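/- Let $d,p,k\in\mathbb N$, let $\Omega$ be an invertible real $p\times p$ matrix, and let $X(x)=\Omega Z(x)$, $x\in\mathbb R^d$, where $Z=(Z_1,\dots,Z_p)^T$ and $Z_1,\dots,Z_p$ are independent Gaussian processes on $\mathbb R^d$ with $E\{Z(x)\}=0$, $E\{Z(x)Z(x)^T\}=I_p$, and $E\{Z(x)Z(y)^T\}=\mathrm{diag}\{K_1(x-y),\dots,K_p(x-y)\}$ for all $x,y$. For each $n$ let $s_1,\dots,s_n\in\mathbb R^d$ be observation points (possibly depending on $n$) with $\|s_i-s_j\|\ge\Delta$ for all $i\ne j$, where $\Delta>0$ does not depend on $n$. Let $f_1,\dots,f_k:\mathbb R^d\to\mathbb R$ be even kernels, and assume that for fixed $A,\alpha>0$ and all $x$, all $a$ and all $l$, $|K_a(x)|$ and $|f_l(x)|$ are at most $A/(1+\|x\|^{d+\alpha})$. Put $f_0(x)=I(x=0)$ and, for $f:\mathbb R^d\to\mathbb R$, $$\widehat M(f)=n^{-1}\sum_{i,j=1}^n f(s_i-s_j)X(s_i)X(s_j)^T,\quad M(f)=n^{-1}\sum_{i,j=1}^n f(s_i-s_j)E\{X(s_i)X(s_j)^T\},\quad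 D(f)=\Omega^{-1}M(f)\Omega^{-T}.$$ Assume that there are $\delta>0$ and $n_0$ such that for all $n\ge n_0$ and all $i\neq j$ in $\{1,\dots,p\}$ there is $l\in\{1,\dots,k\}$ with $|D(f_l)_{i,i}-D(f_l)_{j,j}|\ge\delta$. Let $(\widehat\Gamma_n)$ be any sequence of random $p\times p$ matrices such that for every $n$, almost surely, whenever the set $\{\Gamma:\Gamma\widehat M(f_0)\Gamma^T=I_p\}$ is non-empty, $\widehat\Gamma_n$ maximises $$\sum_{l=1}^k\sum_{j=1}^p\{\gamma_j^T\widehat M(f_l)\gamma_j\}^2$$ over all matrices $\Gamma$ in this set, where $\gamma_1^T,\dots,\gamma_p^T$ denote the rows of $\Gamma$. Then the matrices $F_k$ defined below, which depend on $n$, are positive semidefinite, and there are random permutation matrices $P_n$ and random diagonal matrices $D_n$ with diagonal entries in $\{-1,1\}$ such that the distribution $Q_n$ of $n^{1/2}\mathrm{vect}(D_nP_n\widehat\Gamma_n-\Omega^{-1})$, where $\mathrm{vect}$ is row vectorisation, satisfies $$d_w\{Q_n,\mathcal N(0,F_k)\}\to0\qquad(n\to\infty)$$ for every metric $d_w$ generating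 the topology of weak convergence of Borel probability measures on $\mathbb R^{p^2}$. Here $F_k=M_{\Omega^{-1}}\,G\,\tilde V(f_1,\dots,f_k)\,G^T M_{\Omega^{-1}}^T$, with the following matrices. Positions $1,\dots,p^2$ are identified with pairs $(i,j)$, in row order. - $M_{\Omega^{-1}}$ has entry $(\Omega^{-1})_{j',j}$ at $\{(i,j),(i',j')\}$ if $i=i'$, and $0$ otherwise. - $G=B(A_0,A_1,\dots,A_k)$, where $A_0,\dots,A_k,B$ are diagonal $p^2\times p^2$ matrices. At $(i,i)$ their diagonal entries are $-1/2$ for $A_0$, $0$ for $A_1,\dots,A_k$, and $1$ for $B$. At $(i,j)$ with $i\ne j$ they are $-\sum_{l=1}^k\{D(f_l)_{i,i}-D(f_l)_{j,j}\}D(f_l)_{i,i}$ for $A_0$, $D(f_l)_{i,i}-D(f_l)_{j,j}$ for $A_l$ ($1\le l\le k$), and $[\sum_{l=1}^k\{D(f_l)_{i,i}-D(f_l)_{j,j}\}^2]^{-1}$ for $B$ (with $0^{-1}=0$, which is relevant only for $n<n_0$). - $\tilde V(f_1,\dots,f_k)$ has $(k+1)^2$ blocks of size $p^2\times p^2$.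 For $g,h\in\{0,\dots,k\}$, block $(g+1,h+1)$ has entry $2n^{-1}\mathrm{tr}\{R_zT_{b,c}(f_g)R_zT_{u,v}(f_h)\}$ at $\{(b,c),(u,v)\}$. Here $R_z$ is the $np\times np$ covariance matrix of $(Z(s_1)^T,\dots,Z(s_n)^T)^T$, and $T_{b,c}(f)$ is the $np\times np$ matrix whose $p\times p$ block $(i,j)$ is $f(s_i-s_j)\,\tfrac12(e_be_c^T+e_ce_b^T)$, with $e_1,\dots,e_p$ the standard basis of $\mathbb R^p$. -/

import Mathlib

open MeasureTheory ProbabilityTheory Filter Topology Matrix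

noncomputable section

namespace SBSS

variable {Ω : Type*} [MeasurableSpace Ω] {d p k n : ℕ}

/-- The mixed (observed) field `X(x) = W Z(x)` with mixing matrix `W`. -/
def mixedField (W : Matrix (Fin p) (Fin p) ℝ) (Z : Fin p → EuclideanSpace ℝ (Fin d) → Ω → ℝ)
    (x : EuclideanSpace ℝ (Fin d)) (ω : Ω) : Fin p → ℝ :=
  W *ᵥ fun a => Z a x ω

/-- The kernel `f₀(x) = I(x = 0)`. -/
def kernelZero (x : EuclideanSpace ℝ (Fin d)) : ℝ :=
  Set.indicator {0} (fun _ => (1 : ℝ)) x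

/-- The list of kernels `f₀, f₁, …, f_k`. -/
def kernels (f : Fin k → EuclideanSpace ℝ (Fin d) → ℝ) :
    Fin (k + 1) → EuclideanSpace ℝ (Fin d) → ℝ :=
  Fin.cons kernelZero f

/-- The local covariance matrix
`M̂(g) = n⁻¹ ∑ᵢ ∑ⱼ g(sᵢ - sⱼ) X(sᵢ) X(sⱼ)ᵀ` of the sample at the points `s₁, …, sₙ`. -/
def sampleLocalCov (X : EuclideanSpace ℝ (Fin d) → Ω → Fin p → ℝ)
    (s : Fin n → EuclideanSpace ℝ (Fin d)) (g : EuclideanSpace ℝ (Fin d) → ℝ) (ω : Ω) :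
    Matrix (Fin p) (Fin p) ℝ :=
  (n : ℝ)⁻¹ • ∑ i, ∑ j, g (s i - s j) • vecMulVec (X (s i) ω) (X (s j) ω)

/-- The population local covariance matrix
`M(g) = n⁻¹ ∑ᵢ ∑ⱼ g(sᵢ - sⱼ) E{X(sᵢ) X(sⱼ)ᵀ}`. -/
def popLocalCov (μ : Measure Ω) (X : EuclideanSpace ℝ (Fin d) → Ω → Fin p → ℝ)
    (s : Fin n → EuclideanSpace ℝ (Fin d)) (g : EuclideanSpace ℝ (Fin d) → ℝ) :
    Matrix (Fin p) (Fin p) ℝ :=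
  (n : ℝ)⁻¹ • ∑ i, ∑ j, g (s i - s j) •
    Matrix.of fun a b => ∫ ω, X (s i) ω a * X (s j) ω b ∂μ

/-- The joint diagonalisation criterion `∑ₗ ∑ⱼ (γⱼᵀ Mₗ γⱼ)²`, where `γⱼᵀ` is row `j` of `Γ`. -/
def criterion (M : Fin k → Matrix (Fin p) (Fin p) ℝ) (Γ : Matrix (Fin p) (Fin p) ℝ) : ℝ :=
  ∑ l, ∑ j, (Γ j ⬝ᵥ (M l *ᵥ Γ j)) ^ 2

/-- `Γ` maximises the criterion subject to the constraint `Γ M₀ Γᵀ = I`. -/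
def IsMaximiser (M₀ : Matrix (Fin p) (Fin p) ℝ) (M : Fin k → Matrix (Fin p) (Fin p) ℝ)
    (Γ : Matrix (Fin p) (Fin p) ℝ) : Prop :=
  Γ * M₀ * Γᵀ = 1 ∧
    ∀ Γ' : Matrix (Fin p) (Fin p) ℝ, Γ' * M₀ * Γ'ᵀ = 1 → criterion M Γ' ≤ criterion M Γ

/-- Row vectorisation. The coordinates are indexed by pairs (row, column), in place of their
lexicographic position `(row - 1) p + column`. -/
def vect (A : Matrix (Fin p) (Fin p) ℝ) : EuclideanSpace ℝ (Fin p × Fin p) :=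
  WithLp.toLp 2 fun a => A a.1 a.2

/-- `D(g) = W⁻¹ M(g) W⁻ᵀ`. -/
def unmixedPopCov (μ : Measure Ω) (W : Matrix (Fin p) (Fin p) ℝ)
    (Z : Fin p → EuclideanSpace ℝ (Fin d) → Ω → ℝ)
    (s : Fin n → EuclideanSpace ℝ (Fin d)) (g : EuclideanSpace ℝ (Fin d) → ℝ) :
    Matrix (Fin p) (Fin p) ℝ :=
  W⁻¹ * popLocalCov μ (mixedField W Z) s g * (Wᵀ)⁻¹

/-- The covariance matrix `R_z` of the vector of all `Z_a(sᵢ)`, indexed by the pairs `(i, a)`. -/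
def latentCov (μ : Measure Ω) (Z : Fin p → EuclideanSpace ℝ (Fin d) → Ω → ℝ)
    (s : Fin n → EuclideanSpace ℝ (Fin d)) : Matrix (Fin n × Fin p) (Fin n × Fin p) ℝ :=
  Matrix.of fun u v => cov[Z u.2 (s u.1), Z v.2 (s v.1); μ]

/-- The matrix `T_{b,c}(g)`, with block `(i, j)` equal to
`g(sᵢ - sⱼ) (1/2) (e_b e_cᵀ + e_c e_bᵀ)`. -/
def kernelMatrix (s : Fin n → EuclideanSpace ℝ (Fin d)) (g : EuclideanSpace ℝ (Fin d) → ℝ)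
    (b c : Fin p) : Matrix (Fin n × Fin p) (Fin n × Fin p) ℝ :=
  Matrix.of fun u v => g (s u.1 - s v.1) *
    ((1 / 2 : ℝ) • (Matrix.single b c (1 : ℝ) + Matrix.single c b (1 : ℝ))) u.2 v.2

/-- The matrix with entries `2 n⁻¹ tr{R_z T_{a₁,a₂}(g) R_z T_{b₁,b₂}(h)}`. -/
def sigmaMatrix (μ : Measure Ω) (Z : Fin p → EuclideanSpace ℝ (Fin d) → Ω → ℝ)
    (s : Fin n → EuclideanSpace ℝ (Fin d)) (g h : EuclideanSpace ℝ (Fin d) → ℝ) :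
    Matrix (Fin p × Fin p) (Fin p × Fin p) ℝ :=
  Matrix.of fun a b => 2 * (n : ℝ)⁻¹ *
    (latentCov μ Z s * kernelMatrix s g a.1 a.2 *
      latentCov μ Z s * kernelMatrix s h b.1 b.2).trace

/-- The block matrix `Ṽ(f₁, …, f_k)`, whose blocks are the `sigmaMatrix` of `fᵢ` and `fⱼ`,
`i, j = 0, …, k`. -/
def vTilde (μ : Measure Ω) (Z : Fin p → EuclideanSpace ℝ (Fin d) → Ω → ℝ)
    (s : Fin n → EuclideanSpace ℝ (Fin d)) (f : Fin k → EuclideanSpace ℝ (Fin d) → ℝ) :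
    Matrix (Fin (k + 1) × (Fin p × Fin p)) (Fin (k + 1) × (Fin p × Fin p)) ℝ :=
  Matrix.of fun a b => sigmaMatrix μ Z s (kernels f a.1) (kernels f b.1) a.2 b.2

/-- The diagonal matrix `A₀`, built from the matrices `D l = D(f_l)`. -/
def matA0 (D : Fin k → Matrix (Fin p) (Fin p) ℝ) : Matrix (Fin p × Fin p) (Fin p × Fin p) ℝ :=
  Matrix.diagonal fun a =>
    if a.1 = a.2 then -1 / 2
    else -∑ l, (D l a.1 a.1 - D l a.2 a.2) * D l a.1 a.1

/-- The diagonal matrices `A_l`, `l = 1, …, k`, built from `Dl = D(f_l)`. -/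
def matA (Dl : Matrix (Fin p) (Fin p) ℝ) : Matrix (Fin p × Fin p) (Fin p × Fin p) ℝ :=
  Matrix.diagonal fun a => if a.1 = a.2 then 0 else Dl a.1 a.1 - Dl a.2 a.2

/-- The diagonal matrix `B`. -/
def matB (D : Fin k → Matrix (Fin p) (Fin p) ℝ) : Matrix (Fin p × Fin p) (Fin p × Fin p) ℝ :=
  Matrix.diagonal fun a =>
    if a.1 = a.2 then 1 else (∑ l, (D l a.1 a.1 - D l a.2 a.2) ^ 2)⁻¹

/-- The matrix `(A₀, A₁, …, A_k)` obtained by placing the blocks side by side. -/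
def matARow (D : Fin k → Matrix (Fin p) (Fin p) ℝ) :
    Matrix (Fin p × Fin p) (Fin (k + 1) × (Fin p × Fin p)) ℝ :=
  Matrix.of fun a b =>
    (Fin.cons (matA0 D) (fun l => matA (D l)) :
      Fin (k + 1) → Matrix (Fin p × Fin p) (Fin p × Fin p) ℝ) b.1 a b.2

/-- `G = B (A₀, A₁, …, A_k)`. -/
def matG (D : Fin k → Matrix (Fin p) (Fin p) ℝ) :
    Matrix (Fin p × Fin p) (Fin (k + 1) × (Fin p × Fin p)) ℝ :=
  matB D * matARow D

/-- The matrix of the map `vect E ↦ vect (E W⁻¹)`, with entries `(W⁻¹)_{b₂,a₂}` if `a₁ = b₁` and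
`0` otherwise. -/
def matMInv (W : Matrix (Fin p) (Fin p) ℝ) : Matrix (Fin p × Fin p) (Fin p × Fin p) ℝ :=
  Matrix.of fun a b => if a.1 = b.1 then W⁻¹ b.2 a.2 else 0

/-- The asymptotic covariance matrix `F_k = M G Ṽ Gᵀ Mᵀ` for the points `s₁, …, sₙ`. -/
def asympCov (μ : Measure Ω) (W : Matrix (Fin p) (Fin p) ℝ)
    (Z : Fin p → EuclideanSpace ℝ (Fin d) → Ω → ℝ)
    (s : Fin n → EuclideanSpace ℝ (Fin d)) (f : Fin k → EuclideanSpace ℝ (Fin d) → ℝ) :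
    Matrix (Fin p × Fin p) (Fin p × Fin p) ℝ :=
  matMInv W * matG (fun l => unmixedPopCov μ W Z s (f l)) * vTilde μ Z s f *
    (matG fun l => unmixedPopCov μ W Z s (f l))ᵀ * (matMInv W)ᵀ

/-- The scaled error `n^{1/2} vect(P' P Γ - W⁻¹)`, for a sign matrix `P'`, a permutation
matrix `P` and `Γ`. -/
def scaledError (n : ℕ) (W P' P Γ : Matrix (Fin p) (Fin p) ℝ) :
    EuclideanSpace ℝ (Fin p × Fin p) :=
  √(n : ℝ) • vect (P' * P * Γ - W⁻¹)

/-- `dw` is a metric on the Borel probability measures on `ℝ^{p²}` that generates the topology of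
weak convergence. -/
def GeneratesWeakTopology (p : ℕ) :
    MetricSpace (ProbabilityMeasure (EuclideanSpace ℝ (Fin p × Fin p))) → Prop :=
  fun dw => dw.toUniformSpace.toTopologicalSpace = ProbabilityMeasure.instTopologicalSpace

end SBSS

end

/-! In the variable `U = Γ W` the mixing matrix disappears: `M̂(f₀)` becomes `1 + E₀` and `M̂(f_l)`
becomes `diagonal (d l) + E l`, where `d l` is the diagonal of `D(f_l)`. The errors are centred
quadratic forms in the Gaussian vector of all `Z_a(sᵢ)`, divided by `n`. Separation of the points
and polynomial decay bound the row sums of `R_z` and of the kernel matrices uniformly in `n`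
(`exists_sum_inv_one_add_rpow_le`), so the errors are of order `n^{-1/2}` in mean square.

The deterministic half is `joint_diagonaliser_expansion`. Without errors the maximisers are exactly
the signed permutations, because an orthogonal matrix averages each `d l` over its rows and
averaging loses variance. By compactness, a signed permutation of `U` is then close to the identity
when the errors are small, uniformly over the possible `d`. Write it as `1 + F`. The constraint
determines `F + Fᵀ` to first order, and stationarity under plane rotations gives for each `i ≠ j` a
linear equation for `F i j` with coefficient `∑ₗ (d l i - d l j)² ≥ δ²`. Solving these gives `F =
linearPart + O(η²)` when the errors are at most `η`. In coordinates the linear map is `G`, and right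
multiplication by `W⁻¹` is `M`. The remainder, scaled by `n^{1/2}`, is of order `n^{-1/2}` in
probability.

The probabilistic half is a central limit theorem for quadratic forms. A linear combination of the
errors has the law of a weighted sum of independent centred chi-square variables, with weights
uniformly negligible after scaling. Its characteristic function therefore approaches that of the
Gaussian with the same variance (`norm_charFun_linearError_sub_le`), and this variance is the
quadratic form of `F_k`.

The matrices `F_k` need not converge, but their entries are bounded. Every subsequence has a further
one along which they tend to some `G`; there both laws converge to `N(0, G)`, so their distance
vanishes in any metric of the weak topology (`tendsto_dist_multivariateGaussian`). -/

noncomputable section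

namespace SBSS

/-! ### Joint diagonalisation -/

section JointDiagonalisation

variable {p k : ℕ}

/-- The diagonal matrix of the signs `Q.2`. -/
def signSide (Q : Equiv.Perm (Fin p) × (Fin p → ℤˣ)) : Matrix (Fin p) (Fin p) ℝ :=
  diagonal fun i => ((Q.2 i : ℤ) : ℝ)

/-- The signed permutation matrix attached to a permutation and a family of signs. -/
def signedPerm (Q : Equiv.Perm (Fin p) × (Fin p → ℤˣ)) : Matrix (Fin p) (Fin p) ℝ :=
  signSide Q * Q.1.permMatrix ℝ

lemma signedPerm_mul_apply (Q : Equiv.Perm (Fin p) × (Fin p → ℤˣ))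
    (U : Matrix (Fin p) (Fin p) ℝ) (i j : Fin p) :
    (signedPerm Q * U) i j = ((Q.2 i : ℤ) : ℝ) * U (Q.1 i) j := by
  rw [signedPerm, signSide, Matrix.mul_assoc, diagonal_mul, Equiv.Perm.permMatrix,
    PEquiv.toMatrix_toPEquiv_mul]
  rfl

lemma units_int_cast_sq (u : ℤˣ) : (((u : ℤ) : ℝ)) * ((u : ℤ) : ℝ) = 1 := by
  rcases Int.units_eq_one_or u with h | h <;> simp [h]

lemma signedPerm_mul_transpose (Q : Equiv.Perm (Fin p) × (Fin p → ℤˣ)) :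
    signedPerm Q * (signedPerm Q)ᵀ = 1 := by
  ext i j
  rw [signedPerm_mul_apply, transpose_apply]
  have h : ∀ a b, signedPerm Q a b = ((Q.2 a : ℤ) : ℝ) * (1 : Matrix (Fin p) (Fin p) ℝ) (Q.1 a) b :=
    fun a b => by simpa using signedPerm_mul_apply Q 1 a b
  rw [h]
  by_cases hij : i = j
  · subst hij
    simp [units_int_cast_sq]
  · rw [one_apply_ne hij, one_apply_ne (fun h => hij (Q.1.injective h).symm)]
    simp

/-- The criterion is the sum of squares of the diagonals of `Γ Mₗ Γᵀ`. -/
lemma criterion_eq (M : Fin k → Matrix (Fin p) (Fin p) ℝ) (Γ : Matrix (Fin p) (Fin p) ℝ) :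
    criterion M Γ = ∑ l, ∑ j, ((Γ * M l * Γᵀ) j j) ^ 2 := by
  unfold criterion
  refine Finset.sum_congr rfl fun l _ => Finset.sum_congr rfl fun j _ => ?_
  rw [dotProduct_mulVec, Matrix.mul_apply', ← Matrix.mul_apply_eq_vecMul]
  rfl

/-- The sum over rows absorbs the permutation, and each sign enters a quadratic form twice. This is
the indeterminacy that the random matrices `P` and `D` of the theorem remove. -/
lemma criterion_signedPerm_mul (M : Fin k → Matrix (Fin p) (Fin p) ℝ)
    (Γ : Matrix (Fin p) (Fin p) ℝ) (Q : Equiv.Perm (Fin p) × (Fin p → ℤˣ)) :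
    criterion M (signedPerm Q * Γ) = criterion M Γ := by
  unfold criterion
  refine Finset.sum_congr rfl fun l _ => ?_
  rw [← Equiv.sum_comp Q.1 fun j => (Γ j ⬝ᵥ (M l *ᵥ Γ j)) ^ 2]
  refine Finset.sum_congr rfl fun j _ => ?_
  have h : (signedPerm Q * Γ) j = ((Q.2 j : ℤ) : ℝ) • Γ (Q.1 j) := by
    ext a
    rw [signedPerm_mul_apply]
    rfl
  rw [h, mulVec_smul, smul_dotProduct, dotProduct_smul, smul_smul, units_int_cast_sq, one_smul]

lemma IsMaximiser.signedPerm_mul {M₀ : Matrix (Fin p) (Fin p) ℝ}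
    {M : Fin k → Matrix (Fin p) (Fin p) ℝ} {Γ : Matrix (Fin p) (Fin p) ℝ}
    (h : IsMaximiser M₀ M Γ) (Q : Equiv.Perm (Fin p) × (Fin p → ℤˣ)) :
    IsMaximiser M₀ M (signedPerm Q * Γ) := by
  refine ⟨?_, fun Γ' hΓ' => ?_⟩
  · rw [transpose_mul, show signedPerm Q * Γ * M₀ * (Γᵀ * (signedPerm Q)ᵀ)
      = signedPerm Q * (Γ * M₀ * Γᵀ) * (signedPerm Q)ᵀ by simp only [Matrix.mul_assoc], h.1,
      Matrix.mul_one, signedPerm_mul_transpose]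
  · rw [criterion_signedPerm_mul]
    exact h.2 Γ' hΓ'

/-- Change of coordinates in the maximisation problem. -/
lemma IsMaximiser.unmix {M₀ W : Matrix (Fin p) (Fin p) ℝ} {M : Fin k → Matrix (Fin p) (Fin p) ℝ}
    {Γ : Matrix (Fin p) (Fin p) ℝ} (hW : IsUnit W.det) (h : IsMaximiser M₀ M Γ) :
    IsMaximiser (W⁻¹ * M₀ * (Wᵀ)⁻¹) (fun l => W⁻¹ * M l * (Wᵀ)⁻¹) (Γ * W) := by
  -- The substitution `Γ ↦ Γ W` is a bijection that preserves both the constraint and, through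
  -- `criterion_eq`, the objective.
  have key : ∀ Γ N : Matrix (Fin p) (Fin p) ℝ,
      Γ * W * (W⁻¹ * N * (Wᵀ)⁻¹) * (Γ * W)ᵀ = Γ * N * Γᵀ := fun Γ N => by
    have h1 : W * W⁻¹ = 1 := mul_nonsing_inv W hW
    have h2 : (Wᵀ)⁻¹ * Wᵀ = 1 := nonsing_inv_mul _ (by rwa [det_transpose])
    calc Γ * W * (W⁻¹ * N * (Wᵀ)⁻¹) * (Γ * W)ᵀ
        = Γ * (W * W⁻¹) * N * ((Wᵀ)⁻¹ * Wᵀ) * Γᵀ := by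
          rw [transpose_mul]; simp only [Matrix.mul_assoc]
      _ = Γ * N * Γᵀ := by rw [h1, h2, Matrix.mul_one, Matrix.mul_one]
  refine ⟨by rw [key, h.1], fun Γ' hΓ' => ?_⟩
  have h3 : Γ' * W⁻¹ * W = Γ' := nonsing_inv_mul_cancel_right W _ hW
  have h4 := h.2 (Γ' * W⁻¹) (by rw [← key, h3, hΓ'])
  rw [criterion_eq, criterion_eq] at h4 ⊢
  simp only [key]
  refine le_of_eq_of_le ?_ h4
  refine Finset.sum_congr rfl fun l _ => ?_
  rw [← key (Γ' * W⁻¹), h3]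

/-- An orthogonal matrix that does as well as the identity on diagonal matrices with jointly
distinct diagonals is a signed permutation. -/
lemma exists_signedPerm_mul_eq_one {U : Matrix (Fin p) (Fin p) ℝ} (hU : U * Uᵀ = 1)
    {d : Fin k → Fin p → ℝ} (hd : ∀ i j, i ≠ j → ∃ l, d l i ≠ d l j)
    (hc : criterion (fun l => diagonal (d l)) 1 ≤ criterion (fun l => diagonal (d l)) U) :
    ∃ Q : Equiv.Perm (Fin p) × (Fin p → ℤˣ), signedPerm Q * U = 1 := by
  have hrow : ∀ i j, ∑ a, U i a * U j a = (1 : Matrix (Fin p) (Fin p) ℝ) i j := fun i j => by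
    rw [← hU, Matrix.mul_apply]; rfl
  have hcol : ∀ a, ∑ i, U i a * U i a = 1 := fun a => by
    have h : (Uᵀ * U) a a = 1 := by rw [mul_eq_one_comm.mp hU, one_apply_eq]
    rw [Matrix.mul_apply] at h
    simpa using h
  -- The squared entries of row `j` form a probability vector. `y l j` is the mean of `d l` under
  -- it, and the criterion at `U` is the sum of the squared means.
  set y : Fin k → Fin p → ℝ := fun l j => ∑ a, U j a ^ 2 * d l a with hy
  have hcrit : ∀ V : Matrix (Fin p) (Fin p) ℝ, criterion (fun l => diagonal (d l)) V
      = ∑ l, ∑ j, (∑ a, V j a ^ 2 * d l a) ^ 2 := fun V => by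
    unfold criterion
    refine Finset.sum_congr rfl fun l _ => Finset.sum_congr rfl fun j _ => ?_
    congr 1
    simp only [dotProduct, mulVec_diagonal]
    exact Finset.sum_congr rfl fun a _ => by ring
  have hcrit1 : criterion (fun l => diagonal (d l)) (1 : Matrix (Fin p) (Fin p) ℝ)
      = ∑ l, ∑ j, d l j ^ 2 := by
    rw [hcrit]
    refine Finset.sum_congr rfl fun l _ => Finset.sum_congr rfl fun j _ => ?_
    congr 1
    rw [Finset.sum_eq_single j]
    · simp
    · intro b _ hb
      simp [one_apply_ne hb.symm]
    · simp
  have hvar : ∀ l j, ∑ a, U j a ^ 2 * (d l a - y l j) ^ 2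
      = ∑ a, U j a ^ 2 * d l a ^ 2 - y l j ^ 2 := fun l j => by
    have h1 : ∑ a, U j a ^ 2 = 1 := by
      have := hrow j j
      rw [one_apply_eq] at this
      simpa [sq] using this
    calc ∑ a, U j a ^ 2 * (d l a - y l j) ^ 2
        = ∑ a, (U j a ^ 2 * d l a ^ 2 - 2 * y l j * (U j a ^ 2 * d l a)
            + y l j ^ 2 * U j a ^ 2) := Finset.sum_congr rfl fun a _ => by ring
      _ = ∑ a, U j a ^ 2 * d l a ^ 2 - 2 * y l j * y l j + y l j ^ 2 * 1 := by
          rw [Finset.sum_add_distrib, Finset.sum_sub_distrib, ← Finset.mul_sum, ← Finset.mul_sum,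
            h1]
      _ = _ := by ring
  -- The squared entries are doubly stochastic, so the second moments add up to the criterion at the
  -- identity. Since `U` does at least as well, the variances have a nonpositive sum and all vanish.
  have htot : ∑ l, ∑ j, ∑ a, U j a ^ 2 * (d l a - y l j) ^ 2 ≤ 0 := by
    have h1 : ∀ l, ∑ j, ∑ a, U j a ^ 2 * d l a ^ 2 = ∑ a, d l a ^ 2 := fun l => by
      rw [Finset.sum_comm]
      refine Finset.sum_congr rfl fun a _ => ?_
      rw [← Finset.sum_mul, show ∑ i, U i a ^ 2 = 1 by simpa [sq] using hcol a, one_mul]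
    simp_rw [hvar, Finset.sum_sub_distrib, h1]
    rw [hcrit1, hcrit U] at hc
    linarith
  have hzero : ∀ l j a, U j a ≠ 0 → d l a = y l j := fun l j a hne => by
    have hn : ∀ l ∈ Finset.univ, ∀ j ∈ Finset.univ, ∀ a ∈ (Finset.univ : Finset (Fin p)),
        0 ≤ U j a ^ 2 * (d l a - y l j) ^ 2 := fun _ _ _ _ _ _ => by positivity
    have h0 := le_antisymm htot (Finset.sum_nonneg fun l hl => Finset.sum_nonneg fun j hj =>
      Finset.sum_nonneg (hn l hl j hj))
    rw [Finset.sum_eq_zero_iff_of_nonneg (fun l hl => Finset.sum_nonneg fun j hj =>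
      Finset.sum_nonneg (hn l hl j hj))] at h0
    have h1 := h0 l (Finset.mem_univ _)
    rw [Finset.sum_eq_zero_iff_of_nonneg (fun j hj =>
      Finset.sum_nonneg (hn l (Finset.mem_univ _) j hj))] at h1
    have h2 := h1 j (Finset.mem_univ _)
    rw [Finset.sum_eq_zero_iff_of_nonneg (hn l (Finset.mem_univ _) j (Finset.mem_univ _))] at h2
    have h3 := h2 a (Finset.mem_univ _)
    have h4 : (d l a - y l j) ^ 2 = 0 := by
      rcases mul_eq_zero.mp h3 with h | h
      · exact absurd (pow_eq_zero_iff two_ne_zero |>.mp h) hne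
      · exact h
    linarith [pow_eq_zero_iff two_ne_zero |>.mp h4]
  -- Each `d l` is constant on the support of a row. Joint distinctness reduces this support to one
  -- column.
  have huniq : ∀ j a b, U j a ≠ 0 → U j b ≠ 0 → a = b := fun j a b ha hb => by
    by_contra hab
    obtain ⟨l, hl⟩ := hd a b hab
    exact hl ((hzero l j a ha).trans (hzero l j b hb).symm)
  have hex : ∀ j, ∃ a, U j a ≠ 0 := fun j => by
    by_contra! hcon
    have := hrow j j
    simp [hcon] at this
  choose τ hτ using hex
  have hoff : ∀ j a, a ≠ τ j → U j a = 0 := fun j a ha => by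
    by_contra hne
    exact ha (huniq j a (τ j) hne (hτ j))
  have hsum : ∀ i j, ∑ a, U i a * U j a = U i (τ i) * U j (τ i) := fun i j =>
    Finset.sum_eq_single _ (fun a _ ha => by rw [hoff i a ha, zero_mul]) (by simp)
  have hinj : Function.Injective τ := fun i j hij => by
    by_contra hne
    have h1 := hrow i j
    rw [hsum, one_apply_ne hne, hij] at h1
    rcases mul_eq_zero.mp h1 with h | h
    · exact hτ i (hij ▸ h)
    · exact hτ j h
  have hsq : ∀ j, U j (τ j) * U j (τ j) = 1 := fun j => by
    rw [← hsum, hrow, one_apply_eq]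
  have hsign : ∀ j, ∃ u : ℤˣ, ((u : ℤ) : ℝ) = U j (τ j) := fun j => by
    rcases mul_self_eq_one_iff.mp (hsq j) with h | h
    · exact ⟨1, by simp [h]⟩
    · exact ⟨-1, by simp [h]⟩
  choose u hu using hsign
  let e : Equiv.Perm (Fin p) := Equiv.ofBijective τ (Finite.injective_iff_bijective.mp hinj)
  -- Row `i` of the product reads row `e.symm i` of `U`, whose only nonzero entry is in column `i`.
  -- A sign is its own inverse.
  refine ⟨(e.symm, fun i => u (e.symm i)), ?_⟩
  ext i j
  rw [signedPerm_mul_apply]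
  have hτe : τ (e.symm i) = i := e.apply_symm_apply i
  simp only
  rw [hu, hτe]
  by_cases hij : i = j
  · subst hij
    have := hsq (e.symm i)
    rw [hτe] at this
    rw [this, one_apply_eq]
  · rw [hoff _ j (by rw [hτe]; exact fun h => hij h.symm), one_apply_ne hij, mul_zero]

end JointDiagonalisation

/-! ### Uniform consistency of joint diagonalisers, by compactness -/

section Consistency

open scoped Matrix.Norms.Frobenius

variable {p k : ℕ}

lemma frobenius_norm_sq (A : Matrix (Fin p) (Fin p) ℝ) : ‖A‖ ^ 2 = ∑ i, ∑ j, A i j ^ 2 := by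
  rw [frobenius_norm_def, ← Real.sqrt_eq_rpow, Real.sq_sqrt (by positivity)]
  simp

lemma abs_apply_le_frobenius_norm (A : Matrix (Fin p) (Fin p) ℝ) (i j : Fin p) :
    |A i j| ≤ ‖A‖ := by
  refine abs_le_of_sq_le_sq ?_ (norm_nonneg _)
  rw [frobenius_norm_sq]
  calc A i j ^ 2 ≤ ∑ j, A i j ^ 2 :=
        Finset.single_le_sum (f := fun j => A i j ^ 2) (fun _ _ => sq_nonneg _) (Finset.mem_univ j)
    _ ≤ _ := Finset.single_le_sum (f := fun i => ∑ j, A i j ^ 2)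
        (fun _ _ => Finset.sum_nonneg fun _ _ => sq_nonneg _) (Finset.mem_univ i)

lemma frobenius_norm_le_of_abs_le {A : Matrix (Fin p) (Fin p) ℝ} {c : ℝ} (hc : 0 ≤ c)
    (h : ∀ i j, |A i j| ≤ c) : ‖A‖ ≤ p * c := by
  refine le_of_sq_le_sq ?_ (by positivity)
  rw [frobenius_norm_sq]
  calc ∑ i, ∑ j, A i j ^ 2 ≤ ∑ _i : Fin p, ∑ _j : Fin p, c ^ 2 :=
        Finset.sum_le_sum fun i _ => Finset.sum_le_sum fun j _ => by
          rw [← sq_abs]; gcongr; exact h i j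
    _ = (p * c) ^ 2 := by simp; ring

/-- The constraint reads `U Uᵀ = 1 - U (S₀ - 1) Uᵀ`. Its trace bounds `‖U‖²` by `p + p ‖U‖² ‖S₀ -
1‖`, and the last term is absorbed on the left. -/
lemma frobenius_norm_sq_le_of_mul_eq_one {S₀ U : Matrix (Fin p) (Fin p) ℝ}
    (hU : U * S₀ * Uᵀ = 1) (hS : p * ‖S₀ - 1‖ ≤ 1 / 2) : ‖U‖ ^ 2 ≤ 2 * p := by
  have h1 : U * Uᵀ = 1 - U * (S₀ - 1) * Uᵀ := by
    rw [Matrix.mul_sub, Matrix.sub_mul, hU, Matrix.mul_one]; abel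
  have h2 : ∀ i, ∑ j, U i j ^ 2 ≤ 1 + ‖U‖ ^ 2 * ‖S₀ - 1‖ := fun i => by
    have h3 : ∑ j, U i j ^ 2 = (U * Uᵀ) i i := by
      rw [Matrix.mul_apply]; exact Finset.sum_congr rfl fun j _ => by rw [transpose_apply, sq]
    rw [h3, h1, Matrix.sub_apply, one_apply_eq]
    have h4 := abs_apply_le_frobenius_norm (U * (S₀ - 1) * Uᵀ) i i
    have h5 : ‖U * (S₀ - 1) * Uᵀ‖ ≤ ‖U‖ * ‖S₀ - 1‖ * ‖U‖ := by
      refine (norm_mul_le _ _).trans ?_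
      rw [frobenius_norm_transpose]
      gcongr
      exact norm_mul_le _ _
    have := neg_abs_le ((U * (S₀ - 1) * Uᵀ) i i)
    nlinarith
  have h6 : ‖U‖ ^ 2 ≤ p * (1 + ‖U‖ ^ 2 * ‖S₀ - 1‖) := by
    conv_lhs => rw [frobenius_norm_sq]
    exact (Finset.sum_le_sum fun i _ => h2 i).trans (by simp [mul_add])
  nlinarith [sq_nonneg ‖U‖]

/-- Consistency of joint diagonalisation, uniformly over the diagonal limits. -/
lemma exists_signedPerm_norm_lt (k p : ℕ) (C : ℝ) {δ ε : ℝ} (hδ : 0 < δ) (hε : 0 < ε) :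
    ∃ η > 0, ∀ (d : Fin k → Fin p → ℝ) (S₀ : Matrix (Fin p) (Fin p) ℝ)
      (S : Fin k → Matrix (Fin p) (Fin p) ℝ) (U : Matrix (Fin p) (Fin p) ℝ),
      (∀ l i, |d l i| ≤ C) → (∀ i j, i ≠ j → ∃ l, δ ≤ |d l i - d l j|) →
      ‖S₀ - 1‖ ≤ η → (∀ l, ‖S l - diagonal (d l)‖ ≤ η) → IsMaximiser S₀ S U →
      ∃ Q, ‖signedPerm Q * U - 1‖ < ε := by
  by_contra! hcon
  -- Tolerances for a sequence of counterexamples. The factor `1 / (2p + 1)` keeps `p ‖S₀ - 1‖`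
  -- below `1/2` for every `m`, so all the maximisers are bounded; the factor `1 / (m + 1)` makes
  -- the errors vanish.
  have hpos : ∀ m : ℕ, 0 < 1 / (2 * (p : ℝ) + 1) / ((m : ℝ) + 1) := fun m => by positivity
  choose d S₀ S U hdC hdδ hS₀ hS hmax hfar using fun m : ℕ => hcon _ (hpos m)
  have hη : Tendsto (fun m : ℕ => 1 / (2 * (p : ℝ) + 1) / ((m : ℝ) + 1)) atTop (𝓝 0) :=
    ((tendsto_const_div_atTop_nhds_zero_nat (1 / (2 * (p : ℝ) + 1))).comp
      (tendsto_add_atTop_nat 1)).congr fun m => by simp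
  have hη1 : ∀ m : ℕ, p * ‖S₀ m - 1‖ ≤ 1 / 2 := fun m => by
    have h1 : 1 / (2 * (p : ℝ) + 1) / ((m : ℝ) + 1) ≤ 1 / (2 * (p : ℝ) + 1) :=
      div_le_self (by positivity) (by linarith [(Nat.cast_nonneg m : (0 : ℝ) ≤ m)])
    calc p * ‖S₀ m - 1‖ ≤ p * (1 / (2 * (p : ℝ) + 1)) := by gcongr; exact (hS₀ m).trans h1
      _ ≤ 1 / 2 := by
        rw [mul_one_div, div_le_div_iff₀ (by positivity) (by positivity)]
        linarith
  have hUb : ∀ m, ‖U m‖ ≤ 2 * p + 1 := fun m => by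
    have := frobenius_norm_sq_le_of_mul_eq_one (hmax m).1 (hη1 m)
    nlinarith [norm_nonneg (U m), (Nat.cast_nonneg p : (0 : ℝ) ≤ p)]
  have hC : ∀ m, ‖d m‖ ≤ |C| := fun m => by
    refine (pi_norm_le_iff_of_nonneg (abs_nonneg _)).mpr fun l =>
      (pi_norm_le_iff_of_nonneg (abs_nonneg _)).mpr fun i => ?_
    exact (hdC m l i).trans (le_abs_self C)
  obtain ⟨⟨d', U'⟩, -, φ, hφ, hlim⟩ := tendsto_subseq_of_bounded
    (Metric.isBounded_closedBall (x := (0 : (Fin k → Fin p → ℝ) × Matrix (Fin p) (Fin p) ℝ))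
      (r := max |C| (2 * p + 1))) (x := fun m => (d m, U m)) fun m => by
    rw [mem_closedBall_zero_iff, Prod.norm_def]
    exact max_le_max (hC m) (hUb m)
  have hdlim : Tendsto (fun m => d (φ m)) atTop (𝓝 d') :=
    (continuous_fst.tendsto _).comp hlim
  have hUlim : Tendsto (fun m => U (φ m)) atTop (𝓝 U') :=
    (continuous_snd.tendsto _).comp hlim
  have hηφ := hη.comp hφ.tendsto_atTop
  have hS₀lim : Tendsto (fun m => S₀ (φ m)) atTop (𝓝 1) := by
    exact tendsto_iff_norm_sub_tendsto_zero.mpr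
      (squeeze_zero (fun _ => norm_nonneg _) (fun m => hS₀ (φ m)) hηφ)
  have hSlim : ∀ l, Tendsto (fun m => S (φ m) l) atTop (𝓝 (diagonal (d' l))) := fun l => by
    have h1 : Tendsto (fun m => S (φ m) l - diagonal (d (φ m) l)) atTop (𝓝 0) := by
      exact tendsto_zero_iff_norm_tendsto_zero.mpr
        (squeeze_zero (fun _ => norm_nonneg _) (fun m => hS (φ m) l) hηφ)
    have h2 : Tendsto (fun m => diagonal (d (φ m) l)) atTop (𝓝 (diagonal (d' l))) :=
      ((continuous_id.matrix_diagonal).tendsto (d' l)).comp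
        (((continuous_apply l).tendsto d').comp hdlim)
    simpa using h1.add h2
  have hU' : U' * U'ᵀ = 1 := by
    have h1 : Tendsto (fun m => U (φ m) * S₀ (φ m) * (U (φ m))ᵀ) atTop (𝓝 (U' * 1 * U'ᵀ)) :=
      (hUlim.mul hS₀lim).mul ((continuous_id.matrix_transpose.tendsto U').comp hUlim)
    simp only [(hmax _).1, Matrix.mul_one] at h1
    exact tendsto_nhds_unique h1 tendsto_const_nhds
  have hcont : Continuous fun x : (Fin k → Matrix (Fin p) (Fin p) ℝ) × Matrix (Fin p) (Fin p) ℝ =>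
      criterion x.1 x.2 := by
    simp only [criterion_eq]
    refine continuous_finsetSum _ fun l _ => continuous_finsetSum _ fun j _ => ?_
    refine Continuous.pow ?_ 2
    exact ((continuous_snd.matrix_mul ((continuous_apply l).comp continuous_fst)).matrix_mul
      continuous_snd.matrix_transpose).matrix_elem j j
  have hSlim' : Tendsto (fun m => S (φ m)) atTop (𝓝 fun l => diagonal (d' l)) :=
    tendsto_pi_nhds.mpr hSlim
  -- The competitor `U'ᵀ * U (φ m)` is exactly feasible for the perturbed problem and tends to the
  -- identity. Comparing it with the maximiser and passing to the limit shows that `U'` does at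
  -- least as well as the identity.
  have hcomp : Tendsto (fun m => U'ᵀ * U (φ m)) atTop (𝓝 1) := by
    have := (tendsto_const_nhds (x := U'ᵀ)).mul hUlim
    rwa [mul_eq_one_comm.mp hU'] at this
  have hc : criterion (fun l => diagonal (d' l)) 1 ≤ criterion (fun l => diagonal (d' l)) U' := by
    refine le_of_tendsto_of_tendsto
      ((hcont.tendsto (_, _)).comp (hSlim'.prodMk_nhds hcomp))
      ((hcont.tendsto (_, _)).comp (hSlim'.prodMk_nhds hUlim)) (Eventually.of_forall fun m => ?_)
    refine (hmax (φ m)).2 _ ?_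
    rw [transpose_mul, transpose_transpose,
      show U'ᵀ * U (φ m) * S₀ (φ m) * ((U (φ m))ᵀ * U')
        = U'ᵀ * (U (φ m) * S₀ (φ m) * (U (φ m))ᵀ) * U' by simp only [Matrix.mul_assoc],
      (hmax (φ m)).1, Matrix.mul_one, mul_eq_one_comm.mp hU']
  obtain ⟨Q, hQ⟩ := exists_signedPerm_mul_eq_one hU' (d := d') (fun i j hij => by
    by_contra! heq
    -- The separating index may change with `m`. There are finitely many indices, so if no `d' l`
    -- separated `i` and `j`, all gaps would be below `δ` at one common `m`.
    have h1 : ∀ l, ∀ᶠ m in atTop, |d (φ m) l i - d (φ m) l j| < δ := fun l => by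
      have h2 : ∀ i, Tendsto (fun m => d (φ m) l i) atTop (𝓝 (d' l i)) := fun i =>
        tendsto_pi_nhds.mp (tendsto_pi_nhds.mp hdlim l) i
      have h3 := ((h2 i).sub (h2 j)).abs
      rw [heq l, sub_self, abs_zero] at h3
      exact h3.eventually_lt_const hδ
    obtain ⟨m, hm⟩ := (eventually_all.mpr h1).exists
    obtain ⟨l, hl⟩ := hdδ (φ m) i j hij
    exact absurd (hm l) (not_lt.mpr hl)) hc
  have hfin : Tendsto (fun m => ‖signedPerm Q * U (φ m) - 1‖) atTop (𝓝 0) := by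
    have h1 := ((tendsto_const_nhds (x := signedPerm Q)).mul hUlim)
    rw [hQ] at h1
    exact tendsto_iff_norm_sub_tendsto_zero.mp h1
  obtain ⟨m, hm⟩ := (hfin.eventually_lt_const hε).exists
  exact absurd hm (not_lt.mpr (hfar (φ m) Q))

end Consistency

/-! ### Stationarity under plane rotations -/

section FirstOrder

variable {p k : ℕ}

/-- The Givens rotation in the plane of the coordinates `i` and `j`. -/
def givens (i j : Fin p) (c s : ℝ) : Matrix (Fin p) (Fin p) ℝ :=
  Matrix.of fun a => if a = i then c • Pi.single i 1 + s • Pi.single j 1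
    else if a = j then -s • Pi.single i 1 + c • Pi.single j 1 else Pi.single a 1

lemma givens_left (i j : Fin p) (c s : ℝ) :
    givens i j c s i = c • Pi.single i 1 + s • Pi.single j 1 := by
  funext b
  simp [givens]

lemma givens_right {i j : Fin p} (hij : i ≠ j) (c s : ℝ) :
    givens i j c s j = -s • Pi.single i 1 + c • Pi.single j 1 := by
  funext b
  simp [givens, hij.symm]

lemma givens_other {i j a : Fin p} (hi : a ≠ i) (hj : a ≠ j) (c s : ℝ) :
    givens i j c s a = Pi.single a 1 := by
  funext b
  simp [givens, hi, hj]

lemma givens_mul_transpose {i j : Fin p} (hij : i ≠ j) {c s : ℝ} (h : c ^ 2 + s ^ 2 = 1) :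
    givens i j c s * (givens i j c s)ᵀ = 1 := by
  ext a b
  have hab : (givens i j c s * (givens i j c s)ᵀ) a b = givens i j c s a ⬝ᵥ givens i j c s b := rfl
  rw [hab, one_apply]
  have hji := hij.symm
  rcases eq_or_ne a i with rfl | hai
  · rw [givens_left]
    rcases eq_or_ne b a with rfl | hbi
    · rw [givens_left]; simp [hij, hji]; linarith
    · rcases eq_or_ne b j with rfl | hbj
      · rw [givens_right hij]; simp [hij, hji]; ring
      · rw [givens_other hbi hbj]; simp [hbi, hbj, hbi.symm]
  · rcases eq_or_ne a j with rfl | haj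
    · rw [givens_right hij]
      rcases eq_or_ne b i with rfl | hbi
      · rw [givens_left]; simp [hij, hji]; ring
      · rcases eq_or_ne b a with rfl | hbj
        · rw [givens_right hij]; simp [hij, hji]; linarith
        · rw [givens_other hbi hbj]; simp [hbi, hbj, hbj.symm]
    · rw [givens_other hai haj, single_one_dotProduct]
      rcases eq_or_ne b i with rfl | hbi
      · rw [givens_left]; simp [hai, haj]
      · rcases eq_or_ne b j with rfl | hbj
        · rw [givens_right hij]; simp [hai, haj]
        · rw [givens_other hbi hbj]; simp [Pi.single_apply]

/-- The difference of the two sides is nonnegative and vanishes at `θ = 0`, so its derivative there,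
`-2P`, is zero. -/
lemma two_mul_sin_cos_le_imp_eq_zero {P R : ℝ}
    (h : ∀ θ : ℝ, 2 * Real.sin θ * Real.cos θ * P ≤ Real.sin θ ^ 2 * R) : P = 0 := by
  have hd : HasDerivAt (fun θ => Real.sin θ ^ 2 * R - 2 * Real.sin θ * Real.cos θ * P)
      (-(2 * P)) 0 := by
    have h1 := (((Real.hasDerivAt_sin 0).pow 2).mul_const R).sub
      ((((Real.hasDerivAt_sin 0).const_mul 2).mul (Real.hasDerivAt_cos 0)).mul_const P)
    convert! h1 using 1
    simp
  have hmin : IsLocalMin (fun θ => Real.sin θ ^ 2 * R - 2 * Real.sin θ * Real.cos θ * P) 0 :=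
    Eventually.of_forall fun θ => by
      have := h θ
      simp only [Real.sin_zero]
      linarith
  have := hmin.hasDerivAt_eq_zero hd
  linarith

/-- The first order condition for a maximiser. -/
lemma IsMaximiser.sum_mul_sub_eq_zero {S₀ : Matrix (Fin p) (Fin p) ℝ}
    {S : Fin k → Matrix (Fin p) (Fin p) ℝ} {U : Matrix (Fin p) (Fin p) ℝ}
    (h : IsMaximiser S₀ S U) (hS : ∀ l, (S l)ᵀ = S l) {i j : Fin p} (hij : i ≠ j) :
    ∑ l, (U * S l * Uᵀ) i j * ((U * S l * Uᵀ) i i - (U * S l * Uᵀ) j j) = 0 := by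
  set N : Fin k → Matrix (Fin p) (Fin p) ℝ := fun l => U * S l * Uᵀ with hN
  have hsymm : ∀ l a b, N l a b = N l b a := fun l a b => by
    have : (N l)ᵀ = N l := by
      simp only [hN, transpose_mul, transpose_transpose, hS, Matrix.mul_assoc]
    rw [← this, transpose_apply, this]
  -- A rotation in the plane of `i` and `j` preserves the constraint and alters only the diagonal
  -- entries `i` and `j` of each `N l`.
  have hcirc : ∀ c s : ℝ, c ^ 2 + s ^ 2 = 1 →
      ∑ l, ((c * (c * N l i i + s * N l i j) + s * (c * N l j i + s * N l j j)) ^ 2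
        + (-s * (-s * N l i i + c * N l i j) + c * (-s * N l j i + c * N l j j)) ^ 2)
      ≤ ∑ l, (N l i i ^ 2 + N l j j ^ 2) := fun c s hcs => by
    set V := givens i j c s with hV
    have hle := h.2 (V * U) (by
      rw [transpose_mul, show V * U * S₀ * (Uᵀ * Vᵀ) = V * (U * S₀ * Uᵀ) * Vᵀ by
        simp only [Matrix.mul_assoc], h.1, Matrix.mul_one, givens_mul_transpose hij hcs])
    rw [criterion_eq, criterion_eq, ← sub_nonneg, ← Finset.sum_sub_distrib] at hle
    rw [← sub_nonneg, ← Finset.sum_sub_distrib]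
    refine hle.trans_eq (Finset.sum_congr rfl fun l _ => ?_)
    have hVN : ∀ a, (V * U * S l * (V * U)ᵀ) a a = V a ⬝ᵥ (N l *ᵥ V a) := fun a => by
      rw [transpose_mul, show V * U * S l * (Uᵀ * Vᵀ) = V * N l * Vᵀ by
        simp only [hN, Matrix.mul_assoc], dotProduct_mulVec, Matrix.mul_apply',
        ← Matrix.mul_apply_eq_vecMul]
      rfl
    have hother : ∀ a, a ≠ i → a ≠ j → (V * U * S l * (V * U)ᵀ) a a = N l a a :=
      fun a hai haj => by
        rw [hVN, hV, givens_other hai haj]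
        simp
    have hVi : (V * U * S l * (V * U)ᵀ) i i
        = c * (c * N l i i + s * N l i j) + s * (c * N l j i + s * N l j j) := by
      rw [hVN, hV, givens_left]
      simp [mulVec_add, mulVec_smul, add_dotProduct, smul_dotProduct, hsymm l j i]
    have hVj : (V * U * S l * (V * U)ᵀ) j j
        = -s * (-s * N l i i + c * N l i j) + c * (-s * N l j i + c * N l j j) := by
      rw [hVN, hV, givens_right hij]
      simp [mulVec_add, mulVec_smul, mulVec_neg, add_dotProduct, smul_dotProduct, hsymm l j i]
    rw [← Finset.sum_sub_distrib, ← Finset.sum_subset (Finset.subset_univ {i, j})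
      (fun a _ ha => by
        simp only [Finset.mem_insert, Finset.mem_singleton, not_or] at ha
        rw [hother a ha.1 ha.2, sub_self]), Finset.sum_pair hij, hVi, hVj]
    ring
  -- Rotation by `θ / 2` preserves `N l i i + N l j j` and turns the difference of these entries
  -- into its multiple by `cos θ` plus `2 sin θ * N l i j`. Hence the sum of their squares grows by
  -- `2 sin θ cos θ` times the product in the claim, minus `sin² θ` times the summand of `R`.
  refine two_mul_sin_cos_le_imp_eq_zero
    (R := ∑ l, (((N l i i - N l j j) ^ 2 / 2) - 2 * N l i j ^ 2)) fun θ => ?_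
  have h1 := hcirc (Real.cos (θ / 2)) (Real.sin (θ / 2)) (by rw [add_comm]; exact Real.sin_sq_add_cos_sq _)
  have hs : Real.sin θ = 2 * Real.sin (θ / 2) * Real.cos (θ / 2) := by
    rw [← Real.sin_two_mul]; ring_nf
  have hc : Real.cos θ = Real.cos (θ / 2) ^ 2 - Real.sin (θ / 2) ^ 2 := by
    rw [← Real.cos_two_mul']; ring_nf
  have hcs := Real.sin_sq_add_cos_sq (θ / 2)
  generalize Real.cos (θ / 2) = c at *
  generalize Real.sin (θ / 2) = s at *
  rw [← sub_nonneg, ← Finset.sum_sub_distrib] at h1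
  rw [← sub_nonneg, Finset.mul_sum, Finset.mul_sum, ← Finset.sum_sub_distrib]
  refine h1.trans_eq (Finset.sum_congr rfl fun l _ => ?_)
  rw [hsymm l j i, hs, hc]
  have hs2 : s ^ 2 = 1 - c ^ 2 := by linarith
  have hs3 : s ^ 3 = s * (1 - c ^ 2) := by rw [← hs2]; ring
  have hs4 : s ^ 4 = (1 - c ^ 2) ^ 2 := by rw [← hs2]; ring
  ring_nf
  simp only [hs2, hs3, hs4]
  ring

end FirstOrder

/-! ### First order expansion of the joint diagonaliser -/

section Expansion

open scoped Matrix.Norms.Frobenius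

variable {p k : ℕ}

/-- The linear part of the joint diagonaliser of `1 + E₀` and `diagonal (d l) + E l`. -/
def linearPart (d : Fin k → Fin p → ℝ) (E₀ : Matrix (Fin p) (Fin p) ℝ)
    (E : Fin k → Matrix (Fin p) (Fin p) ℝ) (i j : Fin p) : ℝ :=
  if i = j then -1 / 2 * E₀ i i
  else (∑ l, (d l i - d l j) ^ 2)⁻¹ * ∑ l, (d l i - d l j) * (E l i j - d l i * E₀ i j)

lemma sq_le_sum_sq_sub {d : Fin k → Fin p → ℝ} {δ : ℝ} (hδ : 0 < δ) {i j : Fin p}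
    (h : ∃ l, δ ≤ |d l i - d l j|) : δ ^ 2 ≤ ∑ l, (d l i - d l j) ^ 2 := by
  obtain ⟨l, hl⟩ := h
  calc δ ^ 2 ≤ (d l i - d l j) ^ 2 := by rw [← sq_abs (d l i - d l j)]; gcongr
    _ ≤ _ := Finset.single_le_sum (f := fun l => (d l i - d l j) ^ 2)
      (fun _ _ => sq_nonneg _) (Finset.mem_univ l)

lemma frobenius_norm_diagonal_le {d : Fin p → ℝ} {C : ℝ} (hC : 0 ≤ C) (h : ∀ i, |d i| ≤ C) :
    ‖(diagonal d : Matrix (Fin p) (Fin p) ℝ)‖ ≤ p * C := by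
  refine frobenius_norm_le_of_abs_le hC fun i j => ?_
  by_cases hij : i = j
  · subst hij; simpa using h i
  · rw [diagonal_apply_ne _ hij, abs_zero]; exact hC

lemma abs_linearPart_le {d : Fin k → Fin p → ℝ} {C δ η : ℝ} (hC : 0 ≤ C) (hδ : 0 < δ)
    (hd : ∀ l i, |d l i| ≤ C) (hgap : ∀ i j, i ≠ j → ∃ l, δ ≤ |d l i - d l j|)
    {E₀ : Matrix (Fin p) (Fin p) ℝ} {E : Fin k → Matrix (Fin p) (Fin p) ℝ}
    (h0 : ‖E₀‖ ≤ η) (hE : ∀ l, ‖E l‖ ≤ η) (i j : Fin p) :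
    |linearPart d E₀ E i j| ≤ (1 + (δ ^ 2)⁻¹ * (k * (2 * C * (1 + C)))) * η := by
  have hη : 0 ≤ η := (norm_nonneg _).trans h0
  unfold linearPart
  split_ifs with hij
  · have h1 := (abs_apply_le_frobenius_norm E₀ i i).trans h0
    rw [abs_mul, show |(-1 / 2 : ℝ)| = 1 / 2 by rw [abs_of_neg] <;> norm_num]
    have : 0 ≤ (δ ^ 2)⁻¹ * (k * (2 * C * (1 + C))) * η := by positivity
    linarith
  · have hS := sq_le_sum_sq_sub hδ (hgap i j hij)
    rw [abs_mul, abs_of_nonneg (inv_nonneg.mpr ((sq_nonneg δ).trans hS))]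
    have h1 : |∑ l, (d l i - d l j) * (E l i j - d l i * E₀ i j)| ≤ k * (2 * C * (1 + C)) * η := by
      refine (Finset.abs_sum_le_sum_abs _ _).trans ?_
      calc ∑ l, |(d l i - d l j) * (E l i j - d l i * E₀ i j)|
          ≤ ∑ _l : Fin k, (C + C) * (η + C * η) := Finset.sum_le_sum fun l _ => by
            rw [abs_mul]
            refine mul_le_mul ((abs_sub _ _).trans (add_le_add (hd l i) (hd l j)))
              ((abs_sub _ _).trans (add_le_add
                ((abs_apply_le_frobenius_norm _ i j).trans (hE l)) ?_)) (abs_nonneg _)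
              (by positivity)
            rw [abs_mul]
            exact mul_le_mul (hd l i) ((abs_apply_le_frobenius_norm _ i j).trans h0)
              (abs_nonneg _) hC
        _ = _ := by simp; ring
    have h2 : (∑ l, (d l i - d l j) ^ 2)⁻¹ ≤ (δ ^ 2)⁻¹ := inv_anti₀ (by positivity) hS
    calc (∑ l, (d l i - d l j) ^ 2)⁻¹ * |∑ l, (d l i - d l j) * (E l i j - d l i * E₀ i j)|
        ≤ (δ ^ 2)⁻¹ * (k * (2 * C * (1 + C)) * η) := by gcongr
      _ ≤ _ := by nlinarith

/-- The second order bound for a maximiser near the identity. -/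
lemma exists_abs_sub_linearPart_le (k p : ℕ) {C δ : ℝ} (hC : 0 ≤ C) (hδ : 0 < δ) :
    ∃ K ≥ 0, ∀ (d : Fin k → Fin p → ℝ) (E₀ : Matrix (Fin p) (Fin p) ℝ)
      (E : Fin k → Matrix (Fin p) (Fin p) ℝ) (F : Matrix (Fin p) (Fin p) ℝ) (η : ℝ),
      (∀ l i, |d l i| ≤ C) → (∀ i j, i ≠ j → ∃ l, δ ≤ |d l i - d l j|) →
      (∀ l, (E l)ᵀ = E l) → ‖E₀‖ ≤ η → (∀ l, ‖E l‖ ≤ η) → η ≤ 1 → ‖F‖ ≤ 1 →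
      IsMaximiser (1 + E₀) (fun l => diagonal (d l) + E l) (1 + F) →
      ∀ i j, |F i j - linearPart d E₀ E i j| ≤ K * (‖F‖ + η) ^ 2 := by
  -- With `g = ‖F‖ + η ≤ 2`, `c₁ * g ^ 2` bounds the quadratic remainder `R l` of a rotated matrix,
  -- and `c₂ * g` bounds its whole deviation `T l` from `diagonal (d l)`.
  set c₁ : ℝ := p * C + 2 with hc₁
  set c₂ : ℝ := 1 + 2 * (p * C) + 2 * c₁ with hc₂
  have hpC : 0 ≤ p * C := by positivity
  have hc₁0 : 0 ≤ c₁ := by positivity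
  have hc₂0 : 0 ≤ c₂ := by positivity
  clear_value c₂ c₁
  refine ⟨1 + (δ ^ 2)⁻¹ * (k * (c₂ * (2 * c₂) + 2 * C * (c₁ + C * 2))), by positivity, ?_⟩
  intro d E₀ E F η hd hgap hEs hE₀ hE hη1 hF1 hmax i j
  have hη : 0 ≤ η := (norm_nonneg _).trans hE₀
  set m := ‖F‖ with hm
  have hm0 : 0 ≤ m := norm_nonneg _
  set g := m + η with hg
  have hg0 : 0 ≤ g := by positivity
  have hg2 : g ≤ 2 := by linarith
  have hFT : ‖Fᵀ‖ = m := frobenius_norm_transpose F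
  have hD : ∀ l, ‖(diagonal (d l) : Matrix (Fin p) (Fin p) ℝ)‖ ≤ p * C :=
    fun l => frobenius_norm_diagonal_le hC (hd l)
  have hmulle : ∀ {A B : Matrix (Fin p) (Fin p) ℝ} {a b : ℝ}, ‖A‖ ≤ a → ‖B‖ ≤ b →
      ‖A * B‖ ≤ a * b := fun hA hB =>
    (norm_mul_le _ _).trans (mul_le_mul hA hB (norm_nonneg _) ((norm_nonneg _).trans hA))
  -- the constraint
  set R₀ := F * Fᵀ + F * E₀ + E₀ * Fᵀ + F * E₀ * Fᵀ with hR₀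
  have hcon : F + Fᵀ + E₀ + R₀ = 0 := by
    have h1 := hmax.1
    rw [transpose_add, transpose_one] at h1
    have h2 : (1 + F) * (1 + E₀) * (1 + Fᵀ) = 1 + (F + Fᵀ + E₀ + R₀) := by
      rw [hR₀]; noncomm_ring
    rw [h2] at h1
    simpa using h1
  have hR₀le : ‖R₀‖ ≤ 2 * g ^ 2 := by
    have h1 : ‖R₀‖ ≤ m * m + m * η + η * m + m * η * m := by
      rw [hR₀]
      refine norm_add_le_of_le (norm_add_le_of_le (norm_add_le_of_le ?_ ?_) ?_) ?_
      · exact hmulle le_rfl hFT.le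
      · exact hmulle le_rfl hE₀
      · exact hmulle hE₀ hFT.le
      · exact hmulle (hmulle le_rfl hE₀) hFT.le
    have h2 : m * η * m ≤ m * m := by nlinarith [mul_nonneg hm0 hm0]
    have h3 : 0 ≤ m * η := by positivity
    nlinarith [sq_nonneg η]
  -- the rotated matrices
  set R : Fin k → Matrix (Fin p) (Fin p) ℝ := fun l =>
    F * E l + E l * Fᵀ + F * diagonal (d l) * Fᵀ + F * E l * Fᵀ with hR
  have hRle : ∀ l, ‖R l‖ ≤ c₁ * g ^ 2 := fun l => by
    have h1 : ‖R l‖ ≤ m * η + η * m + m * (p * C) * m + m * η * m := by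
      simp only [hR]
      refine norm_add_le_of_le (norm_add_le_of_le (norm_add_le_of_le ?_ ?_) ?_) ?_
      · exact hmulle le_rfl (hE l)
      · exact hmulle (hE l) hFT.le
      · exact hmulle (hmulle le_rfl (hD l)) hFT.le
      · exact hmulle (hmulle le_rfl (hE l)) hFT.le
    have h2 : m * η * m ≤ m * m := by nlinarith [mul_nonneg hm0 hm0]
    have h3 : 0 ≤ m * η := by positivity
    have h4 : (p * C) * (m * m) ≤ (p * C) * g ^ 2 := by
      refine mul_le_mul_of_nonneg_left ?_ hpC
      nlinarith [sq_nonneg η]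
    have h5 : m * η + η * m + m * m ≤ 2 * g ^ 2 := by nlinarith [sq_nonneg η, sq_nonneg m]
    calc ‖R l‖ ≤ _ := h1
      _ ≤ (p * C) * (m * m) + (m * η + η * m + m * m) := by nlinarith
      _ ≤ (p * C) * g ^ 2 + 2 * g ^ 2 := add_le_add h4 h5
      _ = c₁ * g ^ 2 := by rw [hc₁]; ring
  set N : Fin k → Matrix (Fin p) (Fin p) ℝ := fun l =>
    (1 + F) * (diagonal (d l) + E l) * (1 + F)ᵀ with hN
  have hNeq : ∀ l, N l = diagonal (d l)
      + (E l + F * diagonal (d l) + diagonal (d l) * Fᵀ + R l) := fun l => by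
    simp only [hN, hR, transpose_add, transpose_one]
    noncomm_ring
  set T : Fin k → Matrix (Fin p) (Fin p) ℝ := fun l =>
    E l + F * diagonal (d l) + diagonal (d l) * Fᵀ + R l with hT
  have hTle : ∀ l, ‖T l‖ ≤ c₂ * g := fun l => by
    have h1 : ‖T l‖ ≤ η + m * (p * C) + (p * C) * m + c₁ * g ^ 2 := by
      simp only [hT]
      refine norm_add_le_of_le (norm_add_le_of_le (norm_add_le_of_le (hE l) ?_) ?_) (hRle l)
      · exact hmulle le_rfl (hD l)
      · exact hmulle (hD l) hFT.le
    have h2 : c₁ * g ^ 2 ≤ 2 * c₁ * g := by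
      have : g ^ 2 ≤ 2 * g := by nlinarith
      nlinarith
    have h3 : m * (p * C) + (p * C) * m ≤ 2 * (p * C) * g := by
      have : m ≤ g := by linarith
      nlinarith
    rw [hc₂]
    nlinarith
  have hTij : ∀ l a b, |T l a b| ≤ c₂ * g := fun l a b =>
    (abs_apply_le_frobenius_norm _ a b).trans (hTle l)
  have hRij : ∀ l a b, |R l a b| ≤ c₁ * g ^ 2 := fun l a b =>
    (abs_apply_le_frobenius_norm _ a b).trans (hRle l)
  have hR₀ij : ∀ a b, |R₀ a b| ≤ 2 * g ^ 2 := fun a b =>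
    (abs_apply_le_frobenius_norm _ a b).trans hR₀le
  have hconij : ∀ a b, F a b + F b a + E₀ a b + R₀ a b = 0 := fun a b => by
    have : (F + Fᵀ + E₀ + R₀) a b = 0 := by rw [hcon]; rfl
    simpa using this
  have hrest : 0 ≤ (δ ^ 2)⁻¹ * (k * (c₂ * (2 * c₂) + 2 * C * (c₁ + C * 2))) * g ^ 2 := by positivity
  unfold linearPart
  split_ifs with hij
  · subst hij
    have h1 := hconij i i
    have h2 : F i i - -1 / 2 * E₀ i i = -(1 / 2) * R₀ i i := by linarith
    rw [h2, abs_mul, abs_neg, abs_of_pos (by norm_num : (0 : ℝ) < 1 / 2)]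
    linarith [hR₀ij i i]
  · have hfirst := hmax.sum_mul_sub_eq_zero (fun l => by
      rw [transpose_add, diagonal_transpose, hEs]) hij
    change ∑ l, N l i j * (N l i i - N l j j) = 0 at hfirst
    have hNij : ∀ l, N l i j = T l i j := fun l => by
      rw [hNeq, Matrix.add_apply, diagonal_apply_ne _ hij, zero_add]
    have hNii : ∀ l a, N l a a = d l a + T l a a := fun l a => by
      rw [hNeq, Matrix.add_apply, diagonal_apply_eq]
    simp only [hNij, hNii] at hfirst
    -- The off-diagonal entry involves both `F i j` and `F j i`. The constraint eliminates the
    -- latter, and this is how `E₀` enters the off-diagonal linear part.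
    have hTeq : ∀ l, T l i j
        = E l i j - d l i * E₀ i j - F i j * (d l i - d l j) + (R l i j - d l i * R₀ i j) :=
      fun l => by
        have h1 : T l i j = E l i j + F i j * d l j + d l i * F j i + R l i j := by
          simp only [hT, Matrix.add_apply, mul_diagonal, diagonal_mul, transpose_apply]
        have h2 : F j i = - F i j - E₀ i j - R₀ i j := by linarith [hconij i j]
        rw [h1, h2]; ring
    have hS := sq_le_sum_sq_sub hδ (hgap i j hij)
    have hSpos : 0 < ∑ l, (d l i - d l j) ^ 2 := lt_of_lt_of_le (by positivity) hS
    -- In the stationarity equation, `T l i j` is multiplied by `d l i - d l j` plus `T l i i - T l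
    -- j j`. The second product is already quadratic, so it joins the remainders, and what is left
    -- is linear in `F i j`.
    set Zs := ∑ l, (T l i j * (T l i i - T l j j)
      + (d l i - d l j) * (R l i j - d l i * R₀ i j)) with hZs
    have hkey : F i j * ∑ l, (d l i - d l j) ^ 2
        - ∑ l, (d l i - d l j) * (E l i j - d l i * E₀ i j) = Zs := by
      have h1 : Zs - (F i j * ∑ l, (d l i - d l j) ^ 2
          - ∑ l, (d l i - d l j) * (E l i j - d l i * E₀ i j)) = 0 := by
        rw [← hfirst, hZs, Finset.mul_sum, ← Finset.sum_sub_distrib, ← Finset.sum_sub_distrib]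
        refine Finset.sum_congr rfl fun l _ => ?_
        linear_combination (-(d l i - d l j)) * hTeq l
      linarith
    have hZle : |Zs| ≤ k * (c₂ * (2 * c₂) + 2 * C * (c₁ + C * 2)) * g ^ 2 := by
      refine (Finset.abs_sum_le_sum_abs _ _).trans ?_
      calc _ ≤ ∑ _l : Fin k, (c₂ * g * (c₂ * g + c₂ * g)
            + (C + C) * (c₁ * g ^ 2 + C * (2 * g ^ 2))) := Finset.sum_le_sum fun l _ => by
            refine (abs_add_le _ _).trans (add_le_add ?_ ?_)
            · rw [abs_mul]
              exact mul_le_mul (hTij l i j)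
                ((abs_sub _ _).trans (add_le_add (hTij l i i) (hTij l j j)))
                (abs_nonneg _) (by positivity)
            · rw [abs_mul]
              refine mul_le_mul ((abs_sub _ _).trans (add_le_add (hd l i) (hd l j)))
                ((abs_sub _ _).trans (add_le_add (hRij l i j) ?_)) (abs_nonneg _) (by positivity)
              rw [abs_mul]
              exact mul_le_mul (hd l i) (hR₀ij i j) (abs_nonneg _) hC
        _ = _ := by simp; ring
    have heq : F i j - (∑ l, (d l i - d l j) ^ 2)⁻¹
        * ∑ l, (d l i - d l j) * (E l i j - d l i * E₀ i j)
        = (∑ l, (d l i - d l j) ^ 2)⁻¹ * Zs := by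
      rw [← hkey, mul_sub, mul_comm (F i j), inv_mul_cancel_left₀ hSpos.ne']
    rw [heq, abs_mul, abs_of_pos (inv_pos.mpr hSpos)]
    have h2 : (∑ l, (d l i - d l j) ^ 2)⁻¹ ≤ (δ ^ 2)⁻¹ := inv_anti₀ (by positivity) hS
    calc (∑ l, (d l i - d l j) ^ 2)⁻¹ * |Zs|
        ≤ (δ ^ 2)⁻¹ * (k * (c₂ * (2 * c₂) + 2 * C * (c₁ + C * 2)) * g ^ 2) := by gcongr
      _ ≤ _ := by
        rw [add_mul, one_mul, ← mul_assoc (δ ^ 2)⁻¹]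
        exact le_add_of_nonneg_left (sq_nonneg g)

/-- First order expansion of the joint diagonaliser, uniform in the diagonal limits. -/
theorem joint_diagonaliser_expansion (k p : ℕ) {C δ : ℝ} (hC : 0 ≤ C) (hδ : 0 < δ) :
    ∃ η₀ > 0, ∃ ε > 0, ∃ K ≥ 0, ∀ (d : Fin k → Fin p → ℝ) (E₀ : Matrix (Fin p) (Fin p) ℝ)
      (E : Fin k → Matrix (Fin p) (Fin p) ℝ) (U : Matrix (Fin p) (Fin p) ℝ) (η : ℝ),
      (∀ l i, |d l i| ≤ C) → (∀ i j, i ≠ j → ∃ l, δ ≤ |d l i - d l j|) →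
      (∀ l, (E l)ᵀ = E l) → ‖E₀‖ ≤ η → (∀ l, ‖E l‖ ≤ η) → η ≤ η₀ →
      IsMaximiser (1 + E₀) (fun l => diagonal (d l) + E l) U →
      (∃ Q, ‖signedPerm Q * U - 1‖ < ε) ∧
      ∀ Q, ‖signedPerm Q * U - 1‖ < ε →
        ∀ i j, |(signedPerm Q * U - 1) i j - linearPart d E₀ E i j| ≤ K * η ^ 2 := by
  obtain ⟨K, hK0, hK⟩ := exists_abs_sub_linearPart_le k p hC hδ
  set L : ℝ := 1 + (δ ^ 2)⁻¹ * (k * (2 * C * (1 + C))) with hL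
  have hL0 : 0 ≤ L := by positivity
  -- This makes `p K ε ≤ 1/4`, so the quadratic term in the bound for `‖F‖` is at most half of `‖F‖
  -- + η` and can be absorbed.
  set ε : ℝ := min 1 (1 / (4 * (p * K + 1))) with hε
  have hε0 : 0 < ε := lt_min one_pos (by positivity)
  have hε1 : ε ≤ 1 := min_le_left _ _
  have hpK : p * K * ε ≤ 1 / 4 := by
    calc p * K * ε ≤ (p * K + 1) * (1 / (4 * (p * K + 1))) := by
          refine mul_le_mul (by linarith) (min_le_right _ _) hε0.le (by positivity)
      _ = 1 / 4 := by field_simp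
  obtain ⟨η₁, hη₁, hcons⟩ := exists_signedPerm_norm_lt k p C hδ hε0
  refine ⟨min η₁ ε, lt_min hη₁ hε0, ε, hε0, K * (2 * p * L + 2) ^ 2, by positivity, ?_⟩
  intro d E₀ E U η hd hgap hEs hE₀ hE hηle hmax
  have hη0 : 0 ≤ η := (norm_nonneg _).trans hE₀
  have hη1 := hηle.trans (min_le_left _ _)
  have hη2 := hηle.trans (min_le_right _ _)
  refine ⟨hcons d _ _ U hd hgap (by simpa using hE₀.trans hη1)
    (fun l => by simpa using (hE l).trans hη1) hmax, fun Q hQ i j => ?_⟩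
  set F := signedPerm Q * U - 1 with hF
  have hmaxF : IsMaximiser (1 + E₀) (fun l => diagonal (d l) + E l) (1 + F) := by
    rw [hF, add_sub_cancel]; exact hmax.signedPerm_mul Q
  have hexp := hK d E₀ E F η hd hgap hEs hE₀ hE (hη2.trans hε1) (hQ.le.trans hε1) hmaxF
  have hFle : ‖F‖ ≤ p * (L * η + K * (‖F‖ + η) ^ 2) := by
    refine frobenius_norm_le_of_abs_le (by positivity) fun a b => ?_
    have h1 := abs_linearPart_le hC hδ hd hgap hE₀ hE a b
    have h2 := hexp a b
    have h3 : F a b = linearPart d E₀ E a b + (F a b - linearPart d E₀ E a b) := by ring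
    rw [h3]
    exact (abs_add_le _ _).trans (add_le_add h1 h2)
  have hm0 : 0 ≤ ‖F‖ := norm_nonneg _
  -- Bootstrap: closeness within `ε` improves to `‖F‖ = O(η)`, which turns the remainder into
  -- `O(η²)`.
  have hFη : ‖F‖ + η ≤ (2 * p * L + 2) * η := by
    have h1 : p * K * (‖F‖ + η) ^ 2 ≤ 1 / 2 * (‖F‖ + η) := by
      have h2 : p * K * (‖F‖ + η) ≤ 1 / 2 := by
        calc p * K * (‖F‖ + η) ≤ p * K * (ε + ε) := by gcongr
          _ ≤ 1 / 2 := by linarith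
      calc p * K * (‖F‖ + η) ^ 2 = p * K * (‖F‖ + η) * (‖F‖ + η) := by ring
        _ ≤ 1 / 2 * (‖F‖ + η) := by gcongr
    nlinarith
  calc |F i j - linearPart d E₀ E i j| ≤ K * (‖F‖ + η) ^ 2 := hexp i j
    _ ≤ K * ((2 * p * L + 2) * η) ^ 2 := by gcongr
    _ = _ := by ring

end Expansion

/-! ### Gaussian moments and the centred chi-square law -/

section ChiSquare

/-- The moment is the fourth derivative at `0` of the moment generating function `exp (t² / 2)`. -/
lemma integral_pow_four_gaussianReal : ∫ w, w ^ 4 ∂(gaussianReal 0 1) = 3 := by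
  have h0 : (0 : ℝ) ∈ interior (integrableExpSet (fun x : ℝ => x) (gaussianReal 0 1)) := by simp
  have h1 := iteratedDeriv_mgf_zero h0 4
  have h2 : (∫ w, w ^ 4 ∂(gaussianReal 0 1)) = (gaussianReal 0 1)[(fun x : ℝ => x) ^ 4] := rfl
  rw [h2, ← h1, mgf_fun_id_gaussianReal]
  have hE : ∀ t : ℝ, HasDerivAt (fun t : ℝ => Real.exp (0 * t + ((1 : NNReal) : ℝ) * t ^ 2 / 2))
      (t * Real.exp (0 * t + ((1 : NNReal) : ℝ) * t ^ 2 / 2)) t := fun t => by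
    have h3 : HasDerivAt (fun t : ℝ => 0 * t + ((1 : NNReal) : ℝ) * t ^ 2 / 2) t t := by
      have := (((hasDerivAt_id t).const_mul 0).add
        ((((hasDerivAt_id t).pow 2).const_mul ((1 : NNReal) : ℝ)).div_const 2))
      convert! this using 1
      simp
    simpa [mul_comm] using h3.exp
  set e : ℝ → ℝ := fun t => Real.exp (0 * t + ((1 : NNReal) : ℝ) * t ^ 2 / 2) with he
  have d1 : deriv e = fun t => t * e t := funext fun t => (hE t).deriv
  have d2 : deriv (fun t => t * e t) = fun t => (t ^ 2 + 1) * e t := funext fun t => by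
    have h : HasDerivAt (fun t => t * e t) _ t := (hasDerivAt_id' t).mul (hE t)
    rw [h.deriv]; simp only [he]; ring
  have d3 : deriv (fun t => (t ^ 2 + 1) * e t) = fun t => (t ^ 3 + 3 * t) * e t :=
    funext fun t => by
      have h : HasDerivAt (fun t => (t ^ 2 + 1) * e t) _ t :=
        (((hasDerivAt_id' t).pow 2).add_const 1).mul (hE t)
      rw [h.deriv]; simp [he]; ring
  have d4 : deriv (fun t => (t ^ 3 + 3 * t) * e t) = fun t => (t ^ 4 + 6 * t ^ 2 + 3) * e t :=
    funext fun t => by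
      have h : HasDerivAt (fun t => (t ^ 3 + 3 * t) * e t) _ t :=
        (((hasDerivAt_id' t).pow 3).add ((hasDerivAt_id' t).const_mul 3)).mul (hE t)
      rw [h.deriv]; simp [he]; ring
  rw [iteratedDeriv_succ, iteratedDeriv_succ, iteratedDeriv_succ, iteratedDeriv_one, d1, d2, d3, d4]
  simp [he]

lemma integral_sq_gaussianReal : ∫ w, w ^ 2 ∂(gaussianReal 0 1) = 1 := by
  have h := variance_fun_id_gaussianReal (μ := 0) (v := 1)
  rw [variance_eq_sub (by exact memLp_id_gaussianReal 2)] at h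
  simpa using h

lemma integrable_pow_gaussianReal (n : ℕ) : Integrable (fun w : ℝ => w ^ n) (gaussianReal 0 1) := by
  rcases Nat.eq_zero_or_pos n with rfl | hn
  · simp
  · have h : MemLp (fun x : ℝ => x) n (gaussianReal 0 1) := memLp_id_gaussianReal n
    have h2 := h.integrable_norm_pow hn.ne'
    rw [← integrable_norm_iff (by fun_prop)]
    simpa using h2

lemma integral_sq_sub_one_gaussianReal : ∫ w, (w ^ 2 - 1) ∂(gaussianReal 0 1) = 0 := by
  rw [integral_sub (integrable_pow_gaussianReal 2) (integrable_const _), integral_sq_gaussianReal]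
  simp

lemma integral_sq_sub_one_sq_gaussianReal :
    ∫ w, (w ^ 2 - 1) ^ 2 ∂(gaussianReal 0 1) = 2 := by
  have h : (fun w : ℝ => (w ^ 2 - 1) ^ 2) = fun w => w ^ 4 - 2 * w ^ 2 + 1 := by
    funext w; ring
  rw [h, integral_add _ (integrable_const _), integral_sub (integrable_pow_gaussianReal 4)
    ((integrable_pow_gaussianReal 2).const_mul 2), integral_const_mul, integral_sq_gaussianReal,
    integral_pow_four_gaussianReal]
  · simp; norm_num
  · exact (integrable_pow_gaussianReal 4).sub ((integrable_pow_gaussianReal 2).const_mul 2)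

lemma memLp_sq_sub_one_gaussianReal :
    MemLp (fun w : ℝ => w ^ 2 - 1) 2 (gaussianReal 0 1) := by
  rw [memLp_two_iff_integrable_sq (by fun_prop)]
  exact .of_integral_ne_zero (by rw [integral_sq_sub_one_sq_gaussianReal]; norm_num)

/-- The centred chi-square distribution with one degree of freedom. -/
def centredChiSq : Measure ℝ := (gaussianReal 0 1).map fun w => w ^ 2 - 1

instance : IsProbabilityMeasure centredChiSq :=
  Measure.isProbabilityMeasure_map (by fun_prop)

/-- The law has mean `0` and variance `2`, so both functions equal `1 - u² + o(u²)`. The factor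
`(√2)⁻¹` in the proof normalises the variance for the Taylor expansion `taylor_charFun_two`. -/
lemma charFun_centredChiSq_sub_isLittleO :
    (fun u : ℝ => charFun centredChiSq u - Complex.exp (-(u : ℂ) ^ 2)) =o[𝓝 0]
      fun u : ℝ => u ^ 2 := by
  have h2 : (0 : ℝ) < √2 := by positivity
  have hs : √2 * √2 = 2 := Real.mul_self_sqrt (by norm_num)
  set X : ℝ → ℝ := fun w => (√2)⁻¹ * (w ^ 2 - 1) with hX
  have h0 : (gaussianReal 0 1)[X] = 0 := by
    simp only [hX]
    rw [integral_const_mul, integral_sq_sub_one_gaussianReal, mul_zero]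
  have h1 : (gaussianReal 0 1)[X ^ 2] = 1 := by
    have : X ^ 2 = fun w => 2⁻¹ * (w ^ 2 - 1) ^ 2 := by
      funext w
      simp only [hX, Pi.pow_apply, mul_pow, inv_pow]
      rw [Real.sq_sqrt (by norm_num)]
    rw [this, integral_const_mul, integral_sq_sub_one_sq_gaussianReal]
    norm_num
  have hmeas : AEMeasurable X (gaussianReal 0 1) := by fun_prop
  have ht : Tendsto (fun u : ℝ => √2 * u) (𝓝 0) (𝓝 0) := by
    have : Continuous fun u : ℝ => √2 * u := by fun_prop
    simpa using this.tendsto 0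
  have hA := (taylor_charFun_two hmeas h0 h1).comp_tendsto ht
  have hcf : ∀ u : ℝ, charFun ((gaussianReal 0 1).map X) (√2 * u) = charFun centredChiSq u :=
    fun u => by
      have : (gaussianReal 0 1).map X = centredChiSq.map fun x => (√2)⁻¹ * x := by
        rw [centredChiSq, Measure.map_map (by fun_prop) (by fun_prop)]
        rfl
      rw [this, charFun_map_mul]
      congr 1
      field_simp
  have hA' : (fun u : ℝ => charFun centredChiSq u - (1 - (u : ℂ) ^ 2)) =o[𝓝 0]
      fun u : ℝ => u ^ 2 := by
    have h3 : (fun u : ℝ => charFun centredChiSq u - (1 - (u : ℂ) ^ 2)) =o[𝓝 0]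
        fun u : ℝ => 2 * u ^ 2 := by
      refine hA.congr' (Eventually.of_forall fun u => ?_) (Eventually.of_forall fun u => ?_)
      · simp only [Function.comp_apply]
        rw [hcf]
        congr 2
        push_cast
        rw [mul_pow, ← Complex.ofReal_pow (√2), Real.sq_sqrt (by norm_num)]
        push_cast
        ring
      · simp only [Function.comp_apply, mul_pow, Real.sq_sqrt (by norm_num : (0 : ℝ) ≤ 2)]
    exact (Asymptotics.isLittleO_const_mul_right_iff two_ne_zero).mp h3
  have hB : (fun u : ℝ => Complex.exp (-(u : ℂ) ^ 2) - (1 - (u : ℂ) ^ 2)) =o[𝓝 0]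
      fun u : ℝ => u ^ 2 := by
    have h3 : HasDerivAt Complex.exp 1 0 := by simpa using Complex.hasDerivAt_exp 0
    have h4 := h3.isLittleO
    have h5 : Tendsto (fun u : ℝ => -(u : ℂ) ^ 2) (𝓝 0) (𝓝 0) := by
      have : Continuous fun u : ℝ => -(u : ℂ) ^ 2 := by fun_prop
      simpa using this.tendsto 0
    have h6 := h4.comp_tendsto h5
    rw [← Asymptotics.isLittleO_norm_right] at h6
    refine h6.congr' (Eventually.of_forall fun u => ?_) (Eventually.of_forall fun u => ?_)
    · simp; ring
    · simp
  refine (hA'.sub hB).congr_left fun u => ?_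
  ring

end ChiSquare

/-! ### Quadratic forms in Gaussian vectors -/

section QuadraticForm

open scoped MatrixOrder

/-- Replace the factors one at a time; all the other factors have norm at most `1`. -/
lemma norm_prod_sub_prod_le {ι : Type*} (s : Finset ι) {a b : ι → ℂ} (ha : ∀ i, ‖a i‖ ≤ 1)
    (hb : ∀ i, ‖b i‖ ≤ 1) : ‖∏ i ∈ s, a i - ∏ i ∈ s, b i‖ ≤ ∑ i ∈ s, ‖a i - b i‖ := by
  classical
  induction s using Finset.induction_on with
  | empty => simp
  | insert i s hi ih =>
    rw [Finset.prod_insert hi, Finset.prod_insert hi, Finset.sum_insert hi,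
      show a i * ∏ x ∈ s, a x - b i * ∏ x ∈ s, b x
        = (a i - b i) * ∏ x ∈ s, a x + b i * (∏ x ∈ s, a x - ∏ x ∈ s, b x) by ring]
    refine norm_add_le_of_le ?_ ?_
    · rw [norm_mul]
      refine mul_le_of_le_one_right (norm_nonneg _) ?_
      exact (Finset.norm_prod_le _ _).trans (Finset.prod_le_one (fun _ _ => norm_nonneg _)
        fun i _ => ha i)
    · rw [norm_mul]
      exact (mul_le_of_le_one_left (norm_nonneg _) (hb i)).trans ih

/-- Read the eigenvalue equation at a coordinate where `|v i|` is largest. Symmetry is not needed,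
so the bound applies to `T * R`. -/
lemma abs_le_of_mulVec_eq_smul {ι : Type*} [Fintype ι] {N : Matrix ι ι ℝ} {B c : ℝ} {v : ι → ℝ} (hv : v ≠ 0)
    (h : N *ᵥ v = c • v) (hB : ∀ i, ∑ j, |N i j| ≤ B) : |c| ≤ B := by
  obtain ⟨j, hj⟩ := Function.ne_iff.mp hv
  obtain ⟨i, -, hi⟩ := Finset.exists_max_image Finset.univ (fun i => |v i|) ⟨j, Finset.mem_univ j⟩
  have hpos : 0 < |v i| := (abs_pos.mpr hj).trans_le (hi j (Finset.mem_univ j))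
  have h1 : c * v i = ∑ j, N i j * v j := by
    have := congrFun h i
    simpa [mulVec, dotProduct] using this.symm
  have h2 : |c| * |v i| ≤ B * |v i| := by
    rw [← abs_mul, h1]
    calc |∑ j, N i j * v j| ≤ ∑ j, |N i j| * |v i| :=
          (Finset.abs_sum_le_sum_abs _ _).trans (Finset.sum_le_sum fun j hj => by
            rw [abs_mul]; exact mul_le_mul_of_nonneg_left (hi j hj) (abs_nonneg _))
      _ = (∑ j, |N i j|) * |v i| := by rw [Finset.sum_mul]
      _ ≤ _ := by gcongr; exact hB i
  exact le_of_mul_le_mul_right h2 hpos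

variable {ι : Type*} [Fintype ι] [DecidableEq ι]

/-- A centred quadratic form in a Gaussian vector has the law of a weighted sum of independent
centred chi-square variables. -/
lemma exists_weights_map_quadraticForm {R T : Matrix ι ι ℝ} (hR : R.PosSemidef) (hT : Tᵀ = T) :
    ∃ lam : ι → ℝ,
      (multivariateGaussian 0 R).map (fun z : EuclideanSpace ℝ ι => z ⬝ᵥ T *ᵥ z - (T * R).trace)
        = (Measure.pi fun _ : ι => gaussianReal 0 1).map
          (fun w => ∑ i, lam i * (w i ^ 2 - 1)) ∧
      ∑ i, lam i ^ 2 = (R * T * R * T).trace ∧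
      ∀ B, (∀ i, ∑ j, |(T * R) i j| ≤ B) → ∀ i, |lam i| ≤ B := by
  -- With `z = H x` and `x` standard Gaussian, the form is `xᵀ (H T H) x`. The weights are the
  -- eigenvalues of `H T H`, and by rotation invariance the coordinates of `x` in its eigenbasis are
  -- again independent standard Gaussians.
  set H := CFC.sqrt R with hH
  have hHH : H * H = R := CFC.sqrt_mul_sqrt_self _ hR.nonneg
  have hHT : Hᵀ = H := by
    have := (CFC.sqrt_nonneg R).isSelfAdjoint
    rw [isSelfAdjoint_iff, star_eq_conjTranspose, conjTranspose_eq_transpose_of_trivial] at this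
    exact this
  have hS : (H * T * H).IsHermitian := by
    rw [IsHermitian, conjTranspose_eq_transpose_of_trivial, transpose_mul, transpose_mul, hHT, hT,
      Matrix.mul_assoc]
  set lam := hS.eigenvalues with hlam
  set b := hS.eigenvectorBasis with hb
  have htr : (T * R).trace = ∑ i, lam i := by
    have h1 := hS.trace_eq_sum_eigenvalues
    simp only [RCLike.ofReal_real_eq_id, id_eq] at h1
    rw [hlam, ← h1, ← hHH, ← Matrix.mul_assoc, Matrix.trace_mul_comm (T * H) H, Matrix.mul_assoc]
  have htr2 : ∑ i, lam i ^ 2 = (R * T * R * T).trace := by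
    have h1 : (R * T * R * T).trace = ((H * T * H) * (H * T * H)).trace := by
      rw [← hHH, show H * H * T * (H * H) * T = H * (H * T * (H * H) * T) by
        simp only [Matrix.mul_assoc], Matrix.trace_mul_comm H]
      simp only [Matrix.mul_assoc]
    rw [h1]
    have h2 := hS.spectral_theorem
    rw [Unitary.conjStarAlgAut_apply] at h2
    set V : Matrix ι ι ℝ := (hS.eigenvectorUnitary : Matrix ι ι ℝ) with hV
    have hVV : star V * V = 1 := Unitary.coe_star_mul_self hS.eigenvectorUnitary
    conv_rhs => rw [h2]
    rw [show ∀ D : Matrix ι ι ℝ, V * D * star V * (V * D * star V)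
      = V * (D * (star V * V) * D * star V) from fun D => by simp only [Matrix.mul_assoc],
      hVV, Matrix.trace_mul_comm V, Matrix.mul_one, Matrix.mul_assoc, hVV, Matrix.mul_one,
      diagonal_mul_diagonal, trace_diagonal]
    exact Finset.sum_congr rfl fun i _ => by simp [sq, hlam]
  refine ⟨lam, ?_, htr2, fun B hB i => ?_⟩
  · have hmap : (multivariateGaussian 0 R)
        = (Measure.pi fun _ : ι => gaussianReal 0 1).map
          (fun w => toEuclideanCLM (𝕜 := ℝ) H (∑ i, w i • b i)) := by
      rw [multivariateGaussian, stdGaussian_eq_map_pi_orthonormalBasis b,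
        Measure.map_map (by fun_prop) (by fun_prop)]
      congr 1
      funext w
      simp [hH]
    rw [hmap, Measure.map_map (by fun_prop) (by fun_prop)]
    congr 1
    funext w
    simp only [Function.comp_apply]
    set y : EuclideanSpace ℝ ι := ∑ i, w i • b i with hy
    have h1 : (toEuclideanCLM (𝕜 := ℝ) H y).ofLp = H *ᵥ y.ofLp := rfl
    have h2 : (H * T * H) *ᵥ y.ofLp = (∑ i, (lam i * w i) • b i : EuclideanSpace ℝ ι).ofLp := by
      rw [hy]
      simp only [WithLp.ofLp_sum, WithLp.ofLp_smul, mulVec_sum, mulVec_smul]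
      refine Finset.sum_congr rfl fun i _ => ?_
      rw [hb, hS.mulVec_eigenvectorBasis, smul_smul, mul_comm]
    have h3 : (H *ᵥ y.ofLp) ⬝ᵥ T *ᵥ (H *ᵥ y.ofLp) = y.ofLp ⬝ᵥ (H * T * H) *ᵥ y.ofLp := by
      rw [← mulVec_mulVec, ← mulVec_mulVec, dotProduct_mulVec y.ofLp H, ← mulVec_transpose, hHT]
    have h4 : y.ofLp ⬝ᵥ (∑ i, (lam i * w i) • b i : EuclideanSpace ℝ ι).ofLp
        = inner ℝ y (∑ i, (lam i * w i) • b i) := by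
      rw [EuclideanSpace.inner_eq_star_dotProduct, dotProduct_comm]
      rfl
    rw [h1, h3, h2, h4, htr, hy, b.orthonormal.inner_sum, ← Finset.sum_sub_distrib]
    refine Finset.sum_congr rfl fun i _ => ?_
    simp only [conj_trivial]
    ring
  · have hvec : (H * T * H) *ᵥ (b i).ofLp = lam i • (b i).ofLp := hS.mulVec_eigenvectorBasis i
    by_cases hl : lam i = 0
    · rw [hl, abs_zero]
      exact (Finset.sum_nonneg fun _ _ => abs_nonneg _).trans (hB i)
    · have hv : (b i).ofLp ≠ 0 := fun h => by
        have := b.orthonormal.ne_zero i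
        exact this (by ext j; exact congrFun h j)
      -- A nonzero eigenvalue of `H T H` is also one of `T R`, with eigenvector `T H b`. Hence row
      -- sums of `T R` bound the weights, and row sums of the square root `H` are never needed.
      have hS' : H *ᵥ (T *ᵥ (H *ᵥ (b i).ofLp)) = lam i • (b i).ofLp := by
        rw [← hvec, mulVec_mulVec, mulVec_mulVec, Matrix.mul_assoc]
      refine abs_le_of_mulVec_eq_smul (v := T *ᵥ (H *ᵥ (b i).ofLp)) (fun h => ?_) ?_ hB
      · rw [h, mulVec_zero] at hS'
        exact smul_ne_zero hl hv hS'.symm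
      · rw [← mulVec_mulVec, ← hHH, ← mulVec_mulVec, hS', mulVec_smul, mulVec_smul]

lemma measurable_sum_mul_sq_sub_one {ι : Type*} [Fintype ι] (lam : ι → ℝ) :
    Measurable fun w : ι → ℝ => ∑ i, lam i * (w i ^ 2 - 1) :=
  Finset.measurable_sum _ fun i _ => by fun_prop

/-- The characteristic function of a centred quadratic form and its Gaussian approximation. -/
lemma norm_charFun_quadraticForm_sub_le {R T : Matrix ι ι ℝ} (hR : R.PosSemidef) (hT : Tᵀ = T)
    {ε r B u : ℝ}
    (hr : ∀ x : ℝ, |x| < r → ‖charFun centredChiSq x - Complex.exp (-(x : ℂ) ^ 2)‖ ≤ ε * x ^ 2)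
    (hB : ∀ i, ∑ j, |(T * R) i j| ≤ B) (huB : |u| * B < r) :
    ‖charFun ((multivariateGaussian 0 R).map
        (fun z : EuclideanSpace ℝ ι => z ⬝ᵥ T *ᵥ z - (T * R).trace)) u
      - Complex.exp (-((u ^ 2 * (R * T * R * T).trace : ℝ) : ℂ))‖
      ≤ ε * (u ^ 2 * (R * T * R * T).trace) := by
  obtain ⟨lam, hmap, htr, hle⟩ := exists_weights_map_quadraticForm hR hT
  have hcf : charFun ((multivariateGaussian 0 R).map
        (fun z : EuclideanSpace ℝ ι => z ⬝ᵥ T *ᵥ z - (T * R).trace)) u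
      = ∏ i, charFun centredChiSq (u * lam i) := by
    rw [hmap, charFun_apply_real,
      integral_map (measurable_sum_mul_sq_sub_one lam).aemeasurable (by fun_prop)]
    have h1 : ∀ w : ι → ℝ, Complex.exp (u * (∑ i, lam i * (w i ^ 2 - 1) : ℝ) * Complex.I)
        = ∏ i, Complex.exp ((u * lam i : ℝ) * (w i ^ 2 - 1 : ℝ) * Complex.I) := fun w => by
      rw [← Complex.exp_sum, ← Finset.sum_mul, Complex.ofReal_sum, Finset.mul_sum]
      congr 2
      refine Finset.sum_congr rfl fun i _ => ?_
      push_cast; ring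
    simp_rw [h1]
    rw [integral_fintype_prod_eq_prod
      (f := fun i (x : ℝ) => Complex.exp ((u * lam i : ℝ) * (x ^ 2 - 1 : ℝ) * Complex.I))]
    refine Finset.prod_congr rfl fun i _ => ?_
    rw [charFun_apply_real, centredChiSq, integral_map (by fun_prop) (by fun_prop)]
  have hexp : Complex.exp (-((u ^ 2 * (R * T * R * T).trace : ℝ) : ℂ))
      = ∏ i, Complex.exp (-((u * lam i : ℝ) : ℂ) ^ 2) := by
    rw [← Complex.exp_sum, ← htr, Finset.mul_sum, Complex.ofReal_sum, ← Finset.sum_neg_distrib]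
    congr 1
    refine Finset.sum_congr rfl fun i _ => ?_
    push_cast; ring
  rw [hcf, hexp, ← htr, Finset.mul_sum, Finset.mul_sum]
  refine (norm_prod_sub_prod_le _ (fun i => norm_charFun_le_one _) (fun i => ?_)).trans
    (Finset.sum_le_sum fun i _ => ?_)
  · rw [Complex.norm_exp, ← Complex.ofReal_pow, ← Complex.ofReal_neg, Complex.ofReal_re,
      Real.exp_le_one_iff, neg_nonpos]
    positivity
  · rw [← mul_pow]
    refine hr _ (lt_of_le_of_lt ?_ huB)
    rw [abs_mul]
    exact mul_le_mul_of_nonneg_left (hle B hB i) (abs_nonneg _)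

/-- The trace is the sum of the squared weights, each at most `B ^ 2`. -/
lemma trace_eq_sum_sq_le {R T : Matrix ι ι ℝ} (hR : R.PosSemidef) (hT : Tᵀ = T) {B : ℝ}
    (hB : ∀ i, ∑ j, |(T * R) i j| ≤ B) :
    0 ≤ (R * T * R * T).trace ∧ (R * T * R * T).trace ≤ Fintype.card ι * B ^ 2 := by
  obtain ⟨lam, -, htr, hle⟩ := exists_weights_map_quadraticForm hR hT
  rw [← htr]
  refine ⟨Finset.sum_nonneg fun _ _ => sq_nonneg _, ?_⟩
  calc ∑ i, lam i ^ 2 ≤ ∑ _i : ι, B ^ 2 := Finset.sum_le_sum fun i _ => by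
        rw [← sq_abs]
        exact pow_le_pow_left₀ (abs_nonneg _) (hle B hB i) 2
    _ = _ := by simp

/-- The second moment of a centred quadratic form in a Gaussian vector. -/
lemma integral_sq_quadraticForm {R T : Matrix ι ι ℝ} (hR : R.PosSemidef) (hT : Tᵀ = T) :
    Integrable (fun z : EuclideanSpace ℝ ι => (z ⬝ᵥ T *ᵥ z - (T * R).trace) ^ 2)
      (multivariateGaussian 0 R) ∧
    ∫ z : EuclideanSpace ℝ ι, (z ⬝ᵥ T *ᵥ z - (T * R).trace) ^ 2 ∂(multivariateGaussian 0 R)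
      = 2 * (R * T * R * T).trace := by
  obtain ⟨lam, hmap, htr, -⟩ := exists_weights_map_quadraticForm hR hT
  set ν := Measure.pi fun _ : ι => gaussianReal 0 1 with hν
  have hq : Measurable fun z : EuclideanSpace ℝ ι => z ⬝ᵥ T *ᵥ z - (T * R).trace := by
    simp only [dotProduct, mulVec]
    fun_prop
  have hmem : ∀ i, MemLp (fun x : ℝ => lam i * (x ^ 2 - 1)) 2 (gaussianReal 0 1) := fun i =>
    memLp_sq_sub_one_gaussianReal.const_mul _
  have hmemw : MemLp (fun w : ι → ℝ => ∑ i, lam i * (w i ^ 2 - 1)) 2 ν :=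
    memLp_finsetSum _ fun i _ =>
      (hmem i).comp_measurePreserving (measurePreserving_eval (fun _ : ι => gaussianReal 0 1) i)
  have hmean : ∫ w, ∑ i, lam i * (w i ^ 2 - 1) ∂ν = 0 := by
    rw [integral_finsetSum]
    · refine Finset.sum_eq_zero fun i _ => ?_
      have h2 : ∫ w : ι → ℝ, lam i * (w i ^ 2 - 1) ∂ν
          = ∫ x, lam i * (x ^ 2 - 1) ∂(ν.map fun w => w i) := by
        rw [integral_map (measurable_pi_apply i).aemeasurable (by fun_prop)]
      rw [h2, (measurePreserving_eval (fun _ : ι => gaussianReal 0 1) i).map_eq,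
        integral_const_mul, integral_sq_sub_one_gaussianReal, mul_zero]
    · intro i _
      exact ((hmem i).comp_measurePreserving
        (measurePreserving_eval (fun _ : ι => gaussianReal 0 1) i)).integrable one_le_two
  have hvar : ∫ w, (∑ i, lam i * (w i ^ 2 - 1)) ^ 2 ∂ν = 2 * (R * T * R * T).trace := by
    have h1 := variance_sum_pi (μ := fun _ : ι => gaussianReal 0 1) hmem
    have h2 : (∑ i, fun w : ι → ℝ => lam i * (w i ^ 2 - 1))
        = fun w => ∑ i, lam i * (w i ^ 2 - 1) := by
      funext w; simp
    rw [h2, variance_of_integral_eq_zero (measurable_sum_mul_sq_sub_one lam).aemeasurable hmean] at h1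
    rw [h1, ← htr, Finset.mul_sum]
    refine Finset.sum_congr rfl fun i _ => ?_
    rw [variance_const_mul, variance_of_integral_eq_zero (by fun_prop)
      integral_sq_sub_one_gaussianReal, integral_sq_sub_one_sq_gaussianReal, mul_comm]
  have hint : Integrable (fun x : ℝ => x ^ 2) ((multivariateGaussian 0 R).map
      fun z : EuclideanSpace ℝ ι => z ⬝ᵥ T *ᵥ z - (T * R).trace) := by
    rw [hmap, integrable_map_measure (by fun_prop)
      (measurable_sum_mul_sq_sub_one lam).aemeasurable]
    exact hmemw.integrable_sq
  refine ⟨?_, ?_⟩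
  · rwa [integrable_map_measure (by fun_prop) hq.aemeasurable] at hint
  · rw [← integral_map (φ := fun z : EuclideanSpace ℝ ι => z ⬝ᵥ T *ᵥ z - (T * R).trace)
      (f := fun x : ℝ => x ^ 2) hq.aemeasurable (by fun_prop), hmap,
      integral_map (measurable_sum_mul_sq_sub_one lam).aemeasurable (by fun_prop), hvar]

end QuadraticForm

/-! ### Summation of decaying functions over separated points -/

section Packing

variable {d : ℕ}

/-- Moving a point by at most `b` changes the decay rate only by a constant factor. This allows the
value at a point to be compared with an integral over a ball around it. -/
lemma one_add_rpow_le {r b y x : ℝ} (hr : 0 ≤ r) (hb : 0 ≤ b) (hy : 0 ≤ y) (hx : 0 ≤ x)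
    (h : x ≤ y + b) : (1 + x) ^ r ≤ (1 + b) ^ r * 2 ^ r * (1 + y ^ r) := by
  have h1 : 1 + x ≤ (1 + b) * (2 * max 1 y) := by
    have h2 : 1 + y ≤ 2 * max 1 y := by linarith [le_max_left 1 y, le_max_right 1 y]
    nlinarith
  have hm : (0 : ℝ) ≤ max 1 y := le_trans zero_le_one (le_max_left _ _)
  have h3 : (max 1 y) ^ r ≤ 1 + y ^ r := by
    rcases max_cases 1 y with ⟨h4, -⟩ | ⟨h4, -⟩ <;> rw [h4]
    · rw [Real.one_rpow]; linarith [Real.rpow_nonneg hy r]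
    · linarith
  calc (1 + x) ^ r ≤ ((1 + b) * (2 * max 1 y)) ^ r :=
        Real.rpow_le_rpow (by positivity) h1 hr
    _ = (1 + b) ^ r * 2 ^ r * (max 1 y) ^ r := by
        rw [Real.mul_rpow (by positivity) (by positivity), Real.mul_rpow (by norm_num) hm, mul_assoc]
    _ ≤ _ := by gcongr

/-- Polynomially decaying functions are summable over separated points, uniformly. -/
lemma exists_sum_inv_one_add_rpow_le (d : ℕ) {α Δ : ℝ} (hα : 0 < α) (hΔ : 0 < Δ) :
    ∃ C ≥ 0, ∀ (n : ℕ) (s : Fin n → EuclideanSpace ℝ (Fin d)),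
      (∀ i j : Fin n, i ≠ j → Δ ≤ ‖s i - s j‖) →
      ∀ i, ∑ j, (1 + ‖s i - s j‖ ^ ((d : ℝ) + α))⁻¹ ≤ C := by
  set r : ℝ := (d : ℝ) + α with hr
  have hr0 : 0 ≤ r := by positivity
  -- Balls of radius `Δ / 2` around the points `s i - s j` are disjoint, so the sum is at most a
  -- constant times the integral of `(1 + ‖x‖) ^ (-r)`, which is finite because `r > d`.
  set b := Δ / 2 with hb
  have hb0 : 0 < b := by positivity
  set h : EuclideanSpace ℝ (Fin d) → ℝ := fun x => (1 + ‖x‖) ^ (-r) with hh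
  have hint : Integrable h := integrable_one_add_norm (by simp [hr, hα])
  have hh0 : ∀ x, 0 ≤ h x := fun x => by positivity
  set M := (1 + b) ^ r * 2 ^ r with hM
  have hM0 : 0 ≤ M := by positivity
  set v := (volume : Measure (EuclideanSpace ℝ (Fin d))).real (Metric.ball 0 b) with hv
  have hv0 : 0 < v := by
    rw [hv, measureReal_def]
    exact ENNReal.toReal_pos (Metric.measure_ball_pos _ _ hb0).ne' measure_ball_lt_top.ne
  refine ⟨v⁻¹ * (M * ∫ x, h x), by positivity, fun n s hs i => ?_⟩
  rw [le_inv_mul_iff₀ hv0, Finset.mul_sum]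
  have hstep : ∀ j, v * (1 + ‖s i - s j‖ ^ r)⁻¹
      ≤ M * ∫ x in Metric.ball (s i - s j) b, h x := fun j => by
    have h1 : ∫ _x in Metric.ball (s i - s j) b, (1 + ‖s i - s j‖ ^ r)⁻¹
        = v * (1 + ‖s i - s j‖ ^ r)⁻¹ := by
      rw [setIntegral_const, smul_eq_mul, hv, measureReal_def, measureReal_def,
        Measure.addHaar_ball_center]
    rw [← h1, ← integral_const_mul]
    refine setIntegral_mono_on ?_ (hint.const_mul M).integrableOn measurableSet_ball fun x hx => ?_
    · exact integrableOn_const measure_ball_lt_top.ne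
    · have hxb : ‖x‖ ≤ ‖s i - s j‖ + b := by
        have h2 : ‖x - (s i - s j)‖ < b := by rwa [← dist_eq_norm]
        linarith [norm_le_norm_add_norm_sub' x (s i - s j)]
      have h3 := one_add_rpow_le hr0 hb0.le (norm_nonneg (s i - s j)) (norm_nonneg x) hxb
      have h4 : (0 : ℝ) < (1 + ‖x‖) ^ r := by positivity
      have h5 : (0 : ℝ) < 1 + ‖s i - s j‖ ^ r := by positivity
      simp only [hh]
      rw [Real.rpow_neg (by positivity), ← div_eq_mul_inv, inv_le_comm₀ h5 (by positivity), inv_div,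
        div_le_iff₀ (by positivity), mul_comm]
      exact h3
  calc ∑ j, v * (1 + ‖s i - s j‖ ^ r)⁻¹
      ≤ ∑ j, M * ∫ x in Metric.ball (s i - s j) b, h x := Finset.sum_le_sum fun j _ => hstep j
    _ = M * ∑ j, ∫ x in Metric.ball (s i - s j) b, h x := by rw [Finset.mul_sum]
    _ = M * ∫ x in ⋃ j ∈ (Finset.univ : Finset (Fin n)), Metric.ball (s i - s j) b, h x := by
        rw [integral_biUnion_finset _ (fun _ _ => measurableSet_ball) ?_
          (fun _ _ => hint.integrableOn)]
        intro j _ j' _ hjj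
        refine Metric.ball_disjoint_ball ?_
        rw [dist_eq_norm, show s i - s j - (s i - s j') = s j' - s j by abel, hb, add_halves]
        exact hs j' j hjj.symm
    _ ≤ M * ∫ x, h x := by
        gcongr
        exact Eventually.of_forall hh0
        exact Measure.restrict_le_self

end Packing

/-! ### Row sums of products and traces -/

section RowSums

variable {ι : Type*} [Fintype ι]

lemma rowSum_mul_le {M N : Matrix ι ι ℝ} {a b : ℝ} (hM : ∀ i, ∑ j, |M i j| ≤ a)
    (hN : ∀ i, ∑ j, |N i j| ≤ b) (i : ι) : ∑ j, |(M * N) i j| ≤ a * b := by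
  have hb : 0 ≤ b := (Finset.sum_nonneg fun _ _ => abs_nonneg _).trans (hN i)
  calc ∑ j, |(M * N) i j| ≤ ∑ j, ∑ l, |M i l| * |N l j| := Finset.sum_le_sum fun j _ => by
        rw [Matrix.mul_apply]
        refine (Finset.abs_sum_le_sum_abs _ _).trans (le_of_eq ?_)
        exact Finset.sum_congr rfl fun l _ => abs_mul _ _
    _ = ∑ l, |M i l| * ∑ j, |N l j| := by
        rw [Finset.sum_comm]; simp_rw [Finset.mul_sum]
    _ ≤ ∑ l, |M i l| * b := by gcongr with l; exact hN l
    _ = (∑ l, |M i l|) * b := by rw [Finset.sum_mul]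
    _ ≤ a * b := by gcongr; exact hM i

lemma abs_trace_le {M : Matrix ι ι ℝ} {a : ℝ} (hM : ∀ i, ∑ j, |M i j| ≤ a) :
    |M.trace| ≤ Fintype.card ι * a := by
  calc |M.trace| ≤ ∑ i, |M i i| := Finset.abs_sum_le_sum_abs _ _
    _ ≤ ∑ _i : ι, a := Finset.sum_le_sum fun i _ =>
        (Finset.single_le_sum (f := fun j => |M i j|) (fun _ _ => abs_nonneg _)
          (Finset.mem_univ i)).trans (hM i)
    _ = _ := by simp

end RowSums

/-! ### Uniform bounds for the kernel matrices -/

section KernelBounds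

variable {d p k n : ℕ}

/-- The kernel `f₀` takes the value `1` at the origin, which `A` need not dominate; hence `max A 1`.
-/
lemma abs_kernels_le {f : Fin k → EuclideanSpace ℝ (Fin d) → ℝ} {A α : ℝ} (hα : 0 < α)
    (hf : ∀ l x, |f l x| ≤ A / (1 + ‖x‖ ^ ((d : ℝ) + α))) (l : Fin (k + 1))
    (x : EuclideanSpace ℝ (Fin d)) :
    |kernels f l x| ≤ max A 1 * (1 + ‖x‖ ^ ((d : ℝ) + α))⁻¹ := by
  have hpos : 0 ≤ (1 + ‖x‖ ^ ((d : ℝ) + α))⁻¹ := by positivity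
  refine Fin.cases ?_ (fun l => ?_) l
  · simp only [kernels, Fin.cons_zero, kernelZero]
    by_cases hx : x = 0
    · subst hx
      have : (0 : ℝ) < d + α := by positivity
      simp [Real.zero_rpow this.ne']
    · rw [Set.indicator_of_notMem (by simpa using hx), abs_zero]
      positivity
  · simp only [kernels, Fin.cons_succ]
    refine (hf l x).trans ?_
    rw [div_eq_mul_inv]
    exact mul_le_mul_of_nonneg_right (le_max_left _ _) hpos

lemma kernels_neg {f : Fin k → EuclideanSpace ℝ (Fin d) → ℝ} (hf : ∀ l x, f l (-x) = f l x)
    (l : Fin (k + 1)) (x : EuclideanSpace ℝ (Fin d)) : kernels f l (-x) = kernels f l x := by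
  refine Fin.cases ?_ (fun l => ?_) l
  · simp only [kernels, Fin.cons_zero, kernelZero, Set.indicator, Set.mem_singleton_iff,
      neg_eq_zero]
  · simp only [kernels, Fin.cons_succ, hf]

lemma abs_half_smul_single_add_le (b c u v : Fin p) :
    |((1 / 2 : ℝ) • (Matrix.single b c (1 : ℝ) + Matrix.single c b (1 : ℝ))) u v| ≤ 1 := by
  have h : ∀ b c : Fin p, |Matrix.single b c (1 : ℝ) u v| ≤ 1 := fun b c => by
    rw [Matrix.single_apply]; split_ifs <;> simp
  rw [Matrix.smul_apply, Matrix.add_apply, smul_eq_mul, abs_mul,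
    abs_of_pos (by norm_num : (0 : ℝ) < 1 / 2)]
  have := (abs_add_le (Matrix.single b c (1 : ℝ) u v) (Matrix.single c b (1 : ℝ) u v)).trans
    (add_le_add (h b c) (h c b))
  linarith

lemma rowSum_kernelMatrix_le {s : Fin n → EuclideanSpace ℝ (Fin d)}
    {g : EuclideanSpace ℝ (Fin d) → ℝ} {C : ℝ} (hg : ∀ i, ∑ j, |g (s i - s j)| ≤ C)
    (b c : Fin p) (u : Fin n × Fin p) : ∑ v, |kernelMatrix s g b c u v| ≤ p * C := by
  calc ∑ v, |kernelMatrix s g b c u v| ≤ ∑ v : Fin n × Fin p, |g (s u.1 - s v.1)| :=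
        Finset.sum_le_sum fun v _ => by
          simp only [kernelMatrix, Matrix.of_apply, abs_mul]
          exact mul_le_of_le_one_right (abs_nonneg _) (abs_half_smul_single_add_le _ _ _ _)
    _ = p * ∑ j, |g (s u.1 - s j)| := by
        rw [Fintype.sum_prod_type]
        simp [Finset.mul_sum]
    _ ≤ p * C := by gcongr; exact hg _

lemma kernelMatrix_transpose {s : Fin n → EuclideanSpace ℝ (Fin d)}
    {g : EuclideanSpace ℝ (Fin d) → ℝ} (hg : ∀ x, g (-x) = g x) (b c : Fin p) :
    (kernelMatrix s g b c)ᵀ = kernelMatrix s g b c := by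
  ext u v
  simp only [kernelMatrix, Matrix.transpose_apply, Matrix.of_apply]
  rw [← hg, neg_sub]
  congr 1
  simp only [Matrix.smul_apply, Matrix.add_apply, Matrix.single_apply, smul_eq_mul]
  rw [add_comm]
  simp only [and_comm]

/-- The linear combination of the kernel matrices with coefficients `c`. -/
def combMatrix (s : Fin n → EuclideanSpace ℝ (Fin d)) (f : Fin k → EuclideanSpace ℝ (Fin d) → ℝ)
    (c : Fin (k + 1) × (Fin p × Fin p) → ℝ) : Matrix (Fin n × Fin p) (Fin n × Fin p) ℝ :=
  ∑ a, c a • kernelMatrix s (kernels f a.1) a.2.1 a.2.2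

lemma combMatrix_transpose {s : Fin n → EuclideanSpace ℝ (Fin d)}
    {f : Fin k → EuclideanSpace ℝ (Fin d) → ℝ} (hf : ∀ l x, f l (-x) = f l x)
    (c : Fin (k + 1) × (Fin p × Fin p) → ℝ) : (combMatrix s f c)ᵀ = combMatrix s f c := by
  simp only [combMatrix, Matrix.transpose_sum, Matrix.transpose_smul,
    kernelMatrix_transpose (kernels_neg hf _)]

lemma rowSum_combMatrix_le {s : Fin n → EuclideanSpace ℝ (Fin d)}
    {f : Fin k → EuclideanSpace ℝ (Fin d) → ℝ} {C : ℝ}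
    (hf : ∀ l i, ∑ j, |kernels f l (s i - s j)| ≤ C) (c : Fin (k + 1) × (Fin p × Fin p) → ℝ)
    (u : Fin n × Fin p) : ∑ v, |combMatrix s f c u v| ≤ (∑ a, |c a|) * (p * C) := by
  calc ∑ v, |combMatrix s f c u v|
      ≤ ∑ v, ∑ a, |c a| * |kernelMatrix s (kernels f a.1) a.2.1 a.2.2 u v| :=
        Finset.sum_le_sum fun v _ => by
          rw [combMatrix, Matrix.sum_apply]
          refine (Finset.abs_sum_le_sum_abs _ _).trans (le_of_eq ?_)
          exact Finset.sum_congr rfl fun a _ => by rw [Matrix.smul_apply, smul_eq_mul, abs_mul]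
    _ = ∑ a, |c a| * ∑ v, |kernelMatrix s (kernels f a.1) a.2.1 a.2.2 u v| := by
        rw [Finset.sum_comm]; simp_rw [Finset.mul_sum]
    _ ≤ ∑ a, |c a| * (p * C) := by
        gcongr with a
        exact rowSum_kernelMatrix_le (hf a.1) _ _ u
    _ = _ := by rw [Finset.sum_mul]

end KernelBounds

/-! ### The Gaussian law of the sampled latent field -/

section Law

variable {Ω : Type*} [MeasurableSpace Ω] {μ : Measure Ω} {d p n : ℕ}
  {Z : Fin p → EuclideanSpace ℝ (Fin d) → Ω → ℝ}

/-- The vector of all `Z_a(sᵢ)`. -/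
def latentVec (Z : Fin p → EuclideanSpace ℝ (Fin d) → Ω → ℝ)
    (s : Fin n → EuclideanSpace ℝ (Fin d)) (ω : Ω) : EuclideanSpace ℝ (Fin n × Fin p) :=
  WithLp.toLp 2 fun u => Z u.2 (s u.1) ω

lemma measurable_latentVec (hZ : ∀ a x, Measurable (Z a x))
    (s : Fin n → EuclideanSpace ℝ (Fin d)) : Measurable (latentVec Z s) := by
  have h : Measurable fun ω => fun u : Fin n × Fin p => Z u.2 (s u.1) ω :=
    measurable_pi_lambda _ fun u => hZ _ _
  exact (by fun_prop : Measurable (WithLp.toLp 2 :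
    (Fin n × Fin p → ℝ) → EuclideanSpace ℝ (Fin n × Fin p))).comp h

lemma hasGaussianLaw_latent (hZgauss : ∀ a, IsGaussianProcess (Z a) μ)
    (hZindep : iIndepFun (fun (a : Fin p) (ω : Ω) (x : EuclideanSpace ℝ (Fin d)) => Z a x ω) μ)
    (s : Fin n → EuclideanSpace ℝ (Fin d)) :
    HasGaussianLaw (fun ω => fun u : Fin n × Fin p => Z u.2 (s u.1) ω) μ := by
  classical
  have h1 : ∀ a, HasGaussianLaw (fun ω => fun i => Z a (s i) ω) μ := fun a => by
    -- The sites are not assumed distinct here, so the vector is read off linearly from the values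
    -- on the set of sites.
    let I : Finset (EuclideanSpace ℝ (Fin d)) := Finset.univ.image s
    let L : (I → ℝ) →L[ℝ] (Fin n → ℝ) := ContinuousLinearMap.pi fun i =>
      ContinuousLinearMap.proj (R := ℝ) (φ := fun _ : I => ℝ)
        ⟨s i, Finset.mem_image_of_mem s (Finset.mem_univ i)⟩
    exact ((hZgauss a).hasGaussianLaw I).map_fun L
  have h2 : iIndepFun (fun (a : Fin p) ω => fun i => Z a (s i) ω) μ :=
    hZindep.comp (fun _ (z : EuclideanSpace ℝ (Fin d) → ℝ) i => z (s i))
      fun _ => measurable_pi_lambda _ fun i => measurable_pi_apply _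
  have h3 := iIndepFun.hasGaussianLaw h1 h2
  let L : (Fin p → Fin n → ℝ) →L[ℝ] (Fin n × Fin p → ℝ) := ContinuousLinearMap.pi fun u =>
    (ContinuousLinearMap.proj (R := ℝ) (φ := fun _ : Fin n => ℝ) u.1).comp
      (ContinuousLinearMap.proj (R := ℝ) (φ := fun _ : Fin p => Fin n → ℝ) u.2)
  exact h3.map_fun L

lemma memLp_two_latent (hZgauss : ∀ a, IsGaussianProcess (Z a) μ) (a : Fin p)
    (x : EuclideanSpace ℝ (Fin d)) : MemLp (Z a x) 2 μ :=
  ((hZgauss a).hasGaussianLaw_eval x).memLp_two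

lemma posSemidef_latentCov [IsProbabilityMeasure μ] (hZgauss : ∀ a, IsGaussianProcess (Z a) μ)
    (s : Fin n → EuclideanSpace ℝ (Fin d)) : (latentCov μ Z s).PosSemidef := by
  rw [posSemidef_iff_dotProduct_mulVec]
  refine ⟨?_, fun x => ?_⟩
  · ext u v
    simp only [latentCov, conjTranspose_apply, of_apply, star_trivial]
    exact covariance_comm _ _
  · have h := covarianceBilin_apply_pi (μ := μ) (X := fun u : Fin n × Fin p => Z u.2 (s u.1))
      (fun u => memLp_two_latent hZgauss u.2 (s u.1)) (WithLp.toLp 2 x) (WithLp.toLp 2 x)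
    have h0 := covarianceBilin_self_nonneg (μ := μ.map fun ω =>
      WithLp.toLp 2 fun u : Fin n × Fin p => Z u.2 (s u.1) ω) (WithLp.toLp 2 x)
    rw [h] at h0
    refine h0.trans_eq ?_
    simp only [dotProduct, mulVec, latentCov, of_apply, star_trivial, Finset.mul_sum]
    refine Finset.sum_congr rfl fun u _ => Finset.sum_congr rfl fun v _ => ?_
    ring

/-- Both laws are Gaussian, so it is enough to match the means and the covariance forms on a basis.
-/
lemma map_latentVec [IsProbabilityMeasure μ] (hZmeas : ∀ a x, Measurable (Z a x))
    (hZgauss : ∀ a, IsGaussianProcess (Z a) μ)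
    (hZindep : iIndepFun (fun (a : Fin p) (ω : Ω) (x : EuclideanSpace ℝ (Fin d)) => Z a x ω) μ)
    (hZmean : ∀ a x, ∫ ω, Z a x ω ∂μ = 0) (s : Fin n → EuclideanSpace ℝ (Fin d)) :
    μ.map (latentVec Z s) = multivariateGaussian 0 (latentCov μ Z s) := by
  have hG : HasGaussianLaw (latentVec Z s) μ :=
    (hasGaussianLaw_latent hZgauss hZindep s).toLp_pi 2
  have := hG.isGaussian_map
  have hmeas := measurable_latentVec hZmeas s
  apply IsGaussian.ext
  · simp only [id_eq, integral_id_multivariateGaussian]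
    rw [integral_map hmeas.aemeasurable (by fun_prop)]
    ext u
    rw [eval_integral_piLp]
    · exact hZmean _ _
    · intro u
      exact (memLp_two_latent hZgauss u.2 (s u.1)).integrable one_le_two
  · rw [← ContinuousLinearMap.toBilinForm_inj]
    refine LinearMap.BilinForm.ext_basis (EuclideanSpace.basisFun _ ℝ).toBasis fun u v => ?_
    rw [ContinuousLinearMap.toBilinForm_apply, ContinuousLinearMap.toBilinForm_apply,
      OrthonormalBasis.coe_toBasis,
      covarianceBilin_multivariateGaussian (posSemidef_latentCov hZgauss s)]
    have h := covarianceBilin_apply_basisFun (μ := μ) (X := fun u : Fin n × Fin p => Z u.2 (s u.1))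
      (fun u => memLp_two_latent hZgauss u.2 (s u.1)) u v
    refine h.trans ?_
    simp [latentCov]

end Law

/-! ### Local covariance matrices in unmixed coordinates -/

section Algebra

variable {Ω : Type*} [MeasurableSpace Ω] {μ : Measure Ω} {d p k n : ℕ}
  {Z : Fin p → EuclideanSpace ℝ (Fin d) → Ω → ℝ} {W : Matrix (Fin p) (Fin p) ℝ}
  {K : Fin p → EuclideanSpace ℝ (Fin d) → ℝ}

lemma latentCov_apply [IsProbabilityMeasure μ] (hZgauss : ∀ a, IsGaussianProcess (Z a) μ)
    (hZmean : ∀ a x, ∫ ω, Z a x ω ∂μ = 0)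
    (hZcov : ∀ a b x y, ∫ ω, Z a x ω * Z b y ω ∂μ = if a = b then K a (x - y) else 0)
    (s : Fin n → EuclideanSpace ℝ (Fin d)) (u v : Fin n × Fin p) :
    latentCov μ Z s u v = if u.2 = v.2 then K u.2 (s u.1 - s v.1) else 0 := by
  rw [← hZcov]
  simp only [latentCov, of_apply]
  rw [covariance_eq_sub (memLp_two_latent hZgauss _ _) (memLp_two_latent hZgauss _ _), hZmean,
    zero_mul, sub_zero]
  rfl

lemma rowSum_latentCov_le [IsProbabilityMeasure μ] (hZgauss : ∀ a, IsGaussianProcess (Z a) μ)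
    (hZmean : ∀ a x, ∫ ω, Z a x ω ∂μ = 0)
    (hZcov : ∀ a b x y, ∫ ω, Z a x ω * Z b y ω ∂μ = if a = b then K a (x - y) else 0)
    {s : Fin n → EuclideanSpace ℝ (Fin d)} {C : ℝ} (hK : ∀ a i, ∑ j, |K a (s i - s j)| ≤ C)
    (u : Fin n × Fin p) : ∑ v, |latentCov μ Z s u v| ≤ C := by
  refine le_of_eq_of_le ?_ (hK u.2 u.1)
  rw [Fintype.sum_prod_type]
  refine Finset.sum_congr rfl fun j _ => ?_
  simp only [latentCov_apply hZgauss hZmean hZcov]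
  rw [Finset.sum_eq_single u.2]
  · simp
  · intro b _ hb
    simp [hb.symm]
  · simp

/-- The diagonal entries of `D(g)`. -/
def specDiag (K : Fin p → EuclideanSpace ℝ (Fin d) → ℝ) (s : Fin n → EuclideanSpace ℝ (Fin d))
    (g : EuclideanSpace ℝ (Fin d) → ℝ) (a : Fin p) : ℝ :=
  (n : ℝ)⁻¹ * ∑ i, ∑ j, g (s i - s j) * K a (s i - s j)

lemma unmixedPopCov_eq_diagonal (hW : IsUnit W.det) (hZgauss : ∀ a, IsGaussianProcess (Z a) μ)
    (hZcov : ∀ a b x y, ∫ ω, Z a x ω * Z b y ω ∂μ = if a = b then K a (x - y) else 0)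
    (s : Fin n → EuclideanSpace ℝ (Fin d)) (g : EuclideanSpace ℝ (Fin d) → ℝ) :
    unmixedPopCov μ W Z s g = diagonal (specDiag K s g) := by
  have hint : ∀ a b x y, Integrable (fun ω => Z a x ω * Z b y ω) μ := fun a b x y =>
    (memLp_two_latent hZgauss a x).integrable_mul (memLp_two_latent hZgauss b y)
  have h1 : ∀ x y, (Matrix.of fun a b => ∫ ω, mixedField W Z x ω a * mixedField W Z y ω b ∂μ)
      = W * diagonal (fun a => K a (x - y)) * Wᵀ := fun x y => by
    ext a b
    simp only [of_apply, mixedField, mulVec, dotProduct]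
    have h2 : ∀ ω, (∑ e, W a e * Z e x ω) * (∑ e', W b e' * Z e' y ω)
        = ∑ e, ∑ e', W a e * W b e' * (Z e x ω * Z e' y ω) := fun ω => by
      rw [Finset.sum_mul_sum]
      exact Finset.sum_congr rfl fun e _ => Finset.sum_congr rfl fun e' _ => by ring
    simp_rw [h2]
    rw [integral_finsetSum _ fun e _ => integrable_finsetSum _ fun e' _ =>
      (hint e e' x y).const_mul _]
    rw [Matrix.mul_apply]
    refine Finset.sum_congr rfl fun e _ => ?_
    rw [integral_finsetSum _ fun e' _ => (hint e e' x y).const_mul _, Finset.sum_eq_single e]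
    · rw [integral_const_mul, hZcov, if_pos rfl, mul_diagonal, transpose_apply]
      ring
    · intro e' _ he
      rw [integral_const_mul, hZcov, if_neg he.symm, mul_zero]
    · simp
  have hW1 : W⁻¹ * W = 1 := nonsing_inv_mul W hW
  have hW2 : Wᵀ * (Wᵀ)⁻¹ = 1 := mul_nonsing_inv _ (by rwa [det_transpose])
  have h3 : ∀ D : Matrix (Fin p) (Fin p) ℝ, W⁻¹ * (W * D * Wᵀ) * (Wᵀ)⁻¹ = D := fun D => by
    rw [show W⁻¹ * (W * D * Wᵀ) * (Wᵀ)⁻¹ = (W⁻¹ * W) * D * (Wᵀ * (Wᵀ)⁻¹) by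
      simp only [Matrix.mul_assoc], hW1, hW2, Matrix.one_mul, Matrix.mul_one]
  have h4 : popLocalCov μ (mixedField W Z) s g = W * diagonal (specDiag K s g) * Wᵀ := by
    unfold popLocalCov
    simp_rw [h1]
    have h5 : diagonal (specDiag K s g) = (n : ℝ)⁻¹ • ∑ i, ∑ j,
        g (s i - s j) • diagonal (fun a => K a (s i - s j)) := by
      ext a b
      simp only [Matrix.smul_apply, Matrix.sum_apply, smul_eq_mul]
      by_cases hab : a = b
      · subst hab
        simp [specDiag]
      · simp [diagonal_apply_ne _ hab]
    rw [h5]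
    simp only [Matrix.mul_smul, Matrix.smul_mul, Matrix.mul_sum, Matrix.sum_mul]
  rw [unmixedPopCov, h4, h3]

/-- Distinct points leave only the terms `i = j`. Positivity of `n` matters: the empty average is
`0`. -/
lemma specDiag_kernelZero (hn : 0 < n) {s : Fin n → EuclideanSpace ℝ (Fin d)}
    (hs : ∀ i j, i ≠ j → s i ≠ s j) (hK : ∀ a, K a 0 = 1) (a : Fin p) :
    specDiag K s kernelZero a = 1 := by
  have h : ∀ i, ∑ j, kernelZero (s i - s j) * K a (s i - s j) = 1 := fun i => by
    rw [Finset.sum_eq_single i]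
    · simp [kernelZero, hK]
    · intro j _ hj
      have : s i - s j ≠ 0 := sub_ne_zero.mpr (hs i j hj.symm)
      simp [kernelZero, this]
    · simp
  rw [specDiag, Finset.sum_congr rfl fun i _ => h i]
  have : (n : ℝ) ≠ 0 := by positivity
  simp [this]

lemma abs_specDiag_le {s : Fin n → EuclideanSpace ℝ (Fin d)} {g : EuclideanSpace ℝ (Fin d) → ℝ}
    {A C : ℝ} (hA : 0 ≤ A) (hC : 0 ≤ C) (hg : ∀ i, ∑ j, |g (s i - s j)| ≤ C)
    (hK : ∀ a x, |K a x| ≤ A) (a : Fin p) : |specDiag K s g a| ≤ C * A := by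
  have h1 : |∑ i, ∑ j, g (s i - s j) * K a (s i - s j)| ≤ n * (C * A) := by
    calc |∑ i, ∑ j, g (s i - s j) * K a (s i - s j)|
        ≤ ∑ i, ∑ j, |g (s i - s j)| * A := by
          refine (Finset.abs_sum_le_sum_abs _ _).trans (Finset.sum_le_sum fun i _ => ?_)
          refine (Finset.abs_sum_le_sum_abs _ _).trans (Finset.sum_le_sum fun j _ => ?_)
          rw [abs_mul]
          exact mul_le_mul_of_nonneg_left (hK _ _) (abs_nonneg _)
      _ = ∑ i, (∑ j, |g (s i - s j)|) * A := by simp_rw [Finset.sum_mul]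
      _ ≤ ∑ _i : Fin n, C * A := Finset.sum_le_sum fun i _ =>
          mul_le_mul_of_nonneg_right (hg i) hA
      _ = _ := by simp
  rw [specDiag, abs_mul, abs_of_nonneg (by positivity : (0 : ℝ) ≤ (n : ℝ)⁻¹)]
  rcases Nat.eq_zero_or_pos n with rfl | hn
  · simp; positivity
  · rw [inv_mul_le_iff₀ (by positivity)]
    exact h1

/-- Contraction of a kernel matrix with a symmetric matrix. -/
lemma sum_kernelMatrix_mul {s : Fin n → EuclideanSpace ℝ (Fin d)}
    {g : EuclideanSpace ℝ (Fin d) → ℝ} (hg : ∀ x, g (-x) = g x) (b c : Fin p)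
    {N : Fin n × Fin p → Fin n × Fin p → ℝ} (hN : ∀ u v, N u v = N v u) :
    ∑ u, ∑ v, kernelMatrix s g b c u v * N u v
      = ∑ i, ∑ j, g (s i - s j) * N (i, b) (j, c) := by
  have h1 : ∀ b c : Fin p, ∑ u : Fin n × Fin p, ∑ v : Fin n × Fin p,
      g (s u.1 - s v.1) * Matrix.single b c (1 : ℝ) u.2 v.2 * N u v
      = ∑ i, ∑ j, g (s i - s j) * N (i, b) (j, c) := fun b c => by
    rw [Fintype.sum_prod_type]
    refine Finset.sum_congr rfl fun i _ => ?_
    rw [Finset.sum_eq_single b]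
    · rw [Fintype.sum_prod_type]
      refine Finset.sum_congr rfl fun j _ => ?_
      rw [Finset.sum_eq_single c]
      · simp
      · intro e _ he
        simp [he.symm]
      · simp
    · intro e _ he
      refine Finset.sum_eq_zero fun v _ => ?_
      simp [he.symm]
    · simp
  have h2 : ∑ i, ∑ j, g (s i - s j) * N (i, c) (j, b)
      = ∑ i, ∑ j, g (s i - s j) * N (i, b) (j, c) := by
    rw [Finset.sum_comm]
    refine Finset.sum_congr rfl fun i _ => Finset.sum_congr rfl fun j _ => ?_
    rw [hN, ← hg, neg_sub]
  have h3 : ∑ u, ∑ v, kernelMatrix s g b c u v * N u v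
      = 1 / 2 * (∑ u : Fin n × Fin p, ∑ v : Fin n × Fin p,
          g (s u.1 - s v.1) * Matrix.single b c (1 : ℝ) u.2 v.2 * N u v
        + ∑ u : Fin n × Fin p, ∑ v : Fin n × Fin p,
          g (s u.1 - s v.1) * Matrix.single c b (1 : ℝ) u.2 v.2 * N u v) := by
    rw [← Finset.sum_add_distrib, Finset.mul_sum]
    refine Finset.sum_congr rfl fun u _ => ?_
    rw [← Finset.sum_add_distrib, Finset.mul_sum]
    refine Finset.sum_congr rfl fun v _ => ?_
    simp only [kernelMatrix, of_apply, Matrix.smul_apply, Matrix.add_apply, smul_eq_mul]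
    ring
  rw [h3, h1, h1, h2]
  ring

/-- The error `W⁻¹ M̂(g) W⁻ᵀ - D(g)`. -/
def errMat (W : Matrix (Fin p) (Fin p) ℝ) (Z : Fin p → EuclideanSpace ℝ (Fin d) → Ω → ℝ)
    (K : Fin p → EuclideanSpace ℝ (Fin d) → ℝ) (s : Fin n → EuclideanSpace ℝ (Fin d))
    (g : EuclideanSpace ℝ (Fin d) → ℝ) (ω : Ω) : Matrix (Fin p) (Fin p) ℝ :=
  W⁻¹ * sampleLocalCov (mixedField W Z) s g ω * (Wᵀ)⁻¹ - diagonal (specDiag K s g)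

omit [MeasurableSpace Ω] in
lemma unmixed_sampleLocalCov_apply (hW : IsUnit W.det) (s : Fin n → EuclideanSpace ℝ (Fin d))
    (g : EuclideanSpace ℝ (Fin d) → ℝ) (ω : Ω) (b c : Fin p) :
    (W⁻¹ * sampleLocalCov (mixedField W Z) s g ω * (Wᵀ)⁻¹) b c
      = (n : ℝ)⁻¹ * ∑ i, ∑ j, g (s i - s j) * (Z b (s i) ω * Z c (s j) ω) := by
  have hW1 : W⁻¹ * W = 1 := nonsing_inv_mul W hW
  have h1 : ∀ x y, W⁻¹ * vecMulVec (mixedField W Z x ω) (mixedField W Z y ω) * (Wᵀ)⁻¹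
      = vecMulVec (fun a => Z a x ω) (fun a => Z a y ω) := fun x y => by
    simp only [mixedField]
    rw [mul_vecMulVec, mulVec_mulVec, hW1, one_mulVec, vecMulVec_mul, ← transpose_nonsing_inv,
      vecMul_transpose, mulVec_mulVec, hW1, one_mulVec]
  unfold sampleLocalCov
  simp only [Matrix.mul_smul, Matrix.smul_mul, Matrix.mul_sum, Matrix.sum_mul, h1]
  simp only [Matrix.smul_apply, Matrix.sum_apply, smul_eq_mul, vecMulVec_apply]

/-- Evenness of the kernel permits the symmetrised matrix `kernelMatrix`. The centring constant `tr
(T R)` then reproduces `D(g)`. -/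
lemma errMat_apply [IsProbabilityMeasure μ] (hW : IsUnit W.det) (hZgauss : ∀ a, IsGaussianProcess (Z a) μ)
    (hZmean : ∀ a x, ∫ ω, Z a x ω ∂μ = 0)
    (hZcov : ∀ a b x y, ∫ ω, Z a x ω * Z b y ω ∂μ = if a = b then K a (x - y) else 0)
    (s : Fin n → EuclideanSpace ℝ (Fin d)) {g : EuclideanSpace ℝ (Fin d) → ℝ}
    (hg : ∀ x, g (-x) = g x) (ω : Ω) (b c : Fin p) :
    errMat W Z K s g ω b c = (n : ℝ)⁻¹ * (latentVec Z s ω ⬝ᵥ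
      kernelMatrix s g b c *ᵥ latentVec Z s ω - (kernelMatrix s g b c * latentCov μ Z s).trace) := by
  have h1 : latentVec Z s ω ⬝ᵥ kernelMatrix s g b c *ᵥ latentVec Z s ω
      = ∑ i, ∑ j, g (s i - s j) * (Z b (s i) ω * Z c (s j) ω) := by
    rw [← sum_kernelMatrix_mul hg b c (N := fun u v => Z u.2 (s u.1) ω * Z v.2 (s v.1) ω)
      fun u v => mul_comm _ _]
    simp only [dotProduct, mulVec, latentVec, Finset.mul_sum]
    exact Finset.sum_congr rfl fun u _ => Finset.sum_congr rfl fun v _ => by ring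
  have hsymm : ∀ u v, latentCov μ Z s u v = latentCov μ Z s v u := fun u v => by
    simp only [latentCov, of_apply]
    exact covariance_comm _ _
  have h2 : (n : ℝ)⁻¹ * (kernelMatrix s g b c * latentCov μ Z s).trace
      = diagonal (specDiag K s g) b c := by
    have h3 : (kernelMatrix s g b c * latentCov μ Z s).trace
        = ∑ i, ∑ j, g (s i - s j) * latentCov μ Z s (i, b) (j, c) := by
      rw [← sum_kernelMatrix_mul hg b c hsymm, Matrix.trace]
      refine Finset.sum_congr rfl fun u _ => ?_
      rw [Matrix.diag_apply, Matrix.mul_apply]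
      exact Finset.sum_congr rfl fun v _ => by rw [hsymm]
    rw [h3]
    simp only [latentCov_apply hZgauss hZmean hZcov]
    by_cases hbc : b = c
    · subst hbc
      simp [specDiag]
    · simp [hbc]
  rw [errMat, Matrix.sub_apply, unmixed_sampleLocalCov_apply hW, ← h2, h1]
  ring

omit [MeasurableSpace Ω] in
lemma errMat_transpose (hW : IsUnit W.det) (s : Fin n → EuclideanSpace ℝ (Fin d))
    {g : EuclideanSpace ℝ (Fin d) → ℝ} (hg : ∀ x, g (-x) = g x) (ω : Ω) :
    (errMat W Z K s g ω)ᵀ = errMat W Z K s g ω := by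
  ext b c
  rw [transpose_apply, errMat, Matrix.sub_apply, Matrix.sub_apply,
    unmixed_sampleLocalCov_apply hW, unmixed_sampleLocalCov_apply hW]
  congr 1
  · congr 1
    rw [Finset.sum_comm]
    refine Finset.sum_congr rfl fun i _ => Finset.sum_congr rfl fun j _ => ?_
    rw [← hg, neg_sub, mul_comm (Z c _ ω)]
  · by_cases hbc : b = c
    · rw [hbc]
    · rw [diagonal_apply_ne _ hbc, diagonal_apply_ne _ (Ne.symm hbc)]

/-- Linear combinations of the errors are centred quadratic forms. -/
lemma sum_mul_errMat [IsProbabilityMeasure μ] (hW : IsUnit W.det) (hZgauss : ∀ a, IsGaussianProcess (Z a) μ)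
    (hZmean : ∀ a x, ∫ ω, Z a x ω ∂μ = 0)
    (hZcov : ∀ a b x y, ∫ ω, Z a x ω * Z b y ω ∂μ = if a = b then K a (x - y) else 0)
    (s : Fin n → EuclideanSpace ℝ (Fin d)) {f : Fin k → EuclideanSpace ℝ (Fin d) → ℝ}
    (hf : ∀ l x, f l (-x) = f l x) (c : Fin (k + 1) × (Fin p × Fin p) → ℝ) (ω : Ω) :
    ∑ a, c a * errMat W Z K s (kernels f a.1) ω a.2.1 a.2.2
      = (n : ℝ)⁻¹ * (latentVec Z s ω ⬝ᵥ combMatrix s f c *ᵥ latentVec Z s ω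
        - (combMatrix s f c * latentCov μ Z s).trace) := by
  simp only [errMat_apply hW hZgauss hZmean hZcov s (kernels_neg hf _), combMatrix,
    Matrix.sum_mulVec, dotProduct_sum, Matrix.sum_mul, Matrix.trace_sum, Matrix.smul_mulVec,
    dotProduct_smul, Matrix.smul_mul, Matrix.trace_smul, smul_eq_mul]
  rw [← Finset.sum_sub_distrib, Finset.mul_sum]
  exact Finset.sum_congr rfl fun a _ => by ring

end Algebra

/-! ### Entrywise bounds and positivity of traces -/

section MatrixBounds

lemma abs_matrix_mul_apply_le {ι κ ν : Type*} [Fintype κ] {A : Matrix ι κ ℝ} {B : Matrix κ ν ℝ}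
    {a b : ℝ} (ha : 0 ≤ a) (hA : ∀ i j, |A i j| ≤ a) (hB : ∀ i j, |B i j| ≤ b) (i : ι) (j : ν) :
    |(A * B) i j| ≤ Fintype.card κ * (a * b) := by
  rw [Matrix.mul_apply]
  calc |∑ x, A i x * B x j| ≤ ∑ x, |A i x| * |B x j| := by
        refine (Finset.abs_sum_le_sum_abs _ _).trans (le_of_eq ?_)
        simp_rw [abs_mul]
    _ ≤ ∑ _x : κ, a * b := Finset.sum_le_sum fun x _ =>
        mul_le_mul (hA _ _) (hB _ _) (abs_nonneg _) ha
    _ = _ := by simp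

lemma trace_mul_mul_mul_nonneg {ι : Type*} [Fintype ι] [DecidableEq ι] {R T : Matrix ι ι ℝ}
    (hR : R.PosSemidef) (hT : Tᵀ = T) : 0 ≤ (R * T * R * T).trace := by
  obtain ⟨lam, -, htr, -⟩ := exists_weights_map_quadraticForm hR hT
  rw [← htr]
  exact Finset.sum_nonneg fun _ _ => sq_nonneg _

lemma exists_abs_apply_le {ι κ : Type*} [Finite ι] [Finite κ] (A : Matrix ι κ ℝ) :
    ∃ a, 0 ≤ a ∧ ∀ i j, |A i j| ≤ a := by
  cases nonempty_fintype ι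
  cases nonempty_fintype κ
  refine ⟨∑ i, ∑ j, |A i j|, Finset.sum_nonneg fun _ _ => Finset.sum_nonneg fun _ _ => abs_nonneg _,
    fun i j => ?_⟩
  exact (Finset.single_le_sum (f := fun j => |A i j|) (fun _ _ => abs_nonneg _)
    (Finset.mem_univ j)).trans (Finset.single_le_sum (f := fun i => ∑ j, |A i j|)
      (fun _ _ => Finset.sum_nonneg fun _ _ => abs_nonneg _) (Finset.mem_univ i))

end MatrixBounds

/-! ### The asymptotic covariance matrix -/

section Covariance

variable {Ω : Type*} [MeasurableSpace Ω] {μ : Measure Ω} {d p k n : ℕ}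
  {Z : Fin p → EuclideanSpace ℝ (Fin d) → Ω → ℝ} {W : Matrix (Fin p) (Fin p) ℝ}
  {s : Fin n → EuclideanSpace ℝ (Fin d)} {f : Fin k → EuclideanSpace ℝ (Fin d) → ℝ}

/-- By bilinearity of the trace. The right side is the variance of `n^{1/2}` times the combination
of the errors with coefficients `c`, so `Ṽ` is the exact covariance matrix of the scaled errors. -/
lemma dotProduct_vTilde_mulVec (c : Fin (k + 1) × (Fin p × Fin p) → ℝ) :
    c ⬝ᵥ vTilde μ Z s f *ᵥ c = 2 * (n : ℝ)⁻¹ *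
      (latentCov μ Z s * combMatrix s f c * latentCov μ Z s * combMatrix s f c).trace := by
  simp only [combMatrix, Matrix.sum_mul, Matrix.mul_smul, Matrix.smul_mul,
    Matrix.trace_sum, Matrix.trace_smul, smul_eq_mul, dotProduct, mulVec, vTilde, sigmaMatrix,
    of_apply, Finset.mul_sum]
  rw [Finset.sum_comm]
  refine Finset.sum_congr rfl fun a _ => Finset.sum_congr rfl fun b _ => ?_
  ring

lemma vTilde_transpose : (vTilde μ Z s f)ᵀ = vTilde μ Z s f := by
  ext a b
  simp only [transpose_apply, vTilde, sigmaMatrix, of_apply]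
  congr 1
  rw [Matrix.mul_assoc _ (latentCov μ Z s), Matrix.trace_mul_comm, ← Matrix.mul_assoc]

lemma posSemidef_vTilde [IsProbabilityMeasure μ] (hZgauss : ∀ a, IsGaussianProcess (Z a) μ)
    (hf : ∀ l x, f l (-x) = f l x) : (vTilde μ Z s f).PosSemidef := by
  rw [posSemidef_iff_dotProduct_mulVec]
  refine ⟨?_, fun c => ?_⟩
  · rw [IsHermitian, conjTranspose_eq_transpose_of_trivial, vTilde_transpose]
  · rw [star_trivial, dotProduct_vTilde_mulVec]
    have := trace_mul_mul_mul_nonneg (posSemidef_latentCov hZgauss s)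
      (combMatrix_transpose (s := s) hf c)
    positivity

/-- The matrix `M G`. -/
def linMatrix (μ : Measure Ω) (W : Matrix (Fin p) (Fin p) ℝ)
    (Z : Fin p → EuclideanSpace ℝ (Fin d) → Ω → ℝ) (s : Fin n → EuclideanSpace ℝ (Fin d))
    (f : Fin k → EuclideanSpace ℝ (Fin d) → ℝ) :
    Matrix (Fin p × Fin p) (Fin (k + 1) × (Fin p × Fin p)) ℝ :=
  matMInv W * matG fun l => unmixedPopCov μ W Z s (f l)

lemma asympCov_eq :
    asympCov μ W Z s f = linMatrix μ W Z s f * vTilde μ Z s f * (linMatrix μ W Z s f)ᵀ := by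
  rw [asympCov, linMatrix, Matrix.transpose_mul]
  simp only [Matrix.mul_assoc]

lemma posSemidef_asympCov [IsProbabilityMeasure μ] (hZgauss : ∀ a, IsGaussianProcess (Z a) μ)
    (hf : ∀ l x, f l (-x) = f l x) : (asympCov μ W Z s f).PosSemidef := by
  have h := (posSemidef_vTilde (s := s) hZgauss hf).mul_mul_conjTranspose_same
    (linMatrix μ W Z s f)
  rwa [conjTranspose_eq_transpose_of_trivial, ← asympCov_eq] at h

lemma dotProduct_asympCov_mulVec (t : Fin p × Fin p → ℝ) :
    t ⬝ᵥ asympCov μ W Z s f *ᵥ t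
      = ((linMatrix μ W Z s f)ᵀ *ᵥ t) ⬝ᵥ vTilde μ Z s f *ᵥ ((linMatrix μ W Z s f)ᵀ *ᵥ t) := by
  rw [asympCov_eq, ← mulVec_mulVec, ← mulVec_mulVec, dotProduct_mulVec, ← mulVec_transpose]

lemma matMInv_mulVec (F : Matrix (Fin p) (Fin p) ℝ) (i j : Fin p) :
    (matMInv W *ᵥ fun a => F a.1 a.2) (i, j) = (F * W⁻¹) i j := by
  simp only [mulVec, dotProduct, matMInv, of_apply, Matrix.mul_apply]
  rw [Fintype.sum_prod_type, Finset.sum_eq_single i]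
  · simp only [if_true]
    exact Finset.sum_congr rfl fun b _ => mul_comm _ _
  · intro b _ hb
    simp [hb.symm]
  · simp

/-- Identifies `G` as the matrix of the linear part of the joint diagonaliser. -/
lemma matG_mulVec (D : Fin k → Matrix (Fin p) (Fin p) ℝ)
    (E : Fin (k + 1) → Matrix (Fin p) (Fin p) ℝ) (i j : Fin p) :
    (matG D *ᵥ fun a => E a.1 a.2.1 a.2.2) (i, j)
      = linearPart (fun l a => D l a a) (E 0) (fun l => E l.succ) i j := by
  have h1 : ∀ v, (matB D *ᵥ v) (i, j)
      = (if i = j then 1 else (∑ l, (D l i i - D l j j) ^ 2)⁻¹) * v (i, j) := fun v => by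
    rw [matB, mulVec_diagonal]
  have h2 : (matARow D *ᵥ fun a => E a.1 a.2.1 a.2.2) (i, j)
      = (if i = j then -1 / 2 else -∑ l, (D l i i - D l j j) * D l i i) * E 0 i j
        + ∑ l, (if i = j then 0 else D l i i - D l j j) * E l.succ i j := by
    simp only [mulVec, dotProduct, matARow, of_apply]
    rw [Fintype.sum_prod_type, Fin.sum_univ_succ]
    simp only [Fin.cons_zero, Fin.cons_succ]
    have h3 : ∀ (v : Fin p × Fin p → ℝ) (e : Fin p × Fin p → ℝ),
        ∑ b, diagonal v (i, j) b * e b = v (i, j) * e (i, j) := fun v e => by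
      rw [← mulVec_diagonal]; rfl
    simp only [matA0, matA, h3]
  rw [matG, ← mulVec_mulVec, h1, h2, linearPart]
  split_ifs with hij
  · subst hij
    simp
  · congr 1
    rw [neg_mul, Finset.sum_mul, ← Finset.sum_neg_distrib, ← Finset.sum_add_distrib]
    exact Finset.sum_congr rfl fun l _ => by ring

lemma abs_matG_le {D : Fin k → Matrix (Fin p) (Fin p) ℝ} {C δ : ℝ} (hδ : 0 < δ)
    (hC : ∀ l i, |D l i i| ≤ C) (hgap : ∀ i j, i ≠ j → ∃ l, δ ≤ |D l i i - D l j j|)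
    (a : Fin p × Fin p) (b : Fin (k + 1) × (Fin p × Fin p)) :
    |matG D a b| ≤ (1 + (δ ^ 2)⁻¹) * (1 + k * (2 * C * C) + 2 * |C|) := by
  have hsub : ∀ l i j, |D l i i - D l j j| ≤ 2 * C := fun l i j =>
    (abs_sub _ _).trans (by linarith [hC l i, hC l j])
  have h1 : matG D a b = (if a.1 = a.2 then 1 else (∑ l, (D l a.1 a.1 - D l a.2 a.2) ^ 2)⁻¹)
      * matARow D a b := by
    rw [matG, matB, diagonal_mul]
  have hCC : (0 : ℝ) ≤ k * (2 * C * C) := by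
    have : 0 ≤ C * C := mul_self_nonneg C
    have : 0 ≤ 2 * C * C := by linarith
    positivity
  have h0 : (0 : ℝ) < (δ ^ 2)⁻¹ := by positivity
  rw [h1, abs_mul]
  refine mul_le_mul ?_ ?_ (abs_nonneg _) (by linarith)
  · split_ifs with h
    · rw [abs_one]; linarith
    · have h2 := sq_le_sum_sq_sub (d := fun l i => D l i i) hδ (hgap _ _ h)
      have h3 : 0 < δ ^ 2 := by positivity
      rw [abs_of_nonneg (inv_nonneg.mpr (h3.le.trans h2))]
      exact (inv_anti₀ h3 h2).trans (by linarith)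
  · obtain ⟨l, b⟩ := b
    have hC' := abs_nonneg C
    simp only [matARow, of_apply]
    refine Fin.cases ?_ (fun l => ?_) l
    · rw [Fin.cons_zero, matA0, diagonal_apply]
      split_ifs
      · norm_num [abs_div]; linarith
      · rw [abs_neg]
        have h4 : |∑ l, (D l a.1 a.1 - D l a.2 a.2) * D l a.1 a.1| ≤ k * (2 * C * C) := by
          refine (Finset.abs_sum_le_sum_abs _ _).trans ?_
          calc _ ≤ ∑ _l : Fin k, 2 * C * C := Finset.sum_le_sum fun l _ => by
                rw [abs_mul]
                exact mul_le_mul (hsub _ _ _) (hC _ _) (abs_nonneg _)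
                  ((abs_nonneg _).trans (hsub l a.1 a.2))
            _ = _ := by simp
        linarith
      · rw [abs_zero]; linarith
    · rw [Fin.cons_succ, matA, diagonal_apply]
      split_ifs
      · rw [abs_zero]; linarith
      · have := hsub l a.1 a.2
        have := le_abs_self C
        linarith
      · rw [abs_zero]; linarith

/-- The trace over `np` indices is at most `np` times a row sum, and the factor `n⁻¹` cancels `n`.
-/
lemma abs_vTilde_le {r C : ℝ} (hR : ∀ u, ∑ v, |latentCov μ Z s u v| ≤ r)
    (hf : ∀ l (b c : Fin p) u, ∑ v, |kernelMatrix s (kernels f l) b c u v| ≤ C)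
    (a b : Fin (k + 1) × (Fin p × Fin p)) : |vTilde μ Z s f a b| ≤ 2 * p * |r * C * r * C| := by
  have h := abs_trace_le (rowSum_mul_le (rowSum_mul_le (rowSum_mul_le hR
    (hf a.1 a.2.1 a.2.2)) hR) (hf b.1 b.2.1 b.2.2))
  simp only [vTilde, sigmaMatrix, of_apply, abs_mul, Fintype.card_prod, Fintype.card_fin] at h ⊢
  rw [abs_two, abs_of_nonneg (by positivity : (0 : ℝ) ≤ (n : ℝ)⁻¹)]
  rcases Nat.eq_zero_or_pos n with rfl | hn
  · simp; positivity
  · have hn' : (n : ℝ) ≠ 0 := by positivity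
    refine (mul_le_mul_of_nonneg_left (h.trans (mul_le_mul_of_nonneg_left (le_abs_self _)
      (by positivity))) (by positivity)).trans (le_of_eq ?_)
    simp only [abs_mul]
    push_cast
    field_simp

/-- The entries of `M G` and of the asymptotic covariance matrices are bounded. -/
lemma exists_linMatrix_asympCov_le (k p : ℕ) (W : Matrix (Fin p) (Fin p) ℝ) {δ C r B : ℝ}
    (hδ : 0 < δ) : ∃ b ≥ 0, ∀ (Ω : Type*) (_ : MeasurableSpace Ω) (μ : Measure Ω) (d n : ℕ)
      (Z : Fin p → EuclideanSpace ℝ (Fin d) → Ω → ℝ) (s : Fin n → EuclideanSpace ℝ (Fin d))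
      (f : Fin k → EuclideanSpace ℝ (Fin d) → ℝ),
      (∀ u, ∑ v, |latentCov μ Z s u v| ≤ r) →
      (∀ l (b c : Fin p) u, ∑ v, |kernelMatrix s (kernels f l) b c u v| ≤ B) →
      (∀ l i, |unmixedPopCov μ W Z s (f l) i i| ≤ C) →
      (∀ i j, i ≠ j → ∃ l, δ ≤
        |unmixedPopCov μ W Z s (f l) i i - unmixedPopCov μ W Z s (f l) j j|) →
      (∀ i j, |linMatrix μ W Z s f i j| ≤ b) ∧ ∀ i j, |asympCov μ W Z s f i j| ≤ b := by
  obtain ⟨m, hm0, hm⟩ := exists_abs_apply_le (matMInv W)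
  set b₁ : ℝ := Fintype.card (Fin p × Fin p) *
    (m * ((1 + (δ ^ 2)⁻¹) * (1 + k * (2 * C * C) + 2 * |C|))) with hb₁
  have hCC : (0 : ℝ) ≤ k * (2 * C * C) := by
    have : 0 ≤ C * C := mul_self_nonneg C
    have : 0 ≤ 2 * C * C := by linarith
    positivity
  have hb₁0 : 0 ≤ b₁ := by positivity
  set κ : ℝ := ((Fintype.card (Fin (k + 1) × (Fin p × Fin p)) : ℕ) : ℝ) with hκ
  have hκ0 : 0 ≤ κ := by positivity
  set b₂ : ℝ := κ * ((κ * (b₁ * (2 * p * |r * B * r * B|))) * b₁) with hb₂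
  have hb₂0 : 0 ≤ b₂ := by positivity
  refine ⟨b₁ + b₂, by positivity, fun Ω _ μ d n Z s f hR hf hD hgap => ?_⟩
  have h1 : ∀ i j, |linMatrix μ W Z s f i j| ≤ b₁ :=
    abs_matrix_mul_apply_le hm0 hm (abs_matG_le hδ hD hgap)
  refine ⟨fun i j => (h1 i j).trans (by linarith), fun i j => ?_⟩
  rw [asympCov_eq]
  refine (abs_matrix_mul_apply_le (by positivity)
    (abs_matrix_mul_apply_le hb₁0 h1 (abs_vTilde_le hR hf)) (fun i j => h1 j i) i j).trans ?_
  rw [← hκ]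
  linarith

end Covariance

/-! ### The linear approximation and the size of the errors -/

section Linearisation

variable {Ω : Type*} [MeasurableSpace Ω] {μ : Measure Ω} {d p k n : ℕ}
  {Z : Fin p → EuclideanSpace ℝ (Fin d) → Ω → ℝ} {W : Matrix (Fin p) (Fin p) ℝ}
  {K : Fin p → EuclideanSpace ℝ (Fin d) → ℝ}
  {s : Fin n → EuclideanSpace ℝ (Fin d)} {f : Fin k → EuclideanSpace ℝ (Fin d) → ℝ}

/-- The components of `Z` are independent centred stationary Gaussian processes with covariance
functions `K a`. -/
structure IsLatentField (μ : Measure Ω) (Z : Fin p → EuclideanSpace ℝ (Fin d) → Ω → ℝ)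
    (K : Fin p → EuclideanSpace ℝ (Fin d) → ℝ) : Prop where
  meas : ∀ a x, Measurable (Z a x)
  gauss : ∀ a, IsGaussianProcess (Z a) μ
  indep : iIndepFun (fun (a : Fin p) (ω : Ω) (x : EuclideanSpace ℝ (Fin d)) => Z a x ω) μ
  mean : ∀ a x, ∫ ω, Z a x ω ∂μ = 0
  cov : ∀ a b x y, ∫ ω, Z a x ω * Z b y ω ∂μ = if a = b then K a (x - y) else 0

/-- All the entries of the errors `W⁻¹ M̂(f_l) W⁻ᵀ - D(f_l)`, `l = 0, …, k`. -/
def errVec (W : Matrix (Fin p) (Fin p) ℝ) (Z : Fin p → EuclideanSpace ℝ (Fin d) → Ω → ℝ)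
    (K : Fin p → EuclideanSpace ℝ (Fin d) → ℝ) (s : Fin n → EuclideanSpace ℝ (Fin d))
    (f : Fin k → EuclideanSpace ℝ (Fin d) → ℝ) (ω : Ω) (a : Fin (k + 1) × (Fin p × Fin p)) : ℝ :=
  errMat W Z K s (kernels f a.1) ω a.2.1 a.2.2

/-- The linear approximation `n^{1/2} M G vect(E)` of the scaled error. -/
def linearError (μ : Measure Ω) (W : Matrix (Fin p) (Fin p) ℝ)
    (Z : Fin p → EuclideanSpace ℝ (Fin d) → Ω → ℝ) (K : Fin p → EuclideanSpace ℝ (Fin d) → ℝ)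
    (s : Fin n → EuclideanSpace ℝ (Fin d)) (f : Fin k → EuclideanSpace ℝ (Fin d) → ℝ) (ω : Ω) :
    EuclideanSpace ℝ (Fin p × Fin p) :=
  √(n : ℝ) • WithLp.toLp 2 (linMatrix μ W Z s f *ᵥ errVec W Z K s f ω)

lemma measurable_quadraticForm {ι : Type*} [Fintype ι] [DecidableEq ι] (T R : Matrix ι ι ℝ) :
    Measurable fun z : EuclideanSpace ℝ ι => z ⬝ᵥ T *ᵥ z - (T * R).trace := by
  simp only [dotProduct, mulVec]
  fun_prop

lemma measurable_errVec [IsProbabilityMeasure μ] (hZ : IsLatentField μ Z K) (hW : IsUnit W.det)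
    (hf : ∀ l x, f l (-x) = f l x) (a : Fin (k + 1) × (Fin p × Fin p)) :
    Measurable fun ω => errVec W Z K s f ω a := by
  simp only [errVec, errMat_apply hW hZ.gauss hZ.mean hZ.cov s (kernels_neg hf _)]
  exact ((measurable_quadraticForm _ _).comp (measurable_latentVec hZ.meas s)).const_mul _

lemma measurable_linearError [IsProbabilityMeasure μ] (hZ : IsLatentField μ Z K)
    (hW : IsUnit W.det) (hf : ∀ l x, f l (-x) = f l x) :
    Measurable (linearError μ W Z K s f) := by
  have h := measurable_errVec (s := s) hZ hW hf
  have h2 : Measurable fun ω => linMatrix μ W Z s f *ᵥ errVec W Z K s f ω := by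
    refine measurable_pi_lambda _ fun i => ?_
    simp only [mulVec, dotProduct]
    exact Finset.measurable_sum _ fun a _ => (h a).const_mul _
  have h3 : Measurable (WithLp.toLp 2 :
      (Fin p × Fin p → ℝ) → EuclideanSpace ℝ (Fin p × Fin p)) := by fun_prop
  exact (h3.comp h2).const_smul (√(n : ℝ))

/-- The characteristic function of the linear approximation is close to the Gaussian one. -/
lemma norm_charFun_linearError_sub_le [IsProbabilityMeasure μ] (hZ : IsLatentField μ Z K)
    (hW : IsUnit W.det) (hf : ∀ l x, f l (-x) = f l x) (hn : 0 < n)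
    (t : EuclideanSpace ℝ (Fin p × Fin p)) {ε r B : ℝ} (hε : 0 ≤ ε)
    (hr : ∀ x : ℝ, |x| < r → ‖charFun centredChiSq x - Complex.exp (-(x : ℂ) ^ 2)‖ ≤ ε * x ^ 2)
    (hB : ∀ i, ∑ j, |(combMatrix s f ((linMatrix μ W Z s f)ᵀ *ᵥ t) * latentCov μ Z s) i j| ≤ B)
    (hnB : (√(n : ℝ))⁻¹ * B < r) :
    ‖charFun (μ.map (linearError μ W Z K s f)) t
      - charFun (multivariateGaussian 0 (asympCov μ W Z s f)) t‖ ≤ ε * (p * B ^ 2) := by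
  set c := (linMatrix μ W Z s f)ᵀ *ᵥ t with hc
  set R := latentCov μ Z s with hR
  set T := combMatrix s f c with hT
  have hRp : R.PosSemidef := posSemidef_latentCov hZ.gauss s
  have hTs : Tᵀ = T := combMatrix_transpose hf c
  have hn' : (0 : ℝ) < n := by positivity
  have hsq : (√(n : ℝ))⁻¹ ^ 2 = (n : ℝ)⁻¹ := by rw [inv_pow, Real.sq_sqrt hn'.le]
  set q : EuclideanSpace ℝ (Fin n × Fin p) → ℝ := fun z => z ⬝ᵥ T *ᵥ z - (T * R).trace with hq
  have hqm : Measurable q := measurable_quadraticForm T R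
  -- Moving `M G` to the other side, the projection on `t` is the combination of the errors with
  -- coefficients `(M G)ᵀ t`, hence `n^{-1/2}` times one centred quadratic form.
  have hinner : ∀ ω, inner ℝ (linearError μ W Z K s f ω) t
      = (√(n : ℝ))⁻¹ * q (latentVec Z s ω) := fun ω => by
    have h1 := sum_mul_errMat (s := s) hW hZ.gauss hZ.mean hZ.cov hf c ω
    have h2 : inner ℝ (linearError μ W Z K s f ω) t
        = √(n : ℝ) * (c ⬝ᵥ errVec W Z K s f ω) := by
      rw [linearError, real_inner_smul_left, EuclideanSpace.inner_eq_star_dotProduct, star_trivial]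
      rw [hc, dotProduct_mulVec, mulVec_transpose]
    have h3 : c ⬝ᵥ errVec W Z K s f ω = (n : ℝ)⁻¹ * q (latentVec Z s ω) := h1
    rw [h2, h3, ← mul_assoc]
    congr 1
    rw [← hsq]
    have : √(n : ℝ) ≠ 0 := by positivity
    field_simp
  have hchar : charFun (μ.map (linearError μ W Z K s f)) t
      = charFun ((multivariateGaussian 0 R).map q) (√(n : ℝ))⁻¹ := by
    rw [← map_latentVec hZ.meas hZ.gauss hZ.indep hZ.mean s,
      Measure.map_map hqm (measurable_latentVec hZ.meas s), charFun_apply, charFun_apply_real,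
      integral_map (measurable_linearError hZ hW hf).aemeasurable (by fun_prop),
      integral_map (hqm.comp (measurable_latentVec hZ.meas s)).aemeasurable (by fun_prop)]
    refine integral_congr_ae (.of_forall fun ω => ?_)
    simp only [hinner, Function.comp_apply]
    push_cast
    rfl
  -- The exponent in the chi-square approximation is exactly that of the Gaussian with covariance
  -- `F_k`; only the shape of the law is approximated.
  have hvar : (((√(n : ℝ))⁻¹) ^ 2 * (R * T * R * T).trace : ℝ)
      = (t ⬝ᵥ asympCov μ W Z s f *ᵥ t) / 2 := by
    rw [hsq, dotProduct_asympCov_mulVec, dotProduct_vTilde_mulVec]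
    ring
  have hmain := norm_charFun_quadraticForm_sub_le (u := (√(n : ℝ))⁻¹) hRp hTs hr hB
    (by rwa [abs_of_nonneg (by positivity)])
  rw [hchar, charFun_multivariateGaussian (posSemidef_asympCov hZ.gauss hf)]
  have hexp : Complex.exp ((inner ℝ t (0 : EuclideanSpace ℝ (Fin p × Fin p)) : ℝ) * Complex.I
      - ((t ⬝ᵥ asympCov μ W Z s f *ᵥ t : ℝ) : ℂ) / 2)
      = Complex.exp (-((((√(n : ℝ))⁻¹) ^ 2 * (R * T * R * T).trace : ℝ) : ℂ)) := by
    rw [hvar, inner_zero_right]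
    push_cast
    congr 1
    ring
  rw [hexp]
  refine hmain.trans (mul_le_mul_of_nonneg_left ?_ hε)
  have htr := (trace_eq_sum_sq_le hRp hTs hB).2
  rw [hsq, inv_mul_le_iff₀ hn']
  refine htr.trans (le_of_eq ?_)
  simp [mul_assoc]

/-- The second moment is `2 n⁻² tr (R T R T)`, and the trace is at most `np` times a squared row
sum. -/
lemma integral_errVec_sq_le [IsProbabilityMeasure μ] (hZ : IsLatentField μ Z K)
    (hW : IsUnit W.det) (hf : ∀ l x, f l (-x) = f l x) {r B : ℝ}
    (hR : ∀ u, ∑ v, |latentCov μ Z s u v| ≤ r)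
    (hT : ∀ l (b c : Fin p) u, ∑ v, |kernelMatrix s (kernels f l) b c u v| ≤ B)
    (a : Fin (k + 1) × (Fin p × Fin p)) :
    Integrable (fun ω => errVec W Z K s f ω a ^ 2) μ ∧
      ∫ ω, errVec W Z K s f ω a ^ 2 ∂μ ≤ 2 * p * (B * r) ^ 2 * (n : ℝ)⁻¹ := by
  set R := latentCov μ Z s with hRdef
  set T := kernelMatrix s (kernels f a.1) a.2.1 a.2.2 with hTdef
  have hRp : R.PosSemidef := posSemidef_latentCov hZ.gauss s
  have hTs : Tᵀ = T := kernelMatrix_transpose (kernels_neg hf _) _ _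
  set q : EuclideanSpace ℝ (Fin n × Fin p) → ℝ := fun z => z ⬝ᵥ T *ᵥ z - (T * R).trace with hq
  have hqm : Measurable q := measurable_quadraticForm T R
  have herr : (fun ω => errVec W Z K s f ω a ^ 2)
      = fun ω => (n : ℝ)⁻¹ ^ 2 * (fun z => q z ^ 2) (latentVec Z s ω) := by
    funext ω
    simp only [errVec, errMat_apply hW hZ.gauss hZ.mean hZ.cov s (kernels_neg hf _)]
    rw [mul_pow]
  obtain ⟨hint, hval⟩ := integral_sq_quadraticForm hRp hTs
  have hmap := map_latentVec hZ.meas hZ.gauss hZ.indep hZ.mean s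
  have hlm := (measurable_latentVec hZ.meas s).aemeasurable (μ := μ)
  rw [← hmap] at hint hval
  rw [herr]
  refine ⟨((integrable_map_measure (hqm.pow_const 2).aestronglyMeasurable hlm).mp hint).const_mul _,
    ?_⟩
  rw [integral_const_mul]
  have hval' : ∫ ω, (fun z => q z ^ 2) (latentVec Z s ω) ∂μ = 2 * (R * T * R * T).trace := by
    rw [← hval, integral_map hlm (hqm.pow_const 2).aestronglyMeasurable]
  rw [hval']
  have htr := (trace_eq_sum_sq_le hRp hTs (rowSum_mul_le (hT a.1 a.2.1 a.2.2) hR)).2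
  simp only [Fintype.card_prod, Fintype.card_fin, Nat.cast_mul] at htr
  rcases Nat.eq_zero_or_pos n with hn | hn
  · simp [hn]
  · have hn' : (0 : ℝ) < n := by positivity
    calc (n : ℝ)⁻¹ ^ 2 * (2 * (R * T * R * T).trace)
        ≤ (n : ℝ)⁻¹ ^ 2 * (2 * (n * p * (B * r) ^ 2)) := by gcongr
      _ = _ := by field_simp

/-- A bound for the Frobenius norms of all the errors. -/
def errBound (W : Matrix (Fin p) (Fin p) ℝ) (Z : Fin p → EuclideanSpace ℝ (Fin d) → Ω → ℝ)
    (K : Fin p → EuclideanSpace ℝ (Fin d) → ℝ) (s : Fin n → EuclideanSpace ℝ (Fin d))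
    (f : Fin k → EuclideanSpace ℝ (Fin d) → ℝ) (ω : Ω) : ℝ :=
  p * √(∑ a, errVec W Z K s f ω a ^ 2)

omit [MeasurableSpace Ω] in
lemma errBound_sq (ω : Ω) :
    errBound W Z K s f ω ^ 2 = p ^ 2 * ∑ a, errVec W Z K s f ω a ^ 2 := by
  rw [errBound, mul_pow, Real.sq_sqrt (Finset.sum_nonneg fun _ _ => sq_nonneg _)]

lemma integral_errBound_sq_le [IsProbabilityMeasure μ] (hZ : IsLatentField μ Z K)
    (hW : IsUnit W.det) (hf : ∀ l x, f l (-x) = f l x) {r B : ℝ}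
    (hR : ∀ u, ∑ v, |latentCov μ Z s u v| ≤ r)
    (hT : ∀ l (b c : Fin p) u, ∑ v, |kernelMatrix s (kernels f l) b c u v| ≤ B) :
    Integrable (fun ω => errBound W Z K s f ω ^ 2) μ ∧
      ∫ ω, errBound W Z K s f ω ^ 2 ∂μ
        ≤ p ^ 2 * (Fintype.card (Fin (k + 1) × (Fin p × Fin p)) * (2 * p * (B * r) ^ 2))
          * (n : ℝ)⁻¹ := by
  have h := integral_errVec_sq_le (W := W) hZ hW hf hR hT
  simp only [errBound_sq]
  refine ⟨(integrable_finsetSum _ fun a _ => (h a).1).const_mul _, ?_⟩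
  rw [integral_const_mul, integral_finsetSum _ fun a _ => (h a).1, mul_assoc]
  refine mul_le_mul_of_nonneg_left ?_ (by positivity)
  refine (Finset.sum_le_sum fun a _ => (h a).2).trans (le_of_eq ?_)
  rw [Finset.sum_const, nsmul_eq_mul, Finset.card_univ]
  ring

open scoped Matrix.Norms.Frobenius in
omit [MeasurableSpace Ω] in
lemma norm_errMat_le (l : Fin (k + 1)) (ω : Ω) :
    ‖errMat W Z K s (kernels f l) ω‖ ≤ errBound W Z K s f ω := by
  refine frobenius_norm_le_of_abs_le (Real.sqrt_nonneg _) fun i j => ?_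
  have h : errVec W Z K s f ω (l, (i, j)) ^ 2 ≤ ∑ a, errVec W Z K s f ω a ^ 2 :=
    Finset.single_le_sum (f := fun a => errVec W Z K s f ω a ^ 2) (fun _ _ => sq_nonneg _)
      (Finset.mem_univ (l, (i, j)))
  exact Real.abs_le_sqrt h

end Linearisation

-- The entry bound gives `|xᵀ E x| ≤ |x|² / 2`, so `1 + E` is positive definite and its inverse
-- square root is a solution.
open scoped MatrixOrder in
lemma exists_mul_mul_transpose_eq_one {p : ℕ} {E : Matrix (Fin p) (Fin p) ℝ} (hE : Eᵀ = E)
    (h : ∀ i j, p * |E i j| ≤ 1 / 2) :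
    ∃ Γ : Matrix (Fin p) (Fin p) ℝ, Γ * (1 + E) * Γᵀ = 1 := by
  have hpos : (1 + E).PosDef := by
    rw [posDef_iff_dotProduct_mulVec]
    refine ⟨?_, fun {x} hx => ?_⟩
    · rw [IsHermitian, conjTranspose_eq_transpose_of_trivial, transpose_add, transpose_one, hE]
    · rw [star_trivial, add_mulVec, one_mulVec, dotProduct_add]
      have h1 : 0 < x ⬝ᵥ x := by
        have := dotProduct_star_self_pos_iff.mpr hx
        rwa [star_trivial] at this
      have h2 : |x ⬝ᵥ E *ᵥ x| ≤ 1 / 2 * (x ⬝ᵥ x) := by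
        have h3 : ∀ i j, |x i * (E i j * x j)| ≤ |E i j| * ((x i ^ 2 + x j ^ 2) / 2) :=
          fun i j => by
            rw [show x i * (E i j * x j) = E i j * (x i * x j) by ring, abs_mul]
            refine mul_le_mul_of_nonneg_left ?_ (abs_nonneg _)
            rw [abs_le]
            constructor <;> nlinarith [sq_nonneg (x i - x j), sq_nonneg (x i + x j)]
        rcases Nat.eq_zero_or_pos p with hp | hp
        · subst hp
          simp [dotProduct]
        have hp' : (0 : ℝ) < p := by positivity
        have h4 : ∀ i j, |E i j| ≤ (p : ℝ)⁻¹ * (1 / 2) := fun i j => by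
          rw [le_inv_mul_iff₀ hp']; exact h i j
        calc |x ⬝ᵥ E *ᵥ x| ≤ ∑ i, ∑ j, (p : ℝ)⁻¹ * (1 / 2) * ((x i ^ 2 + x j ^ 2) / 2) := by
              simp only [dotProduct, mulVec, Finset.mul_sum]
              refine (Finset.abs_sum_le_sum_abs _ _).trans (Finset.sum_le_sum fun i _ => ?_)
              refine (Finset.abs_sum_le_sum_abs _ _).trans (Finset.sum_le_sum fun j _ => ?_)
              exact (h3 i j).trans (mul_le_mul_of_nonneg_right (h4 i j) (by positivity))
          _ = 1 / 2 * (x ⬝ᵥ x) := by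
              have h5 : x ⬝ᵥ x = ∑ i, x i ^ 2 := by
                simp only [dotProduct]; exact Finset.sum_congr rfl fun i _ => (sq _).symm
              simp only [← Finset.mul_sum, ← Finset.sum_div, Finset.sum_add_distrib,
                Finset.sum_const, Finset.card_univ, Fintype.card_fin, nsmul_eq_mul]
              rw [h5]
              field_simp
              ring
      have := neg_abs_le (x ⬝ᵥ E *ᵥ x)
      linarith
  have hsd := hpos.posSemidef
  set H := CFC.sqrt (1 + E) with hH
  have hHH : H * H = 1 + E := CFC.sqrt_mul_sqrt_self _ hsd.nonneg
  have hHs : Hᵀ = H := by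
    have : H.PosSemidef := (CFC.sqrt_nonneg (1 + E)).posSemidef
    rw [← conjTranspose_eq_transpose_of_trivial]
    exact this.isHermitian
  have hdet : IsUnit H.det := by
    have h1 := hpos.det_pos.ne'
    rw [← hHH, det_mul] at h1
    exact isUnit_iff_ne_zero.mpr (left_ne_zero_of_mul h1)
  refine ⟨H⁻¹, ?_⟩
  rw [← hHH, transpose_nonsing_inv, hHs, ← Matrix.mul_assoc, nonsing_inv_mul H hdet,
    Matrix.one_mul, mul_nonsing_inv H hdet]

/-! ### Expansion of the scaled error on the event of small errors -/

section Expansion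

variable {Ω : Type*} [MeasurableSpace Ω] {μ : Measure Ω} {d p k n : ℕ}
  {Z : Fin p → EuclideanSpace ℝ (Fin d) → Ω → ℝ} {W : Matrix (Fin p) (Fin p) ℝ}
  {K : Fin p → EuclideanSpace ℝ (Fin d) → ℝ}
  {s : Fin n → EuclideanSpace ℝ (Fin d)} {f : Fin k → EuclideanSpace ℝ (Fin d) → ℝ}

omit [MeasurableSpace Ω] in
lemma unmixed_eq_diagonal_add_errMat (g : EuclideanSpace ℝ (Fin d) → ℝ) (ω : Ω) :
    W⁻¹ * sampleLocalCov (mixedField W Z) s g ω * (Wᵀ)⁻¹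
      = diagonal (specDiag K s g) + errMat W Z K s g ω := by
  rw [errMat]; abel

-- The estimator is only known to be a maximiser when the constraint set is non-empty; small errors
-- guarantee this.
omit [MeasurableSpace Ω] in
lemma exists_constraint (hW : IsUnit W.det) (hf : ∀ l x, f l (-x) = f l x)
    (h0 : ∀ a, specDiag K s kernelZero a = 1) {ω : Ω} (h : errBound W Z K s f ω ≤ 1 / 2) :
    ∃ Γ : Matrix (Fin p) (Fin p) ℝ,
      Γ * sampleLocalCov (mixedField W Z) s kernelZero ω * Γᵀ = 1 := by
  have hsum : ∀ i j, |errMat W Z K s kernelZero ω i j|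
      ≤ √(∑ a, errVec W Z K s f ω a ^ 2) := fun i j => by
    have h1 : errVec W Z K s f ω (0, (i, j)) ^ 2 ≤ ∑ a, errVec W Z K s f ω a ^ 2 :=
      Finset.single_le_sum (f := fun a => errVec W Z K s f ω a ^ 2) (fun _ _ => sq_nonneg _)
        (Finset.mem_univ (0, (i, j)))
    exact Real.abs_le_sqrt h1
  obtain ⟨Γ, hΓ⟩ := exists_mul_mul_transpose_eq_one
    (errMat_transpose (K := K) (Z := Z) hW s (kernels_neg hf 0) ω)
    (fun i j => (mul_le_mul_of_nonneg_left (hsum i j) (Nat.cast_nonneg _)).trans h)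
  refine ⟨Γ * W⁻¹, ?_⟩
  have h1 := unmixed_eq_diagonal_add_errMat (W := W) (Z := Z) (K := K) (s := s) kernelZero ω
  rw [show specDiag K s kernelZero = fun _ => 1 from funext h0, diagonal_one] at h1
  have h2 : errMat W Z K s (kernels f 0) ω = errMat W Z K s kernelZero ω := rfl
  rw [h2, ← h1] at hΓ
  rw [transpose_mul, transpose_nonsing_inv]
  simpa only [Matrix.mul_assoc] using hΓ

lemma norm_toLp_le_sum {ι : Type*} [Fintype ι] (v : ι → ℝ) : ‖WithLp.toLp 2 v‖ ≤ ∑ i, |v i| := by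
  classical
  have h : WithLp.toLp 2 v = ∑ i, v i • EuclideanSpace.single i (1 : ℝ) := by
    ext j
    simp [Finset.sum_apply, Pi.single_apply]
  rw [h]
  refine (norm_sum_le _ _).trans (le_of_eq ?_)
  simp [norm_smul]

open scoped Matrix.Norms.Frobenius in
/-- On the event that the errors are small, the scaled error is well approximated by the linear
one for any admissible choice of the signed permutation, and there is such a choice. -/
lemma exists_scaledError_sub_linearError_le (k p : ℕ) {W : Matrix (Fin p) (Fin p) ℝ}
    (hW : IsUnit W.det) {C δ : ℝ} (hC : 0 ≤ C) (hδ : 0 < δ) :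
    ∃ η₀ > 0, ∃ ε > 0, ∃ L ≥ 0, ∀ (Ω : Type*) (_ : MeasurableSpace Ω) (μ : Measure Ω) (d n : ℕ)
      (Z : Fin p → EuclideanSpace ℝ (Fin d) → Ω → ℝ) (K : Fin p → EuclideanSpace ℝ (Fin d) → ℝ)
      (s : Fin n → EuclideanSpace ℝ (Fin d)) (f : Fin k → EuclideanSpace ℝ (Fin d) → ℝ)
      (Γ : Matrix (Fin p) (Fin p) ℝ) (ω : Ω),
      (∀ l, unmixedPopCov μ W Z s (f l) = diagonal (specDiag K s (f l))) →
      (∀ l x, f l (-x) = f l x) → (∀ a, specDiag K s kernelZero a = 1) →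
      (∀ l i, |unmixedPopCov μ W Z s (f l) i i| ≤ C) →
      (∀ i j, i ≠ j → ∃ l, δ ≤
        |unmixedPopCov μ W Z s (f l) i i - unmixedPopCov μ W Z s (f l) j j|) →
      ((∃ Γ : Matrix (Fin p) (Fin p) ℝ,
          Γ * sampleLocalCov (mixedField W Z) s kernelZero ω * Γᵀ = 1) →
        IsMaximiser (sampleLocalCov (mixedField W Z) s kernelZero ω)
          (fun l => sampleLocalCov (mixedField W Z) s (f l) ω) Γ) →
      errBound W Z K s f ω ≤ η₀ →
      (∃ Q, ‖signedPerm Q * (Γ * W) - 1‖ < ε) ∧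
      ∀ Q, ‖signedPerm Q * (Γ * W) - 1‖ < ε →
        ‖scaledError n W (signSide Q) (Q.1.permMatrix ℝ) Γ - linearError μ W Z K s f ω‖
          ≤ L * (√(n : ℝ) * errBound W Z K s f ω ^ 2) := by
  obtain ⟨η₀, hη₀, ε, hε, κ, hκ, hmain⟩ := joint_diagonaliser_expansion k p hC hδ
  obtain ⟨m, hm0, hm⟩ := exists_abs_apply_le W⁻¹
  refine ⟨min η₀ (1 / 2), by positivity, ε, hε,
    Fintype.card (Fin p × Fin p) * (Fintype.card (Fin p) * (κ * m)), by positivity, ?_⟩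
  intro Ω _ μ d n Z K s f Γ ω hdiag hf h0 hdC hgap hmax hη
  have hη1 := hη.trans (min_le_left _ _)
  have hη2 := hη.trans (min_le_right _ _)
  set η := errBound W Z K s f ω with hηdef
  have hU := (hmax (exists_constraint hW hf h0 hη2)).unmix hW
  have hd : ∀ l i, unmixedPopCov μ W Z s (f l) i i = specDiag K s (f l) i := fun l i => by
    rw [hdiag, diagonal_apply_eq]
  simp only [hd] at hdC hgap
  simp only [unmixed_eq_diagonal_add_errMat (K := K)] at hU
  rw [show specDiag K s kernelZero = fun _ => 1 from funext h0, diagonal_one] at hU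
  obtain ⟨hex, hall⟩ := hmain (fun l => specDiag K s (f l)) (errMat W Z K s kernelZero ω)
    (fun l => errMat W Z K s (f l) ω) (Γ * W) η hdC hgap
    (fun l => errMat_transpose hW s (hf l) ω) (norm_errMat_le (f := f) 0 ω)
    (fun l => norm_errMat_le (f := f) l.succ ω) hη1 hU
  refine ⟨hex, fun Q hQ => ?_⟩
  have hexp := hall Q hQ
  set F := signedPerm Q * (Γ * W) - 1 with hF
  set Lin : Matrix (Fin p) (Fin p) ℝ := Matrix.of fun i j =>
    linearPart (fun l => specDiag K s (f l)) (errMat W Z K s kernelZero ω)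
      (fun l => errMat W Z K s (f l) ω) i j with hLin
  have hlin : linMatrix μ W Z s f *ᵥ errVec W Z K s f ω = fun a => (Lin * W⁻¹) a.1 a.2 := by
    have h1 : (matG fun l => unmixedPopCov μ W Z s (f l)) *ᵥ errVec W Z K s f ω
        = fun a => Lin a.1 a.2 := by
      funext a
      have h2 := matG_mulVec (fun l => unmixedPopCov μ W Z s (f l))
        (fun l => errMat W Z K s (kernels f l) ω) a.1 a.2
      simp only [hd] at h2
      exact h2
    rw [linMatrix, ← mulVec_mulVec, h1]
    funext a
    exact matMInv_mulVec Lin a.1 a.2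
  -- The estimation error is `F * W⁻¹`, and its linear approximation in `hlin` is `Lin * W⁻¹`. Only
  -- the remainder `F - Lin` has to be estimated.
  have hsc : signSide Q * Q.1.permMatrix ℝ * Γ - W⁻¹ = F * W⁻¹ := by
    rw [hF, Matrix.sub_mul, Matrix.one_mul, ← signedPerm, Matrix.mul_assoc, Matrix.mul_assoc,
      mul_nonsing_inv W hW, Matrix.mul_one]
  have hdiff : scaledError n W (signSide Q) (Q.1.permMatrix ℝ) Γ - linearError μ W Z K s f ω
      = √(n : ℝ) • WithLp.toLp 2 fun a : Fin p × Fin p => ((F - Lin) * W⁻¹) a.1 a.2 := by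
    rw [scaledError, linearError, hsc, hlin, vect, ← smul_sub, ← WithLp.toLp_sub]
    congr 2
    funext a
    rw [Matrix.sub_mul F Lin]
    rfl
  rw [hdiff, norm_smul, Real.norm_of_nonneg (Real.sqrt_nonneg _)]
  have hent : ∀ a : Fin p × Fin p, |((F - Lin) * W⁻¹) a.1 a.2|
      ≤ Fintype.card (Fin p) * (κ * η ^ 2 * m) := fun a =>
    abs_matrix_mul_apply_le (by positivity) hexp hm a.1 a.2
  have hsum : ‖WithLp.toLp 2 fun a : Fin p × Fin p => ((F - Lin) * W⁻¹) a.1 a.2‖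
      ≤ Fintype.card (Fin p × Fin p) * (Fintype.card (Fin p) * (κ * η ^ 2 * m)) := by
    refine (norm_toLp_le_sum _).trans ((Finset.sum_le_sum fun a _ => hent a).trans (le_of_eq ?_))
    simp
  refine (mul_le_mul_of_nonneg_left hsum (Real.sqrt_nonneg _)).trans (le_of_eq ?_)
  ring

end Expansion

/-! ### Weak approximation by Gaussians with bounded covariances -/

section Approximation

/-- Two sequences with the same limit have vanishing distance, for any metric inducing the given
topology. -/
lemma tendsto_dist_of_tendsto {α : Type*} (τ : TopologicalSpace α) (dw : MetricSpace α)
    (h : dw.toUniformSpace.toTopologicalSpace = τ) {u v : ℕ → α} {a : α}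
    (hu : Tendsto u atTop (@nhds α τ a)) (hv : Tendsto v atTop (@nhds α τ a)) :
    Tendsto (fun n => dw.dist (u n) (v n)) atTop (𝓝 0) := by
  subst h
  have := hu.dist hv
  rwa [dist_self] at this

variable {ι : Type*} [Fintype ι]

lemma posSemidef_of_tendsto {F : ℕ → Matrix ι ι ℝ} {G : Matrix ι ι ℝ}
    (hF : ∀ n, (F n).PosSemidef) (h : Tendsto F atTop (𝓝 G)) : G.PosSemidef := by
  rw [posSemidef_iff_dotProduct_mulVec]
  refine ⟨?_, fun x => ?_⟩
  · refine tendsto_nhds_unique ?_ h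
    have h2 : Tendsto (fun n => (F n)ᴴ) atTop (𝓝 Gᴴ) :=
      (continuous_id.matrix_conjTranspose.tendsto G).comp h
    exact h2.congr fun n => (hF n).1
  · have hc : Continuous fun M : Matrix ι ι ℝ => star x ⬝ᵥ M *ᵥ x := by fun_prop
    exact ge_of_tendsto' ((hc.tendsto G).comp h) fun n =>
      (posSemidef_iff_dotProduct_mulVec.mp (hF n)).2 x

lemma exists_tendsto_subseq_of_abs_le {F : ℕ → Matrix ι ι ℝ} {b : ℝ} {N : ℕ}
    (hb : ∀ n, N ≤ n → ∀ i j, |F n i j| ≤ b) {ns : ℕ → ℕ} (hns : Tendsto ns atTop atTop) :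
    ∃ G, ∃ ms : ℕ → ℕ, StrictMono ms ∧ Tendsto (fun n => F (ns (ms n))) atTop (𝓝 G) := by
  have hcomp : IsCompact (Set.univ.pi fun _ : ι => Set.univ.pi fun _ : ι => Set.Icc (-b) b) :=
    isCompact_univ_pi fun _ => isCompact_univ_pi fun _ => isCompact_Icc
  obtain ⟨G, -, ms, hms, hG⟩ := hcomp.tendsto_subseq' (X := ι → ι → ℝ) (x := fun n => F (ns n))
    (((hns.eventually_ge_atTop N).mono fun n hn i _ j _ =>
      Set.mem_Icc.mpr (abs_le.mp (hb _ hn i j))).frequently)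
  exact ⟨G, ms, hms, hG⟩

variable [DecidableEq ι]

lemma tendsto_charFun_multivariateGaussian {F : ℕ → Matrix ι ι ℝ} {G : Matrix ι ι ℝ}
    (hF : ∀ n, (F n).PosSemidef) (h : Tendsto F atTop (𝓝 G)) (t : EuclideanSpace ℝ ι) :
    Tendsto (fun n => charFun (multivariateGaussian 0 (F n)) t) atTop
      (𝓝 (charFun (multivariateGaussian 0 G) t)) := by
  simp only [charFun_multivariateGaussian (hF _),
    charFun_multivariateGaussian (posSemidef_of_tendsto hF h)]
  have hc : Continuous fun M : Matrix ι ι ℝ => Complex.exp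
      ((inner ℝ t (0 : EuclideanSpace ℝ ι) : ℝ) * Complex.I - ((t ⬝ᵥ M *ᵥ t : ℝ) : ℂ) / 2) := by
    fun_prop
  exact (hc.tendsto G).comp h

/-- If `X n` is asymptotically Gaussian with bounded covariance matrices `F n`, and `Y n - X n`
vanishes in probability, then the laws of `Y n` are asymptotically Gaussian for every metric of the
weak topology. -/
lemma tendsto_dist_multivariateGaussian {Ω : Type*} [MeasurableSpace Ω] {μ : Measure Ω}
    [IsProbabilityMeasure μ] {X Y : ℕ → Ω → EuclideanSpace ℝ ι} {F : ℕ → Matrix ι ι ℝ}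
    (hX : ∀ n, AEMeasurable (X n) μ) (hY : ∀ n, AEMeasurable (Y n) μ)
    (hF : ∀ n, (F n).PosSemidef) {b : ℝ} {N : ℕ} (hb : ∀ n, N ≤ n → ∀ i j, |F n i j| ≤ b)
    (hchar : ∀ t, Tendsto (fun n => charFun (μ.map (X n)) t
      - charFun (multivariateGaussian 0 (F n)) t) atTop (𝓝 0))
    (hYX : TendstoInMeasure μ (Y - X) atTop 0)
    (dw : MetricSpace (ProbabilityMeasure (EuclideanSpace ℝ ι)))
    (hdw : dw.toUniformSpace.toTopologicalSpace = ProbabilityMeasure.instTopologicalSpace) :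
    Tendsto (fun n => dw.dist
      (⟨μ.map (Y n), Measure.isProbabilityMeasure_map (hY n)⟩ :
        ProbabilityMeasure (EuclideanSpace ℝ ι))
      (⟨multivariateGaussian 0 (F n), inferInstance⟩ :
        ProbabilityMeasure (EuclideanSpace ℝ ι))) atTop (𝓝 0) := by
  -- It suffices to treat a further subsequence along which the covariances converge. Both laws then
  -- have the same limit, and only the topology of the metric matters.
  refine tendsto_of_subseq_tendsto fun ns hns => ?_
  obtain ⟨G, ms, hms, hG⟩ := exists_tendsto_subseq_of_abs_le hb hns
  have hsub : Tendsto (fun n => ns (ms n)) atTop atTop := hns.comp hms.tendsto_atTop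
  refine ⟨ms, tendsto_dist_of_tendsto _ dw hdw (a := ⟨multivariateGaussian 0 G, inferInstance⟩)
    ?_ ?_⟩
  · have hXd : TendstoInDistribution (fun n => X (ns (ms n))) atTop
        (id : EuclideanSpace ℝ ι → EuclideanSpace ℝ ι) (fun _ => μ)
        (multivariateGaussian 0 G) := by
      refine ⟨fun n => hX _, aemeasurable_id, ?_⟩
      refine ProbabilityMeasure.tendsto_iff_tendsto_charFun.mpr fun t => ?_
      simp only [ProbabilityMeasure.coe_mk, Measure.map_id]
      have h1 := ((hchar t).comp hsub).add
        (tendsto_charFun_multivariateGaussian (fun n => hF (ns (ms n))) hG t)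
      rw [zero_add] at h1
      exact h1.congr fun n => by simp
    -- Slutsky: a perturbation that vanishes in probability does not change the limit law.
    have hYd := tendstoInDistribution_of_tendstoInMeasure_sub (fun n => Y (ns (ms n))) _ hXd
      (hYX.comp hsub) fun n => hY _
    have := hYd.tendsto
    simp only [Measure.map_id] at this
    exact this
  · exact ProbabilityMeasure.tendsto_iff_tendsto_charFun.mpr
      (tendsto_charFun_multivariateGaussian (fun n => hF (ns (ms n))) hG)

end Approximation

/-! ### Measurable choice of the signed permutation -/

section Selection

/-- Decide the finitely many candidates in turn, with an arbitrary constant as the default value. -/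
lemma exists_measurable_selection {Ω T : Type*} [MeasurableSpace Ω] [Finite T] [Nonempty T]
    [MeasurableSpace T] (A : T → Set Ω) (hA : ∀ t, MeasurableSet (A t)) :
    ∃ τ : Ω → T, Measurable τ ∧ ∀ ω, (∃ t, ω ∈ A t) → ω ∈ A (τ ω) := by
  classical
  cases nonempty_fintype T
  have h : ∀ S : Finset T, ∃ τ : Ω → T, Measurable τ ∧
      ∀ ω, (∃ t ∈ S, ω ∈ A t) → ω ∈ A (τ ω) := fun S => by
    induction S using Finset.induction_on with
    | empty => exact ⟨fun _ => Classical.arbitrary T, measurable_const, by simp⟩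
    | insert a S _ ih =>
      obtain ⟨τ, hτ, hτA⟩ := ih
      refine ⟨fun ω => if ω ∈ A a then a else τ ω, measurable_const.ite (hA a) hτ, ?_⟩
      rintro ω ⟨t, ht, hω⟩
      by_cases ha : ω ∈ A a
      · simp [ha]
      · simp only [ha, if_false]
        rcases Finset.mem_insert.mp ht with rfl | ht
        · exact absurd hω ha
        · exact hτA ω ⟨t, ht, hω⟩
  obtain ⟨τ, hτ, hτA⟩ := h Finset.univ
  exact ⟨τ, hτ, fun ω ⟨t, ht⟩ => hτA ω ⟨t, Finset.mem_univ t, ht⟩⟩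

lemma aemeasurable_scaledError {Ω : Type*} [MeasurableSpace Ω] {μ : Measure Ω} {p : ℕ} (n : ℕ)
    (W : Matrix (Fin p) (Fin p) ℝ) {D P Γ : Ω → Matrix (Fin p) (Fin p) ℝ}
    (hD : ∀ i j, Measurable fun ω => D ω i j) (hP : ∀ i j, Measurable fun ω => P ω i j)
    (hΓ : ∀ i j, AEMeasurable (fun ω => Γ ω i j) μ) :
    AEMeasurable (fun ω => scaledError n W (D ω) (P ω) (Γ ω)) μ := by
  have h1 : ∀ i j, AEMeasurable (fun ω => (D ω * P ω * Γ ω - W⁻¹) i j) μ := fun i j => by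
    simp only [Matrix.sub_apply, Matrix.mul_apply]
    refine (Finset.aemeasurable_fun_sum _ fun a _ => ?_).sub_const _
    exact (Finset.measurable_fun_sum _ fun c _ => (hD i c).mul (hP c a)).aemeasurable.mul (hΓ a j)
  have h2 : AEMeasurable (fun ω => fun a : Fin p × Fin p => (D ω * P ω * Γ ω - W⁻¹) a.1 a.2) μ :=
    aemeasurable_pi_lambda _ fun a => h1 a.1 a.2
  have h3 : Measurable (WithLp.toLp 2 :
      (Fin p × Fin p → ℝ) → EuclideanSpace ℝ (Fin p × Fin p)) := by fun_prop
  exact (h3.comp_aemeasurable h2).const_smul (√(n : ℝ))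

open scoped Matrix.Norms.Frobenius in
lemma measurableSet_norm_mul_sub_one_lt {Ω : Type*} [MeasurableSpace Ω] {p : ℕ}
    (V W : Matrix (Fin p) (Fin p) ℝ) {Γ : Ω → Matrix (Fin p) (Fin p) ℝ}
    (hΓ : ∀ i j, Measurable fun ω => Γ ω i j) {ε : ℝ} (hε : 0 < ε) :
    MeasurableSet {ω | ‖V * (Γ ω * W) - 1‖ < ε} := by
  have h : {ω | ‖V * (Γ ω * W) - 1‖ < ε}
      = {ω | ∑ i, ∑ j, ((V * (Γ ω * W) - 1) i j) ^ 2 < ε ^ 2} := by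
    ext ω
    simp only [Set.mem_ofPred_eq, ← frobenius_norm_sq]
    exact (pow_lt_pow_iff_left₀ (norm_nonneg _) hε.le two_ne_zero).symm
  rw [h]
  refine measurableSet_lt (Finset.measurable_fun_sum _ fun i _ =>
    Finset.measurable_fun_sum _ fun j _ => Measurable.pow_const ?_ 2) measurable_const
  simp only [Matrix.sub_apply, Matrix.mul_apply]
  exact (Finset.measurable_fun_sum _ fun a _ =>
    (Finset.measurable_fun_sum _ fun c _ => (hΓ a c).mul_const _).const_mul _).sub_const _

end Selection

/-! ### Limits as the number of points grows -/

section Asymptotics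

variable {Ω : Type*} [MeasurableSpace Ω] {μ : Measure Ω} [IsProbabilityMeasure μ] {d p k : ℕ}
  {Z : Fin p → EuclideanSpace ℝ (Fin d) → Ω → ℝ} {W : Matrix (Fin p) (Fin p) ℝ}
  {K : Fin p → EuclideanSpace ℝ (Fin d) → ℝ}
  {s : ∀ n : ℕ, Fin n → EuclideanSpace ℝ (Fin d)} {f : Fin k → EuclideanSpace ℝ (Fin d) → ℝ}

instance : MeasurableSpace (Equiv.Perm (Fin p) × (Fin p → ℤˣ)) := ⊤

instance : DiscreteMeasurableSpace (Equiv.Perm (Fin p) × (Fin p → ℤˣ)) := ⟨fun _ => trivial⟩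

/-- The row-sum bound `M` is uniform in `n`, so all the chi-square weights, after scaling by
`n^{-1/2}`, eventually lie where the expansion at `0` is accurate, while their squares have a
bounded sum. -/
lemma tendsto_charFun_linearError_sub (hZ : IsLatentField μ Z K) (hW : IsUnit W.det)
    (hf : ∀ l x, f l (-x) = f l x) {r B b : ℝ} {N : ℕ}
    (hR : ∀ n u, ∑ v, |latentCov μ Z (s n) u v| ≤ r)
    (hT : ∀ n l i, ∑ j, |kernels f l (s n i - s n j)| ≤ B)
    (hlin : ∀ n, N ≤ n → ∀ i j, |linMatrix μ W Z (s n) f i j| ≤ b)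
    (t : EuclideanSpace ℝ (Fin p × Fin p)) :
    Tendsto (fun n => charFun (μ.map (linearError μ W Z K (s n) f)) t
      - charFun (multivariateGaussian 0 (asympCov μ W Z (s n) f)) t) atTop (𝓝 0) := by
  set κ : ℝ := ((Fintype.card (Fin (k + 1) × (Fin p × Fin p)) : ℕ) : ℝ) with hκ
  set c₀ : ℝ := κ * ∑ i, b * |t i| with hc₀
  have hc : ∀ n, N ≤ n → ∑ a, |((linMatrix μ W Z (s n) f)ᵀ *ᵥ t) a| ≤ c₀ := fun n hn => by
    calc ∑ a, |((linMatrix μ W Z (s n) f)ᵀ *ᵥ t) a|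
        ≤ ∑ _a : Fin (k + 1) × (Fin p × Fin p), ∑ i, b * |t i| :=
          Finset.sum_le_sum fun a _ => by
            simp only [mulVec, dotProduct, transpose_apply]
            refine (Finset.abs_sum_le_sum_abs _ _).trans (Finset.sum_le_sum fun i _ => ?_)
            rw [abs_mul]
            exact mul_le_mul_of_nonneg_right (hlin n hn i a) (abs_nonneg _)
      _ = c₀ := by simp [hc₀, hκ]
  set M : ℝ := |c₀| * (p * |B|) * |r| with hM
  have hM0 : 0 ≤ M := by positivity
  have hrow : ∀ n, N ≤ n → ∀ i, ∑ j, |(combMatrix (s n) f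
      ((linMatrix μ W Z (s n) f)ᵀ *ᵥ t) * latentCov μ Z (s n)) i j| ≤ M := fun n hn i => by
    refine rowSum_mul_le (fun u => (rowSum_combMatrix_le (C := |B|)
      (fun l i => (hT n l i).trans (le_abs_self B)) _ u).trans ?_)
      (fun u => (hR n u).trans (le_abs_self r)) i
    exact mul_le_mul_of_nonneg_right ((hc n hn).trans (le_abs_self _)) (by positivity)
  rw [Metric.tendsto_atTop]
  intro e he
  -- Chosen so that `e' * (p * M ^ 2) < e`, also when `M = 0`.
  set e' : ℝ := e / (2 * (p * M ^ 2 + 1)) with he'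
  have he'0 : 0 < e' := by positivity
  obtain ⟨ρ, hρ, hball⟩ := Metric.eventually_nhds_iff.mp
    (charFun_centredChiSq_sub_isLittleO.def he'0)
  have hr : ∀ x : ℝ, |x| < ρ →
      ‖charFun centredChiSq x - Complex.exp (-(x : ℂ) ^ 2)‖ ≤ e' * x ^ 2 := fun x hx => by
    have := hball (y := x) (by simpa using hx)
    rwa [Real.norm_of_nonneg (sq_nonneg x)] at this
  have hlim : Tendsto (fun n : ℕ => (√(n : ℝ))⁻¹ * M) atTop (𝓝 0) := by
    have h1 : Tendsto (fun n : ℕ => (√(n : ℝ))⁻¹) atTop (𝓝 0) :=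
      tendsto_inv_atTop_zero.comp (Real.tendsto_sqrt_atTop.comp tendsto_natCast_atTop_atTop)
    simpa using h1.mul_const M
  obtain ⟨n₁, hn₁⟩ := eventually_atTop.mp (hlim.eventually (gt_mem_nhds hρ))
  refine ⟨max (max N n₁) 1, fun n hn => ?_⟩
  rw [dist_zero_right]
  refine (norm_charFun_linearError_sub_le hZ hW hf (by omega) t he'0.le hr
    (hrow n (by omega)) (hn₁ n (by omega))).trans_lt ?_
  rw [he', div_mul_eq_mul_div, div_lt_iff₀ (by positivity)]
  have : 0 ≤ p * M ^ 2 := by positivity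
  nlinarith

-- The squared error bound has expectation `O(n⁻¹)`. By Markov's inequality, the errors are small
-- with probability tending to `1`, and the remainder `√n * errBound ^ 2` vanishes in probability.
open scoped Matrix.Norms.Frobenius in
lemma exists_selection_tendstoInMeasure (hW : IsUnit W.det) (hZ : IsLatentField μ Z K)
    (hf : ∀ l x, f l (-x) = f l x) {r B η₀ ε L : ℝ} {N : ℕ} (hη₀ : 0 < η₀) (hε : 0 < ε)
    (hL : 0 ≤ L) (hR : ∀ n u, ∑ v, |latentCov μ Z (s n) u v| ≤ r)
    (hT : ∀ n l i, ∑ j, |kernels f l (s n i - s n j)| ≤ B)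
    (hexp : ∀ n, N ≤ n → ∀ (Γ : Matrix (Fin p) (Fin p) ℝ) (ω : Ω),
      ((∃ Γ : Matrix (Fin p) (Fin p) ℝ,
          Γ * sampleLocalCov (mixedField W Z) (s n) kernelZero ω * Γᵀ = 1) →
        IsMaximiser (sampleLocalCov (mixedField W Z) (s n) kernelZero ω)
          (fun l => sampleLocalCov (mixedField W Z) (s n) (f l) ω) Γ) →
      errBound W Z K (s n) f ω ≤ η₀ →
      (∃ Q, ‖signedPerm Q * (Γ * W) - 1‖ < ε) ∧
      ∀ Q, ‖signedPerm Q * (Γ * W) - 1‖ < ε →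
        ‖scaledError n W (signSide Q) (Q.1.permMatrix ℝ) Γ - linearError μ W Z K (s n) f ω‖
          ≤ L * (√(n : ℝ) * errBound W Z K (s n) f ω ^ 2))
    {Γhat : ℕ → Ω → Matrix (Fin p) (Fin p) ℝ}
    (hΓmeas : ∀ n i j, AEMeasurable (fun ω => Γhat n ω i j) μ)
    (hΓmax : ∀ n, ∀ᵐ ω ∂μ,
      (∃ Γ : Matrix (Fin p) (Fin p) ℝ,
        Γ * sampleLocalCov (mixedField W Z) (s n) kernelZero ω * Γᵀ = 1) →
      IsMaximiser (sampleLocalCov (mixedField W Z) (s n) kernelZero ω)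
        (fun l => sampleLocalCov (mixedField W Z) (s n) (f l) ω) (Γhat n ω)) :
    ∃ τ : ℕ → Ω → Equiv.Perm (Fin p) × (Fin p → ℤˣ), (∀ n, Measurable (τ n)) ∧
      TendstoInMeasure μ ((fun n ω => scaledError n W (signSide (τ n ω))
        ((τ n ω).1.permMatrix ℝ) (Γhat n ω)) - fun n => linearError μ W Z K (s n) f) atTop 0 := by
  have hsel : ∀ n, ∃ τ : Ω → Equiv.Perm (Fin p) × (Fin p → ℤˣ), Measurable τ ∧
      ∀ᵐ ω ∂μ, (∃ Q, ‖signedPerm Q * (Γhat n ω * W) - 1‖ < ε) →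
        ‖signedPerm (τ ω) * (Γhat n ω * W) - 1‖ < ε := fun n => by
    -- The estimator is only almost everywhere measurable. Selecting from a measurable version makes
    -- `τ` measurable, as required of `P` and `D`.
    set Γ' : Ω → Matrix (Fin p) (Fin p) ℝ := fun ω => Matrix.of fun i j =>
      (hΓmeas n i j).mk _ ω with hΓ'
    obtain ⟨τ, hτ, hτA⟩ := exists_measurable_selection
      (fun Q => {ω | ‖signedPerm Q * (Γ' ω * W) - 1‖ < ε}) fun Q =>
        measurableSet_norm_mul_sub_one_lt (signedPerm Q) W
          (fun i j => (hΓmeas n i j).measurable_mk) hε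
    refine ⟨τ, hτ, ?_⟩
    have hae : ∀ᵐ ω ∂μ, ∀ i j, Γhat n ω i j = (hΓmeas n i j).mk _ ω :=
      ae_all_iff.mpr fun i => ae_all_iff.mpr fun j => (hΓmeas n i j).ae_eq_mk
    filter_upwards [hae] with ω hω
    have hΓω : Γhat n ω = Γ' ω := by
      ext i j
      exact hω i j
    rw [hΓω]
    exact hτA ω
  choose τ hτ hτA using hsel
  refine ⟨τ, hτ, ?_⟩
  rw [tendstoInMeasure_iff_measureReal_norm]
  intro e he
  set c : ℝ := p ^ 2 * (Fintype.card (Fin (k + 1) × (Fin p × Fin p)) *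
    (2 * p * (p * B * r) ^ 2)) with hc
  have hint := fun n => integral_errBound_sq_le (W := W) hZ hW hf (hR n)
    (fun l b c u => rowSum_kernelMatrix_le (hT n l) b c u)
  have hmarkov : ∀ n : ℕ, ∀ x : ℝ, 0 < x →
      μ.real {ω | x ≤ errBound W Z K (s n) f ω ^ 2} ≤ c * (n : ℝ)⁻¹ / x := fun n x hx => by
    rw [le_div_iff₀' hx]
    exact (mul_meas_ge_le_integral_of_nonneg (.of_forall fun ω => sq_nonneg _) (hint n).1 x).trans
      (hint n).2
  have hinv : Tendsto (fun n : ℕ => (√(n : ℝ))⁻¹) atTop (𝓝 0) :=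
    tendsto_inv_atTop_zero.comp (Real.tendsto_sqrt_atTop.comp tendsto_natCast_atTop_atTop)
  have hbound : Tendsto (fun n : ℕ => c * (n : ℝ)⁻¹ / η₀ ^ 2
      + c * (L + 1) / e * (√(n : ℝ))⁻¹) atTop (𝓝 0) := by
    have h1 : Tendsto (fun n : ℕ => c * (n : ℝ)⁻¹ / η₀ ^ 2) atTop (𝓝 0) := by
      simpa using (tendsto_inv_atTop_nhds_zero_nat (𝕜 := ℝ)).const_mul c |>.div_const (η₀ ^ 2)
    simpa using h1.add (hinv.const_mul (c * (L + 1) / e))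
  refine tendsto_of_tendsto_of_tendsto_of_le_of_le' tendsto_const_nhds hbound
    (.of_forall fun n => measureReal_nonneg) ?_
  filter_upwards [eventually_ge_atTop (max N 1)] with n hn
  have hn0 : (0 : ℝ) < √(n : ℝ) := by
    have : 0 < n := by omega
    positivity
  -- `L + 1` in place of `L` because `L` may vanish. Against this threshold, Markov's inequality
  -- leaves a probability of order `n^{-1/2}`.
  have hx : 0 < e / ((L + 1) * √(n : ℝ)) := by positivity
  have hsub : {ω | e ≤ ‖((fun n ω => scaledError n W (signSide (τ n ω))
        ((τ n ω).1.permMatrix ℝ) (Γhat n ω)) - fun n => linearError μ W Z K (s n) f) n ω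
          - (0 : Ω → EuclideanSpace ℝ (Fin p × Fin p)) ω‖}
      ≤ᵐ[μ] ({ω | η₀ ^ 2 ≤ errBound W Z K (s n) f ω ^ 2} ∪
        {ω | e / ((L + 1) * √(n : ℝ)) ≤ errBound W Z K (s n) f ω ^ 2} : Set Ω) := by
    filter_upwards [hΓmax n, hτA n] with ω hω hωτ hωe
    by_cases hη : errBound W Z K (s n) f ω ≤ η₀
    · right
      obtain ⟨hex, hall⟩ := hexp n (by omega) (Γhat n ω) ω hω hη
      have h1 := hall _ (hωτ hex)
      have h2 : e ≤ ‖scaledError n W (signSide (τ n ω)) ((τ n ω).1.permMatrix ℝ) (Γhat n ω)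
          - linearError μ W Z K (s n) f ω‖ := by
        have h3 : e ≤ ‖scaledError n W (signSide (τ n ω)) ((τ n ω).1.permMatrix ℝ) (Γhat n ω)
          - linearError μ W Z K (s n) f ω - 0‖ := hωe
        rwa [sub_zero] at h3
      have h4 := h2.trans h1
      change e / ((L + 1) * √(n : ℝ)) ≤ errBound W Z K (s n) f ω ^ 2
      rw [div_le_iff₀ (by positivity)]
      have h5 : 0 ≤ √(n : ℝ) * errBound W Z K (s n) f ω ^ 2 := by positivity
      linarith
    · left
      change η₀ ^ 2 ≤ errBound W Z K (s n) f ω ^ 2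
      exact pow_le_pow_left₀ hη₀.le (not_le.mp hη).le 2
  have h6 : μ.real {ω | e ≤ ‖((fun n ω => scaledError n W (signSide (τ n ω))
        ((τ n ω).1.permMatrix ℝ) (Γhat n ω)) - fun n => linearError μ W Z K (s n) f) n ω
          - (0 : Ω → EuclideanSpace ℝ (Fin p × Fin p)) ω‖}
      ≤ μ.real ({ω | η₀ ^ 2 ≤ errBound W Z K (s n) f ω ^ 2} ∪
        {ω | e / ((L + 1) * √(n : ℝ)) ≤ errBound W Z K (s n) f ω ^ 2} : Set Ω) :=
    ENNReal.toReal_mono (measure_ne_top _ _) (measure_mono_ae hsub)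
  refine h6.trans ((measureReal_union_le _ _).trans (add_le_add (hmarkov n _ (by positivity)) ?_))
  refine (hmarkov n _ hx).trans (le_of_eq ?_)
  have hsq : (n : ℝ)⁻¹ = (√(n : ℝ))⁻¹ * (√(n : ℝ))⁻¹ := by
    rw [← mul_inv, Real.mul_self_sqrt (Nat.cast_nonneg n)]
  rw [hsq]
  field_simp

-- Every constant comes from the packing bound, `A` and `δ`, and is therefore independent of `n`.
-- The last claim needs `n ≥ 1` because it uses `D(f₀) = 1`, which fails for an empty sample.
open scoped Matrix.Norms.Frobenius in
lemma exists_uniform_bounds (hW : IsUnit W.det) (hZ : IsLatentField μ Z K)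
    (hZunit : ∀ a b x, ∫ ω, Z a x ω * Z b x ω ∂μ = if a = b then 1 else 0)
    {Δ : ℝ} (hΔ : 0 < Δ) (hs : ∀ n, ∀ i j : Fin n, i ≠ j → Δ ≤ ‖s n i - s n j‖)
    {A α : ℝ} (hA : 0 < A) (hα : 0 < α)
    (hK : ∀ a x, |K a x| ≤ A / (1 + ‖x‖ ^ ((d : ℝ) + α)))
    (hf : ∀ l x, |f l x| ≤ A / (1 + ‖x‖ ^ ((d : ℝ) + α)))
    (hfeven : ∀ l x, f l (-x) = f l x) {δ : ℝ} (hδ : 0 < δ) {n₀ : ℕ}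
    (hident : ∀ n, n₀ ≤ n → ∀ i j : Fin p, i ≠ j → ∃ l : Fin k,
      δ ≤ |unmixedPopCov μ W Z (s n) (f l) i i - unmixedPopCov μ W Z (s n) (f l) j j|) :
    ∃ r B b η₀ ε L : ℝ, 0 < η₀ ∧ 0 < ε ∧ 0 ≤ L ∧
      (∀ n u, ∑ v, |latentCov μ Z (s n) u v| ≤ r) ∧
      (∀ n l i, ∑ j, |kernels f l (s n i - s n j)| ≤ B) ∧
      (∀ n, n₀ ≤ n → ∀ i j, |linMatrix μ W Z (s n) f i j| ≤ b) ∧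
      (∀ n, n₀ ≤ n → ∀ i j, |asympCov μ W Z (s n) f i j| ≤ b) ∧
      ∀ n, max n₀ 1 ≤ n → ∀ (Γ : Matrix (Fin p) (Fin p) ℝ) (ω : Ω),
        ((∃ Γ : Matrix (Fin p) (Fin p) ℝ,
            Γ * sampleLocalCov (mixedField W Z) (s n) kernelZero ω * Γᵀ = 1) →
          IsMaximiser (sampleLocalCov (mixedField W Z) (s n) kernelZero ω)
            (fun l => sampleLocalCov (mixedField W Z) (s n) (f l) ω) Γ) →
        errBound W Z K (s n) f ω ≤ η₀ →
        (∃ Q, ‖signedPerm Q * (Γ * W) - 1‖ < ε) ∧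
        ∀ Q, ‖signedPerm Q * (Γ * W) - 1‖ < ε →
          ‖scaledError n W (signSide Q) (Q.1.permMatrix ℝ) Γ - linearError μ W Z K (s n) f ω‖
            ≤ L * (√(n : ℝ) * errBound W Z K (s n) f ω ^ 2) := by
  obtain ⟨C, hC0, hC⟩ := exists_sum_inv_one_add_rpow_le d hα hΔ
  have hsum : ∀ {g : EuclideanSpace ℝ (Fin d) → ℝ} {a : ℝ}, 0 ≤ a →
      (∀ x, |g x| ≤ a * (1 + ‖x‖ ^ ((d : ℝ) + α))⁻¹) →
      ∀ n i, ∑ j, |g (s n i - s n j)| ≤ a * C := fun ha hg n i => by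
    refine (Finset.sum_le_sum fun j _ => hg _).trans ?_
    rw [← Finset.mul_sum]
    exact mul_le_mul_of_nonneg_left (hC n (s n) (hs n) i) ha
  have hR : ∀ n u, ∑ v, |latentCov μ Z (s n) u v| ≤ A * C := fun n =>
    rowSum_latentCov_le hZ.gauss hZ.mean hZ.cov fun a i =>
      hsum hA.le (fun x => (hK a x).trans_eq (div_eq_mul_inv _ _)) n i
  have hT : ∀ n l i, ∑ j, |kernels f l (s n i - s n j)| ≤ max A 1 * C := fun n l i =>
    hsum (by positivity) (abs_kernels_le hα hf l) n i
  -- The two descriptions of the covariance of `Z` agree at equal points.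
  have hK1 : ∀ a, K a 0 = 1 := fun a => by
    have h1 := hZ.cov a a 0 0
    rw [hZunit, sub_zero] at h1
    simpa using h1.symm
  have hKA : ∀ a x, |K a x| ≤ A := fun a x =>
    (hK a x).trans (div_le_self hA.le (le_add_of_nonneg_right (by positivity)))
  have hdiag := fun n l => unmixedPopCov_eq_diagonal hW hZ.gauss hZ.cov (s n) (f l)
  have hD : ∀ n l i, |unmixedPopCov μ W Z (s n) (f l) i i| ≤ max A 1 * C * A := fun n l i => by
    rw [hdiag, diagonal_apply_eq]
    exact abs_specDiag_le hA.le (by positivity) (hT n l.succ) hKA i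
  obtain ⟨b, -, hb⟩ := exists_linMatrix_asympCov_le k p W (δ := δ) (C := max A 1 * C * A)
    (r := A * C) (B := p * (max A 1 * C)) hδ
  obtain ⟨η₀, hη₀, ε, hε, L, hL, hexp⟩ := exists_scaledError_sub_linearError_le k p hW
    (C := max A 1 * C * A) (by positivity) hδ
  have hb' := fun n (hn : n₀ ≤ n) => hb Ω _ μ d n Z (s n) f (hR n)
    (fun l b c u => rowSum_kernelMatrix_le (hT n l) b c u) (hD n) (hident n hn)
  refine ⟨A * C, max A 1 * C, b, η₀, ε, L, hη₀, hε, hL, hR, hT, fun n hn => (hb' n hn).1,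
    fun n hn => (hb' n hn).2, fun n hn Γ ω hmax hη => ?_⟩
  refine hexp Ω _ μ d n Z K (s n) f Γ ω (hdiag n) hfeven
    (specDiag_kernelZero (by omega) (fun i j hij h => ?_) hK1) (hD n)
    (hident n (by omega)) hmax hη
  have := hs n i j hij
  rw [h, sub_self, norm_zero] at this
  linarith

end Asymptotics

end SBSS

end

theorem proposition7 {Ω : Type*} [MeasurableSpace Ω] (μ : Measure Ω) [IsProbabilityMeasure μ]
    {d p k : ℕ}
    -- latent field, mixing matrix, covariance functions, sampling points, kernels
    (Z : Fin p → EuclideanSpace ℝ (Fin d) → Ω → ℝ)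
    (W : Matrix (Fin p) (Fin p) ℝ) (hW : IsUnit W.det)
    (K : Fin p → EuclideanSpace ℝ (Fin d) → ℝ)
    (s : ∀ n : ℕ, Fin n → EuclideanSpace ℝ (Fin d))
    (f : Fin k → EuclideanSpace ℝ (Fin d) → ℝ)
    -- the components of the latent field are independent Gaussian processes
    (hZmeas : ∀ a x, Measurable (Z a x))
    (hZgauss : ∀ a, IsGaussianProcess (Z a) μ)
    (hZindep : iIndepFun (fun (a : Fin p) (ω : Ω) (x : EuclideanSpace ℝ (Fin d)) => Z a x ω) μ)
    -- mean zero, identity covariance, stationary diagonal cross-covariance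
    (hZmean : ∀ a x, ∫ ω, Z a x ω ∂μ = 0)
    (hZunit : ∀ a b x, ∫ ω, Z a x ω * Z b x ω ∂μ = if a = b then 1 else 0)
    (hZcov : ∀ a b x y, ∫ ω, Z a x ω * Z b y ω ∂μ = if a = b then K a (x - y) else 0)
    -- minimal distance between the sampling points
    (Δ : ℝ) (hΔ : 0 < Δ) (hs : ∀ n, ∀ i j : Fin n, i ≠ j → Δ ≤ ‖s n i - s n j‖)
    -- decay of the covariance functions and of the kernels
    (A α : ℝ) (hA : 0 < A) (hα : 0 < α)
    (hK : ∀ a x, |K a x| ≤ A / (1 + ‖x‖ ^ ((d : ℝ) + α)))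
    (hf : ∀ l x, |f l x| ≤ A / (1 + ‖x‖ ^ ((d : ℝ) + α)))
    -- the kernels are even
    (hfeven : ∀ l x, f l (-x) = f l x)
    -- asymptotic identifiability
    (δ : ℝ) (hδ : 0 < δ) (n₀ : ℕ)
    (hident : ∀ n, n₀ ≤ n → ∀ i j : Fin p, i ≠ j → ∃ l : Fin k,
      δ ≤ |SBSS.unmixedPopCov μ W Z (s n) (f l) i i - SBSS.unmixedPopCov μ W Z (s n) (f l) j j|)
    -- a sequence of random maximisers (whenever the constraint set is non-empty)
    (Γhat : ℕ → Ω → Matrix (Fin p) (Fin p) ℝ)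
    (hΓmeas : ∀ n i j, AEMeasurable (fun ω => Γhat n ω i j) μ)
    (hΓmax : ∀ n, ∀ᵐ ω ∂μ,
      (∃ Γ : Matrix (Fin p) (Fin p) ℝ,
        Γ * SBSS.sampleLocalCov (SBSS.mixedField W Z) (s n) SBSS.kernelZero ω * Γᵀ = 1) →
      SBSS.IsMaximiser
        (SBSS.sampleLocalCov (SBSS.mixedField W Z) (s n) SBSS.kernelZero ω)
        (fun l => SBSS.sampleLocalCov (SBSS.mixedField W Z) (s n) (f l) ω)
        (Γhat n ω)) :
    -- the matrices `F_k` are covariance matrices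
    (∀ n, (SBSS.asympCov μ W Z (s n) f).PosSemidef) ∧
    -- random permutation matrices `P` and random sign matrices `D`
    ∃ (P D : ℕ → Ω → Matrix (Fin p) (Fin p) ℝ)
      (hmeas : ∀ n, AEMeasurable (fun ω => SBSS.scaledError n W (D n ω) (P n ω) (Γhat n ω)) μ),
      (∀ n i j, Measurable fun ω => P n ω i j) ∧
      (∀ n i j, Measurable fun ω => D n ω i j) ∧
      (∀ n ω, ∃ σ : Equiv.Perm (Fin p), P n ω = σ.permMatrix ℝ) ∧
      (∀ n ω, ∃ ε : Fin p → ℝ, (∀ i, ε i = 1 ∨ ε i = -1) ∧ D n ω = Matrix.diagonal ε) ∧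
      -- for every metric `dw` generating the topology of weak convergence
      ∀ dw : MetricSpace (ProbabilityMeasure (EuclideanSpace ℝ (Fin p × Fin p))),
        SBSS.GeneratesWeakTopology p dw →
        Tendsto
          (fun n => dw.dist
            (⟨μ.map (fun ω => SBSS.scaledError n W (D n ω) (P n ω) (Γhat n ω)),
              Measure.isProbabilityMeasure_map (hmeas n)⟩ :
              ProbabilityMeasure (EuclideanSpace ℝ (Fin p × Fin p)))
            (⟨multivariateGaussian 0 (SBSS.asympCov μ W Z (s n) f), inferInstance⟩ :
              ProbabilityMeasure (EuclideanSpace ℝ (Fin p × Fin p))))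
          atTop (𝓝 0) := by
  have hZ : SBSS.IsLatentField μ Z K := ⟨hZmeas, hZgauss, hZindep, hZmean, hZcov⟩
  have hF : ∀ n, (SBSS.asympCov μ W Z (s n) f).PosSemidef := fun n =>
    SBSS.posSemidef_asympCov hZgauss hfeven
  obtain ⟨r, B, b, η₀, ε, L, hη₀, hε, hL, hR, hT, hlin, hcov, hexp⟩ :=
    SBSS.exists_uniform_bounds hW hZ hZunit hΔ hs hA hα hK hf hfeven hδ hident
  obtain ⟨τ, hτ, hYX⟩ := SBSS.exists_selection_tendstoInMeasure hW hZ hfeven hη₀ hε hL hR hT hexp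
    hΓmeas hΓmax
  have hPm : ∀ n i j, Measurable fun ω => (τ n ω).1.permMatrix ℝ i j := fun n i j =>
    (measurable_of_finite fun Q : Equiv.Perm (Fin p) × (Fin p → ℤˣ) =>
      Q.1.permMatrix ℝ i j).comp (hτ n)
  have hDm : ∀ n i j, Measurable fun ω => SBSS.signSide (τ n ω) i j := fun n i j =>
    (measurable_of_finite fun Q : Equiv.Perm (Fin p) × (Fin p → ℤˣ) =>
      SBSS.signSide Q i j).comp (hτ n)
  have hY := fun n => SBSS.aemeasurable_scaledError n W (hDm n) (hPm n) (hΓmeas n)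
  refine ⟨hF, fun n ω => (τ n ω).1.permMatrix ℝ, fun n ω => SBSS.signSide (τ n ω), hY, hPm, hDm,
    fun n ω => ⟨_, rfl⟩, fun n ω => ⟨_, fun i => ?_, rfl⟩, fun dw hdw => ?_⟩
  · rcases Int.units_eq_one_or ((τ n ω).2 i) with h | h <;> simp [h]
  · exact SBSS.tendsto_dist_multivariateGaussian
      (fun n => (SBSS.measurable_linearError hZ hW hfeven).aemeasurable) hY hF
      (fun n hn => hcov n hn)
      (SBSS.tendsto_charFun_linearError_sub hZ hW hfeven hR hT hlin) hYX dw hdw
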